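/- Let $n\ge 1$. All functions are complex valued, functions that agree almost everywhere are identified, and balls are Euclidean balls of positive radius. **Hardy space.** Fix $b>1$ and $K>0$. Let $\Phi_1$ be the set of smooth functions $\phi$ on $\mathbb{R}^n$ with support in $B(0,1)$ and $\sup|\nabla\phi|\le K$, put $\phi_t(y)=t^{-n}\phi(y/t)$, and for $f\in L^1(\mathbb{R}^n)$ let $$\mathcal{M}f(x)=\sup_{\phi\in\Phi_1,\ t>0,\ |y-x|<bt}|f*\phi_t(y)| .$$ The Hardy space $H^1(\mathbb{R}^n)$ consists of all $f\in L^1(\mathbb{R}^n)$ with $\|f\|_{H^1}:=\|\mathcal{M}f\|_{L^1}<\infty$. **Atoms.** For $1<q\le\infty$ a $(1,q)$-atom is a function $a$ that vanishes outside some ball $B$ and satisfies $\|a\|_q\le|B|^{-1+1/q}$ and $\int_B a=0$. A $(1,q)$-atomic decomposition of $f$ is a representation $f=\sum_{j\in\mathbb{N}}\lambda_ja_j$, convergent in $L^1$, with $(1,q)$-atoms $a_j$ and $\sum_j|\lambda_j|<\infty$. **BMO and VMO.** $\mathrm{BMO}(\mathbb{R}^n)$ is the space of locally integrable $g$ with $$\|g\|_{\mathrm{BMO}}=\sup_B\frac1{|B|}\int_B\Big|g-\frac1{|B|}\int_Bg\Big|<\infty$$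 (supremum over all balls) modulo constants, and $\mathrm{VMO}(\mathbb{R}^n)$ is the closure in $\mathrm{BMO}(\mathbb{R}^n)$ of the space of (classes of) continuous functions with compact support. **Proposition 6.30.** The Hardy space $H^1(\mathbb{R}^n)$ is the Banach space dual of $\mathrm{VMO}(\mathbb{R}^n)$, with equivalent norms, the duality being given by the atomic pairing. That is, there is a linear homeomorphism $T$ from $H^1(\mathbb{R}^n)$ (with the norm $\|\cdot\|_{H^1}$) onto the space $\mathrm{VMO}(\mathbb{R}^n)'$ of bounded linear functionals on $\mathrm{VMO}(\mathbb{R}^n)$ (with the dual norm) such that for every $1<q\le\infty$ every $f\in H^1(\mathbb{R}^n)$ has a $(1,q)$-atomic decomposition, and for every $(1,q)$-atomic decomposition $f=\sum_j\lambda_ja_j$, every $v\in\mathrm{VMO}(\mathbb{R}^n)$ and every representative $g$ of $v$, the functions $a_jg$ are integrable and $$T(f)(v)=\sum_j\lambda_j\int_{\mathbb{R}^n}a_j(x)\,g(x)\,dx ,$$ the series being absolutely convergent. -/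

import Mathlib

open MeasureTheory Metric Set Filter Topology
open scoped ENNReal ContDiff

noncomputable section

/-- Euclidean `n`-space. -/
abbrev Eucl (n : ℕ) : Type := EuclideanSpace ℝ (Fin n)

/-- `L¹(ℝⁿ)`, complex valued. -/
abbrev LOne (n : ℕ) : Type := Lp ℂ 1 (volume : Measure (Eucl n))

/-! ### The Hardy space -/

/-- The class `Φ₁` of smooth functions supported in the unit ball whose `C¹`-seminorm is at most
`K`. -/
def IsTestFun (n : ℕ) (K : ℝ) (φ : Eucl n → ℂ) : Prop :=
  ContDiff ℝ ∞ φ ∧ tsupport φ ⊆ ball 0 1 ∧ ∀ x, ‖fderiv ℝ φ x‖ ≤ K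

/-- The dilate `φ_t(y) = t⁻ⁿ φ(y/t)`. -/
def dilate {n : ℕ} (φ : Eucl n → ℂ) (t : ℝ) (y : Eucl n) : ℂ :=
  ((t ^ n)⁻¹ : ℝ) • φ (t⁻¹ • y)

/-- The convolution `f * φ_t`. -/
def convDilate {n : ℕ} (f φ : Eucl n → ℂ) (t : ℝ) (y : Eucl n) : ℂ :=
  ∫ z, f z * dilate φ t (y - z)

/-- The non-tangential grand maximal function with aperture `b`. -/
def grandMax {n : ℕ} (b K : ℝ) (f : Eucl n → ℂ) (x : Eucl n) : ℝ≥0∞ :=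
  ⨆ (φ : Eucl n → ℂ) (_ : IsTestFun n K φ) (t : ℝ) (_ : 0 < t) (y : Eucl n)
    (_ : dist y x < b * t), ‖convDilate f φ t y‖ₑ

lemma integrable_mul_dilate {n : ℕ} {K : ℝ} {f φ : Eucl n → ℂ} (hf : Integrable f)
    (hφ : IsTestFun n K φ) (t : ℝ) (y : Eucl n) :
    Integrable (fun z => f z * dilate φ t (y - z)) := by
  have hc : Continuous φ := hφ.1.continuous
  have hs : HasCompactSupport φ :=
    HasCompactSupport.of_support_subset_isCompact (isCompact_closedBall (0 : Eucl n) 1)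
      ((subset_tsupport φ).trans (hφ.2.1.trans ball_subset_closedBall))
  obtain ⟨C, hC⟩ := hc.bounded_above_of_compact_support hs
  refine hf.mul_bdd (c := |(t ^ n)⁻¹| * C) ?_ (Eventually.of_forall fun z => ?_)
  · unfold dilate
    exact Continuous.aestronglyMeasurable (by fun_prop)
  · simp only [dilate, norm_smul, Real.norm_eq_abs]
    exact mul_le_mul_of_nonneg_left (hC _) (abs_nonneg _)

lemma grandMax_add_le {n : ℕ} (b K : ℝ) {f g : Eucl n → ℂ} (hf : Integrable f)
    (hg : Integrable g) (x : Eucl n) :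
    grandMax b K (f + g) x ≤ grandMax b K f x + grandMax b K g x := by
  unfold grandMax
  refine iSup_le fun φ => iSup_le fun hφ => iSup_le fun t => iSup_le fun ht => iSup_le fun y =>
    iSup_le fun hy => ?_
  have h : convDilate (f + g) φ t y = convDilate f φ t y + convDilate g φ t y := by
    unfold convDilate
    rw [← integral_add (integrable_mul_dilate hf hφ t y) (integrable_mul_dilate hg hφ t y)]
    simp [add_mul]
  rw [h]
  refine (enorm_add_le _ _).trans (add_le_add ?_ ?_)
  · exact le_iSup₂_of_le φ hφ (le_iSup₂_of_le t ht (le_iSup₂_of_le y hy le_rfl))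
  · exact le_iSup₂_of_le φ hφ (le_iSup₂_of_le t ht (le_iSup₂_of_le y hy le_rfl))

lemma grandMax_smul {n : ℕ} (b K : ℝ) (c : ℂ) (f : Eucl n → ℂ) (x : Eucl n) :
    grandMax b K (c • f) x = ‖c‖ₑ * grandMax b K f x := by
  have h : ∀ φ t y, ‖convDilate (c • f) φ t y‖ₑ = ‖c‖ₑ * ‖convDilate f φ t y‖ₑ := by
    intro φ t y
    rw [← enorm_mul]
    unfold convDilate
    rw [← integral_const_mul]
    simp [mul_assoc]
  simp only [grandMax, h, ENNReal.mul_iSup]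

lemma grandMax_congr {n : ℕ} (b K : ℝ) {f g : Eucl n → ℂ} (h : f =ᵐ[volume] g) :
    grandMax b K f = grandMax b K g := by
  have h' : ∀ φ t y, convDilate f φ t y = convDilate g φ t y := fun φ t y =>
    integral_congr_ae (h.mono fun z hz => by simp only [hz])
  funext x
  simp only [grandMax, h']

lemma measurable_grandMax {n : ℕ} (b K : ℝ) (f : Eucl n → ℂ) :
    Measurable (grandMax b K f) := by
  refine LowerSemicontinuous.measurable ?_
  refine lowerSemicontinuous_iSup fun φ => lowerSemicontinuous_iSup fun hφ =>
    lowerSemicontinuous_iSup fun t => lowerSemicontinuous_iSup fun ht =>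
    lowerSemicontinuous_iSup fun y => ?_
  rw [lowerSemicontinuous_iff_isOpen_preimage]
  intro α
  have hset : ∀ x, α < (⨆ (_ : dist y x < b * t), ‖convDilate f φ t y‖ₑ) ↔
      x ∈ ball y (b * t) ∧ α < ‖convDilate f φ t y‖ₑ := by
    intro x
    rw [lt_iSup_iff, exists_prop, mem_ball, dist_comm y x]
  by_cases hα : α < ‖convDilate f φ t y‖ₑ
  · have he : (fun x => ⨆ (_ : dist y x < b * t), ‖convDilate f φ t y‖ₑ) ⁻¹' Ioi α =
        ball y (b * t) := by
      refine Set.ext fun x => ?_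
      rw [mem_preimage, mem_Ioi, hset, and_iff_left hα]
    rw [he]
    exact isOpen_ball
  · have he : (fun x => ⨆ (_ : dist y x < b * t), ‖convDilate f φ t y‖ₑ) ⁻¹' Ioi α = ∅ := by
      refine Set.ext fun x => ?_
      rw [mem_preimage, mem_Ioi, hset]
      simp [hα]
    rw [he]
    exact isOpen_empty

/-- `‖f‖_{H¹} = ‖𝓜 f‖₁`, possibly infinite. -/
def hardyENorm {n : ℕ} (b K : ℝ) (f : LOne n) : ℝ≥0∞ := ∫⁻ x, grandMax b K f x

lemma hardyENorm_add_le {n : ℕ} (b K : ℝ) (f g : LOne n) :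
    hardyENorm b K (f + g) ≤ hardyENorm b K f + hardyENorm b K g := by
  unfold hardyENorm
  rw [← lintegral_add_left (measurable_grandMax b K f), grandMax_congr b K (Lp.coeFn_add f g)]
  exact lintegral_mono fun x => grandMax_add_le b K (L1.integrable_coeFn f)
    (L1.integrable_coeFn g) x

lemma hardyENorm_smul {n : ℕ} (b K : ℝ) (c : ℂ) (f : LOne n) :
    hardyENorm b K (c • f) = ‖c‖ₑ * hardyENorm b K f := by
  unfold hardyENorm
  rw [← lintegral_const_mul _ (measurable_grandMax b K f),
    grandMax_congr b K (Lp.coeFn_smul c f)]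
  simp only [grandMax_smul]

/-- The integrable functions `f` with `‖𝓜 f‖₁ < ∞`. -/
def hardySubmodule (n : ℕ) (b K : ℝ) : Submodule ℂ (LOne n) where
  carrier := {f | hardyENorm b K f < ⊤}
  zero_mem' := by
    have h := hardyENorm_smul b K 0 (0 : LOne n)
    rw [zero_smul, enorm_zero, zero_mul] at h
    exact h.trans_lt ENNReal.zero_lt_top
  add_mem' {f g} hf hg := (hardyENorm_add_le b K f g).trans_lt (ENNReal.add_lt_top.2 ⟨hf, hg⟩)
  smul_mem' c f hf := by
    simp only [mem_ofPred_eq, hardyENorm_smul] at hf ⊢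
    exact ENNReal.mul_lt_top enorm_lt_top hf

/-- The Hardy space `H¹(ℝⁿ)`. It is a type of its own: its topology comes from the norm
`‖𝓜 f‖₁` and not from the norm of `L¹`. -/
def Hardy (n : ℕ) (b K : ℝ) : Type := hardySubmodule n b K

namespace Hardy

variable {n : ℕ} {b K : ℝ}

instance : AddCommGroup (Hardy n b K) := inferInstanceAs (AddCommGroup (hardySubmodule n b K))
instance : Module ℂ (Hardy n b K) := inferInstanceAs (Module ℂ (hardySubmodule n b K))

/-- The inclusion of `H¹` into `L¹`. -/
def toL1 : Hardy n b K →ₗ[ℂ] LOne n := (hardySubmodule n b K).subtype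

instance : Norm (Hardy n b K) := ⟨fun f => (hardyENorm b K f.toL1).toReal⟩

lemma norm_def (f : Hardy n b K) : ‖f‖ = (hardyENorm b K f.toL1).toReal := rfl

/-- The norm `‖f‖_{H¹} = ‖𝓜 f‖₁`. -/
theorem core : SeminormedSpace.Core ℂ (Hardy n b K) where
  norm_nonneg _ := ENNReal.toReal_nonneg
  norm_smul c f := by
    rw [norm_def, norm_def, map_smul, hardyENorm_smul, ENNReal.toReal_mul, toReal_enorm]
  norm_triangle f g := by
    have hf : hardyENorm b K f.toL1 ≠ ⊤ := ne_of_lt f.2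
    have hg : hardyENorm b K g.toL1 ≠ ⊤ := ne_of_lt g.2
    rw [norm_def, norm_def, norm_def, map_add, ← ENNReal.toReal_add hf hg]
    exact ENNReal.toReal_mono (ENNReal.add_ne_top.2 ⟨hf, hg⟩) (hardyENorm_add_le b K _ _)

instance : SeminormedAddCommGroup (Hardy n b K) := SeminormedAddCommGroup.ofCore core
instance : NormedSpace ℂ (Hardy n b K) := ⟨fun c f => (core.norm_smul c f).le⟩

end Hardy

/-! ### Atoms -/

/-- `(1, q)`-atoms; for `q = ∞` the size condition reads `‖a‖_∞ ≤ |B|⁻¹`. -/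
def IsHardyAtom {n : ℕ} (q : ℝ≥0∞) (a : LOne n) : Prop :=
  ∃ (c : Eucl n) (r : ℝ), 0 < r ∧
    (∀ᵐ x, x ∉ ball c r → a x = 0) ∧
    eLpNorm a q volume ≤ volume (ball c r) ^ (-1 + (q⁻¹).toReal) ∧
    ∫ x in ball c r, a x = 0

/-- `f = ∑ⱼ μⱼ aⱼ` is a `(1, q)`-atomic decomposition. -/
structure IsAtomicDecomposition {n : ℕ} (q : ℝ≥0∞) (μ : ℕ → ℂ) (a : ℕ → LOne n)
    (f : LOne n) : Prop where
  atom : ∀ j, IsHardyAtom q (a j)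
  summable : Summable fun j => ‖μ j‖
  hasSum : HasSum (fun j => μ j • a j) f

/-! ### Bounded and vanishing mean oscillation -/

/-- The mean oscillation of `f` over the ball `B(c, r)`. -/
def meanOsc {n : ℕ} (f : Eucl n → ℂ) (c : Eucl n) (r : ℝ) : ℝ≥0∞ :=
  (volume (ball c r))⁻¹ * ∫⁻ x in ball c r, ‖f x - ⨍ y in ball c r, f y‖ₑ

/-- The supremum of the mean oscillations over all balls. -/
def bmoENorm {n : ℕ} (f : Eucl n → ℂ) : ℝ≥0∞ :=
  ⨆ (c : Eucl n) (r : ℝ) (_ : 0 < r), meanOsc f c r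

lemma integrableOn_ball_of_loc {n : ℕ} {f : Eucl n → ℂ} (hf : LocallyIntegrable f) (c : Eucl n)
    (r : ℝ) : IntegrableOn f (ball c r) :=
  (hf.integrableOn_isCompact (isCompact_closedBall c r)).mono_set ball_subset_closedBall

lemma bmoENorm_add_le {n : ℕ} {f g : Eucl n → ℂ} (hf : LocallyIntegrable f)
    (hg : LocallyIntegrable g) : bmoENorm (f + g) ≤ bmoENorm f + bmoENorm g := by
  refine iSup_le fun c => iSup_le fun r => iSup_le fun hr => ?_
  have hfi := integrableOn_ball_of_loc hf c r
  have hgi := integrableOn_ball_of_loc hg c r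
  have hav : (⨍ y in ball c r, (f + g) y) = (⨍ y in ball c r, f y) + ⨍ y in ball c r, g y := by
    simp only [setAverage_eq, Pi.add_apply]
    rw [integral_add hfi hgi, smul_add]
  have h : meanOsc (f + g) c r ≤ meanOsc f c r + meanOsc g c r := by
    unfold meanOsc
    have hme : AEMeasurable (fun x => ‖f x - ⨍ y in ball c r, f y‖ₑ)
        (volume.restrict (ball c r)) :=
      (hfi.aestronglyMeasurable.sub aestronglyMeasurable_const).enorm
    rw [← mul_add, ← lintegral_add_left' hme, hav]
    refine mul_le_mul_right (lintegral_mono fun x => ?_) _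
    refine le_trans (le_of_eq ?_) (enorm_add_le _ _)
    congr 1
    simp only [Pi.add_apply]
    ring
  exact h.trans (add_le_add (le_iSup₂_of_le c r (le_iSup_of_le hr le_rfl))
    (le_iSup₂_of_le c r (le_iSup_of_le hr le_rfl)))

lemma bmoENorm_smul {n : ℕ} (k : ℂ) (f : Eucl n → ℂ) :
    bmoENorm (k • f) = ‖k‖ₑ * bmoENorm f := by
  have h : ∀ c r, meanOsc (k • f) c r = ‖k‖ₑ * meanOsc f c r := by
    intro c r
    unfold meanOsc
    have hav : (⨍ y in ball c r, (k • f) y) = k * ⨍ y in ball c r, f y := by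
      simp only [setAverage_eq, Pi.smul_apply, smul_eq_mul, integral_const_mul, mul_smul_comm]
    rw [mul_left_comm, ← lintegral_const_mul' _ _ enorm_ne_top, hav]
    simp only [Pi.smul_apply, smul_eq_mul, ← mul_sub, enorm_mul]
  simp only [bmoENorm, h, ENNReal.mul_iSup]

/-- The functions of bounded mean oscillation. -/
def bmoSubmodule (n : ℕ) : Submodule ℂ (Eucl n → ℂ) where
  carrier := {f | LocallyIntegrable f ∧ bmoENorm f < ⊤}
  zero_mem' := by
    refine ⟨locallyIntegrable_zero, ?_⟩
    have h := bmoENorm_smul 0 (0 : Eucl n → ℂ)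
    rw [zero_smul, enorm_zero, zero_mul] at h
    exact h.trans_lt ENNReal.zero_lt_top
  add_mem' {f g} hf hg := ⟨hf.1.add hg.1,
    (bmoENorm_add_le hf.1 hg.1).trans_lt (ENNReal.add_lt_top.2 ⟨hf.2, hg.2⟩)⟩
  smul_mem' c f hf := by
    refine ⟨hf.1.smul c, ?_⟩
    rw [bmoENorm_smul]
    exact ENNReal.mul_lt_top enorm_lt_top hf.2

/-- The functions of bounded mean oscillation as a type of its own, with the topology of the
`BMO`-seminorm. -/
def BMOFun (n : ℕ) : Type := bmoSubmodule n

namespace BMOFun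

variable {n : ℕ}

instance : AddCommGroup (BMOFun n) := inferInstanceAs (AddCommGroup (bmoSubmodule n))
instance : Module ℂ (BMOFun n) := inferInstanceAs (Module ℂ (bmoSubmodule n))

/-- The underlying function. -/
def toFun : BMOFun n →ₗ[ℂ] (Eucl n → ℂ) := (bmoSubmodule n).subtype

instance : Norm (BMOFun n) := ⟨fun f => (bmoENorm f.toFun).toReal⟩

lemma norm_def (f : BMOFun n) : ‖f‖ = (bmoENorm f.toFun).toReal := rfl

lemma locallyIntegrable (f : BMOFun n) : LocallyIntegrable f.toFun := f.2.1

lemma bmoENorm_ne_top (f : BMOFun n) : bmoENorm f.toFun ≠ ⊤ := ne_of_lt f.2.2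

/-- The seminorm `‖f‖_BMO`. -/
theorem core : SeminormedSpace.Core ℂ (BMOFun n) where
  norm_nonneg _ := ENNReal.toReal_nonneg
  norm_smul c f := by
    rw [norm_def, norm_def, map_smul, bmoENorm_smul, ENNReal.toReal_mul, toReal_enorm]
  norm_triangle f g := by
    rw [norm_def, norm_def, norm_def, map_add,
      ← ENNReal.toReal_add f.bmoENorm_ne_top g.bmoENorm_ne_top]
    exact ENNReal.toReal_mono (ENNReal.add_ne_top.2 ⟨f.bmoENorm_ne_top, g.bmoENorm_ne_top⟩)
      (bmoENorm_add_le f.locallyIntegrable g.locallyIntegrable)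

instance : SeminormedAddCommGroup (BMOFun n) := SeminormedAddCommGroup.ofCore core
instance : NormedSpace ℂ (BMOFun n) := ⟨fun c f => (core.norm_smul c f).le⟩

/-- The functions of zero `BMO`-seminorm are exactly the (almost everywhere) constant ones. -/
lemma norm_eq_zero_iff (f : BMOFun n) :
    ‖f‖ = 0 ↔ ∃ k : ℂ, f.toFun =ᵐ[volume] fun _ => k := by
  rw [norm_def, ENNReal.toReal_eq_zero_iff, or_iff_left f.bmoENorm_ne_top]
  constructor
  · intro h
    have key : ∀ m : ℕ, ∀ᵐ x, x ∈ ball (0 : Eucl n) (m + 1) →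
        f.toFun x = ⨍ y in ball (0 : Eucl n) (m + 1), f.toFun y := by
      intro m
      have hm : meanOsc f.toFun 0 (m + 1 : ℝ) = 0 := by
        refine le_antisymm ?_ bot_le
        rw [← h]
        exact le_iSup₂_of_le 0 (m + 1 : ℝ) (le_iSup_of_le (by positivity) le_rfl)
      rw [meanOsc, mul_eq_zero, or_iff_right
        (ENNReal.inv_ne_zero.2 measure_ball_lt_top.ne)] at hm
      have hfi := integrableOn_ball_of_loc f.locallyIntegrable 0 (m + 1 : ℝ)
      have hme : AEMeasurable
          (fun x => ‖f.toFun x - ⨍ y in ball (0 : Eucl n) (m + 1), f.toFun y‖ₑ)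
          (volume.restrict (ball (0 : Eucl n) (m + 1))) :=
        (hfi.aestronglyMeasurable.sub aestronglyMeasurable_const).enorm
      rw [lintegral_eq_zero_iff' hme, EventuallyEq, ae_restrict_iff' measurableSet_ball] at hm
      filter_upwards [hm] with x hx hxb
      have := hx hxb
      simpa [sub_eq_zero] using this
    have hk : ∀ m : ℕ, (⨍ y in ball (0 : Eucl n) (m + 1), f.toFun y) =
        ⨍ y in ball (0 : Eucl n) ((0 : ℕ) + 1), f.toFun y := by
      intro m
      have hpos : volume (ball (0 : Eucl n) ((0 : ℕ) + 1)) ≠ 0 :=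
        (measure_ball_pos volume 0 (by positivity)).ne'
      obtain ⟨x, hx, hx1, hx2⟩ : ∃ x ∈ ball (0 : Eucl n) ((0 : ℕ) + 1),
          (x ∈ ball (0 : Eucl n) (m + 1) →
            f.toFun x = ⨍ y in ball (0 : Eucl n) (m + 1), f.toFun y) ∧
          (x ∈ ball (0 : Eucl n) ((0 : ℕ) + 1) →
            f.toFun x = ⨍ y in ball (0 : Eucl n) ((0 : ℕ) + 1), f.toFun y) := by
        have hfr : ∃ᵐ x, x ∈ ball (0 : Eucl n) ((0 : ℕ) + 1) := by
          rw [frequently_ae_mem_iff]; exact hpos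
        exact (hfr.and_eventually ((key m).and (key 0))).exists
      rw [← hx1 (ball_subset_ball (by simp) hx), hx2 hx]
    refine ⟨⨍ y in ball (0 : Eucl n) ((0 : ℕ) + 1), f.toFun y, ?_⟩
    filter_upwards [ae_all_iff.2 key] with x hx
    obtain ⟨m, hm⟩ := exists_nat_gt (dist x 0)
    rw [hx m (by rw [mem_ball]; linarith), hk m]
  · rintro ⟨k, hk⟩
    refine le_antisymm (iSup_le fun c => iSup_le fun r => iSup_le fun hr => ?_) bot_le
    have hav : (⨍ y in ball c r, f.toFun y) = k := by
      have h0 : volume (ball c r) ≠ 0 := (measure_ball_pos volume c hr).ne'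
      rw [average_congr (ae_restrict_of_ae hk), setAverage_const h0 measure_ball_lt_top.ne]
    rw [meanOsc, hav, lintegral_congr_ae (g := fun _ => 0)]
    · simp
    · filter_upwards [ae_restrict_of_ae hk] with x hx
      simp [hx]

end BMOFun

/-- `BMO(ℝⁿ)`: the functions of bounded mean oscillation modulo those of zero seminorm, which are
the constants. -/
abbrev BMO (n : ℕ) : Type := SeparationQuotient (BMOFun n)

/-- The class of a function in `BMO`. -/
def BMO.mk {n : ℕ} : BMOFun n →L[ℂ] BMO n := SeparationQuotient.mkCLM ℂ (BMOFun n)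

/-- Continuous functions with compact support. -/
def ccSubmodule (n : ℕ) : Submodule ℂ (BMOFun n) where
  carrier := {f | Continuous f.toFun ∧ HasCompactSupport f.toFun}
  zero_mem' := by
    simp only [mem_ofPred_eq, map_zero]
    exact ⟨continuous_zero, HasCompactSupport.zero⟩
  add_mem' {f g} hf hg := by
    simp only [mem_ofPred_eq, map_add]
    exact ⟨hf.1.add hg.1, hf.2.add hg.2⟩
  smul_mem' c f hf := by
    simp only [mem_ofPred_eq, map_smul]
    exact ⟨hf.1.const_smul c, hf.2.comp_left (g := fun z => c • z) (smul_zero c)⟩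

/-- Every continuous function with compact support has bounded mean oscillation, so that
`ccSubmodule` contains all of them. -/
lemma mem_bmoSubmodule_of_cc {n : ℕ} {f : Eucl n → ℂ} (hf : Continuous f)
    (hs : HasCompactSupport f) : f ∈ bmoSubmodule n := by
  refine ⟨hf.locallyIntegrable, ?_⟩
  obtain ⟨C, hC⟩ := hf.bounded_above_of_compact_support hs
  refine lt_of_le_of_lt (b := ENNReal.ofReal (C + C)) ?_ ENNReal.ofReal_lt_top
  refine iSup_le fun c => iSup_le fun r => iSup_le fun hr => ?_
  have h0 : volume (ball c r) ≠ 0 := (measure_ball_pos volume c hr).ne'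
  have hav : ‖⨍ y in ball c r, f y‖ ≤ C := by
    rw [setAverage_eq, norm_smul, norm_inv, Real.norm_eq_abs, abs_of_nonneg measureReal_nonneg]
    have hp : 0 < volume.real (ball c r) := ENNReal.toReal_pos h0 measure_ball_lt_top.ne
    rw [inv_mul_le_iff₀ hp, mul_comm]
    exact norm_setIntegral_le_of_norm_le_const measure_ball_lt_top fun x _ => hC x
  have hle : ∫⁻ x in ball c r, ‖f x - ⨍ y in ball c r, f y‖ₑ ≤
      ENNReal.ofReal (C + C) * volume (ball c r) := by
    rw [← setLIntegral_const]
    refine lintegral_mono fun x => ?_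
    rw [← ofReal_norm]
    exact ENNReal.ofReal_le_ofReal ((norm_sub_le _ _).trans (add_le_add (hC x) hav))
  rw [meanOsc, mul_comm, ← div_eq_mul_inv]
  exact ENNReal.div_le_of_le_mul hle

/-- `VMO(ℝⁿ)`: the closure in `BMO` of the continuous functions with compact support. -/
def VMO (n : ℕ) : Submodule ℂ (BMO n) :=
  ((ccSubmodule n).map (BMO.mk : BMOFun n →L[ℂ] BMO n).toLinearMap).topologicalClosure

end

/-! The functional attached to `f` is, to begin with, integration against continuous functions of
compact support. These are dense in `VMO n` by definition, so a bounded functional is determined by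
its values on them (`ext_on_cc`). An atomic decomposition converges in `L¹`, hence its pairing with
such a `g` is `∫ f g` (`tsum_pairing_eq_integral`), whatever the decomposition and the exponent.
Well-definedness, linearity and the series formula on all of `VMO n` follow by density once the
pairing is known to be bounded.

Boundedness. `exists_atomic_decomposition` writes `f` as a series of `(1,∞)`-atoms with coefficient
sum at most `A ‖f‖_{H¹}`. Let `O_k = {𝓜f > 2^k}` and let `g_k` be the good part of `f` at level `k`:
equal to `f` off `O_k`, replaced on `O_k` by averages along a Whitney partition of unity. Then `g_k`
tends to `f` as `k → ∞` and to `0` as `k → -∞`, so `f` is the sum of the differences `g_{k+1} -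
g_k`. Each difference is split along the partition of `O_k`, with correction terms that restore the
vanishing integral. The pieces are of size `2^k` and live on Whitney balls, so the coefficients add
up to a multiple of `∑ 2^k |O_k|`, which is controlled by `∫ 𝓜f`. Atoms pair boundedly with `BMO`
(`exists_atom_pairing_le`): directly from the definition for `q = ∞`, through `john_nirenberg` for
finite `q`.

Surjectivity (`exists_hardy_representative`). Given `Λ`, let `M(x)` be the supremum of `|Λ(φ_t(y -
·))|` over the triples `(φ, t, y)` admitted in `𝓜` at `x`. To bound `∫ M` it suffices to bound the
sums `∑ |E_j| |Λ(φ_j)|` with disjoint `E_j` inside the admissible balls. With suitable phases such a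
sum is `Λ(∑ w_j φ_j)` with `|w_j| ≤ |E_j|`. The combination has `BMO`-norm bounded in terms of `n,
b, K`, because its pairing with a bounded atom `a` is at most `∫ 𝓜a`, which is uniformly bounded
(`exists_lintegral_grandMax_le`). Hence `∫ M ≤ C ‖Λ‖`. An approximate identity built from one test
function gives `|Λ(g)| ≤ C ∫ |g| M` (`enorm_functional_le`), so `Λ` has an integrable density `f`
(`exists_density`). Then `f * φ_t(y) = Λ(φ_t(y - ·))`, so `𝓜f ≤ M`.

Injectivity is the fact that an integrable function is determined by its integrals against test
functions, and the two norm bounds make the bijection a homeomorphism. -/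

open scoped BoundedContinuousFunction

/-! ### Volumes of Euclidean balls. -/

section Balls

variable {n : ℕ}

lemma volume_ball_eq (c : Eucl n) {r : ℝ} (hr : 0 < r) :
    volume (ball c r) = ENNReal.ofReal (r ^ n) * volume (ball (0 : Eucl n) 1) := by
  have := Measure.addHaar_ball_mul_of_pos (volume : Measure (Eucl n)) c hr 1
  simpa using this

/-- The volume of the unit ball. -/
noncomputable def unitVol (n : ℕ) : ℝ := volume.real (ball (0 : Eucl n) 1)

lemma unitVol_pos : 0 < unitVol n :=
  ENNReal.toReal_pos (measure_ball_pos volume _ one_pos).ne' measure_ball_lt_top.ne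

lemma volumeReal_ball (c : Eucl n) {r : ℝ} (hr : 0 < r) :
    volume.real (ball c r) = r ^ n * unitVol n := by
  rw [measureReal_def, volume_ball_eq c hr, ENNReal.toReal_mul,
    ENNReal.toReal_ofReal (by positivity)]
  rfl

lemma volume_ball_eq_ofReal (c : Eucl n) {r : ℝ} (hr : 0 < r) :
    volume (ball c r) = ENNReal.ofReal (r ^ n * unitVol n) := by
  rw [← volumeReal_ball c hr, ofReal_measureReal measure_ball_lt_top.ne]

lemma volumeReal_closedBall (c : Eucl n) {r : ℝ} (hr : 0 < r) :
    volume.real (closedBall c r) = r ^ n * unitVol n := by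
  have := Measure.addHaar_real_closedBall (volume : Measure (Eucl n)) c hr.le
  simpa [unitVol] using this

lemma volume_closedBall_eq_ofReal (c : Eucl n) {r : ℝ} (hr : 0 < r) :
    volume (closedBall c r) = ENNReal.ofReal (r ^ n * unitVol n) := by
  rw [← volumeReal_closedBall c hr, ofReal_measureReal measure_closedBall_lt_top.ne]

end Balls

/-! ### Testing against Lipschitz bumps, and pointwise domination by the grand maximal function. -/

section Lipschitz

variable {n : ℕ}

lemma continuous_of_lip {ψ : Eucl n → ℂ} {L : ℝ} (hL : 0 ≤ L)
    (hlip : ∀ x y, ‖ψ x - ψ y‖ ≤ L * dist x y) : Continuous ψ :=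
  (LipschitzWith.of_dist_le_mul (K := ⟨L, hL⟩) fun x y => by
    rw [dist_eq_norm]; exact hlip x y).continuous

lemma hasCompactSupport_of_ball {ψ : Eucl n → ℂ} {c : Eucl n} {s : ℝ}
    (hs : ∀ z, s < dist z c → ψ z = 0) : HasCompactSupport ψ :=
  HasCompactSupport.intro (isCompact_closedBall c s) fun z hz => hs z (by simpa using hz)

/-- Integrals against smooth Lipschitz bumps are controlled by the grand maximal function. -/
lemma enorm_integral_mul_smooth_le {b K : ℝ} (hb : 1 < b) (hK : 0 < K) (f : Eucl n → ℂ)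
    {ψ : Eucl n → ℂ} {L s r : ℝ} {x₀ x : Eucl n} (hL : 0 < L) (hr : 0 < r) (hsr : s < r)
    (hψ : ContDiff ℝ ∞ ψ) (hlip : ∀ x y, ‖ψ x - ψ y‖ ≤ L * dist x y)
    (hs : ∀ z, s < dist z x₀ → ψ z = 0) (hx : dist x₀ x ≤ r) :
    ‖∫ z, f z * ψ z‖ₑ ≤ ENNReal.ofReal (L * r ^ (n + 1) / K) * grandMax b K f x := by
  -- The reflection matches the one in the convolution. Rescaling by `r` turns the Lipschitz
  -- constant `L` into `r L`, and the prefactor normalizes it to `K`.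
  set Φ : Eucl n → ℂ := fun u => ((K / (r * L) : ℝ) : ℂ) * ψ (x₀ - r • u) with hΦ
  have hc : 0 < K / (r * L) := by positivity
  have htest : IsTestFun n K Φ := by
    refine ⟨?_, ?_, ?_⟩
    · exact contDiff_const.mul (hψ.comp (contDiff_const.sub (contDiff_const_smul r)))
    · have h1 : Function.support Φ ⊆ closedBall 0 (s / r) := by
        intro u hu
        by_contra hcon
        apply hu
        have hu' : s / r < ‖u‖ := by simpa using hcon
        have : s < dist (x₀ - r • u) x₀ := by
          rw [dist_eq_norm, sub_sub_cancel_left, norm_neg, norm_smul, Real.norm_eq_abs,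
            abs_of_pos hr]
          rwa [div_lt_iff₀' hr] at hu'
        simp [hΦ, hs _ this]
      exact (closure_minimal h1 isClosed_closedBall).trans
        (closedBall_subset_ball (by rwa [div_lt_one hr]))
    · intro u
      have hl : LipschitzWith ⟨K, hK.le⟩ Φ := by
        refine LipschitzWith.of_dist_le_mul fun y z => ?_
        rw [dist_eq_norm, hΦ]
        simp only [← mul_sub, norm_mul, Complex.norm_real, Real.norm_eq_abs, abs_of_pos hc]
        have h1 := hlip (x₀ - r • y) (x₀ - r • z)
        have h2 : dist (x₀ - r • y) (x₀ - r • z) = r * dist y z := by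
          rw [dist_sub_left, dist_smul₀, Real.norm_eq_abs, abs_of_pos hr]
        rw [h2] at h1
        calc K / (r * L) * ‖ψ (x₀ - r • y) - ψ (x₀ - r • z)‖
            ≤ K / (r * L) * (L * (r * dist y z)) := by gcongr
          _ = K * dist y z := by field_simp
          _ = _ := rfl
      exact norm_fderiv_le_of_lipschitz ℝ hl
  have hconv : ∫ z, f z * ψ z = ((L * r ^ (n + 1) / K : ℝ) : ℂ) * convDilate f Φ r x₀ := by
    unfold convDilate
    rw [← integral_const_mul]
    refine integral_congr_ae (Eventually.of_forall fun z => ?_)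
    simp only [dilate, hΦ, smul_smul, mul_inv_cancel₀ hr.ne', one_smul, sub_sub_cancel]
    rw [Complex.real_smul]
    push_cast
    have : (r : ℂ) ≠ 0 := by exact_mod_cast hr.ne'
    have : (L : ℂ) ≠ 0 := by exact_mod_cast hL.ne'
    have : (K : ℂ) ≠ 0 := by exact_mod_cast hK.ne'
    field_simp
    ring
  rw [hconv, enorm_mul]
  have hc2 : 0 ≤ L * r ^ (n + 1) / K := by positivity
  have : ‖((L * r ^ (n + 1) / K : ℝ) : ℂ)‖ₑ = ENNReal.ofReal (L * r ^ (n + 1) / K) := by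
    rw [← ofReal_norm, Complex.norm_real, Real.norm_eq_abs, abs_of_nonneg hc2]
  rw [this]
  gcongr
  -- The aperture enters here: `x₀` is within `r`, hence strictly within `b r`, of `x`.
  refine le_iSup₂_of_le Φ htest (le_iSup₂_of_le r hr (le_iSup₂_of_le x₀ ?_ le_rfl))
  nlinarith

/-- Mollification keeps the Lipschitz constant. -/
lemma exists_smooth_approx {ψ : Eucl n → ℂ} {L s : ℝ} {x₀ : Eucl n} (hL : 0 ≤ L)
    (hlip : ∀ x y, ‖ψ x - ψ y‖ ≤ L * dist x y)
    (hs : ∀ z, s < dist z x₀ → ψ z = 0) {ε : ℝ} (hε : 0 < ε) :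
    ∃ ψ' : Eucl n → ℂ, ContDiff ℝ ∞ ψ' ∧ (∀ x y, ‖ψ' x - ψ' y‖ ≤ L * dist x y) ∧
      (∀ z, s + ε < dist z x₀ → ψ' z = 0) ∧ ∀ z, ‖ψ' z - ψ z‖ ≤ L * ε := by
  let φ : ContDiffBump (0 : Eucl n) := ⟨ε / 2, ε, by positivity, by linarith⟩
  have hψc := continuous_of_lip hL hlip
  have hint : ∀ x, Integrable fun t => φ.normed volume t • ψ (x - t) := fun x =>
    Continuous.integrable_of_hasCompactSupport
      (φ.continuous_normed.smul (hψc.comp (continuous_const.sub continuous_id)))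
      φ.hasCompactSupport_normed.smul_right
  refine ⟨convolution (φ.normed volume) ψ (ContinuousLinearMap.lsmul ℝ ℝ) volume,
    ?_, ?_, ?_, ?_⟩
  · exact φ.hasCompactSupport_normed.contDiff_convolution_left _ φ.contDiff_normed
      hψc.locallyIntegrable
  · intro x y
    simp only [convolution, ContinuousLinearMap.lsmul_apply]
    rw [← integral_sub (hint x) (hint y)]
    calc ‖∫ t, (φ.normed volume t • ψ (x - t) - φ.normed volume t • ψ (y - t))‖
        ≤ ∫ t, φ.normed volume t * (L * dist x y) := by
          refine norm_integral_le_of_norm_le (φ.integrable_normed.mul_const _)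
            (Eventually.of_forall fun t => ?_)
          rw [← smul_sub, norm_smul, Real.norm_eq_abs, abs_of_nonneg (φ.nonneg_normed t)]
          refine mul_le_mul_of_nonneg_left ?_ (φ.nonneg_normed t)
          simpa using hlip (x - t) (y - t)
      _ = L * dist x y := by rw [integral_mul_const, φ.integral_normed, one_mul]
  · intro z hz
    simp only [convolution, ContinuousLinearMap.lsmul_apply]
    rw [integral_eq_zero_of_ae]
    refine Eventually.of_forall fun t => ?_
    by_cases ht : t ∈ ball (0 : Eucl n) ε
    · have : ψ (z - t) = 0 := by
        apply hs
        have h1 : dist z x₀ ≤ dist (z - t) x₀ + ‖t‖ := by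
          rw [dist_eq_norm, dist_eq_norm]
          calc ‖z - x₀‖ = ‖(z - t - x₀) + t‖ := by congr 1; abel
            _ ≤ _ := norm_add_le _ _
        have h2 : ‖t‖ < ε := by simpa using ht
        linarith
      simp [this]
    · have : φ.normed volume t = 0 := by
        rw [← Function.notMem_support, φ.support_normed_eq]
        exact ht
      simp [this]
  · intro z
    rw [← dist_eq_norm]
    refine φ.dist_normed_convolution_le hψc.aestronglyMeasurable fun x hx => ?_
    rw [dist_eq_norm]
    refine (hlip x z).trans ?_
    gcongr
    exact (mem_ball.1 hx).le

/-- Integrals against Lipschitz bumps are controlled by the grand maximal function. -/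
lemma norm_integral_mul_lip_le {b K : ℝ} (hb : 1 < b) (hK : 0 < K) {f : Eucl n → ℂ}
    (hf : Integrable f) {ψ : Eucl n → ℂ} {L s r α : ℝ} {x₀ x : Eucl n} (hL : 0 < L) (hr : 0 < r)
    (hsr : s < r) (hlip : ∀ x y, ‖ψ x - ψ y‖ ≤ L * dist x y)
    (hs : ∀ z, s < dist z x₀ → ψ z = 0) (hx : dist x₀ x ≤ r) (hα : 0 ≤ α)
    (hM : grandMax b K f x ≤ ENNReal.ofReal α) :
    ‖∫ z, f z * ψ z‖ ≤ L * r ^ (n + 1) / K * α := by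
  have hbd : ∀ ψ' : Eucl n → ℂ, Continuous ψ' → HasCompactSupport ψ' →
      Integrable fun z => f z * ψ' z := by
    intro ψ' hc hcs
    obtain ⟨C, hC⟩ := hc.bounded_above_of_compact_support hcs
    exact hf.mul_bdd (c := C) hc.aestronglyMeasurable (Eventually.of_forall hC)
  refine le_of_forall_pos_le_add fun δ hδ => ?_
  set I := ∫ z, ‖f z‖ with hI
  have hI0 : 0 ≤ I := integral_nonneg fun _ => norm_nonneg _
  -- The mollification radius must keep the enlarged support strictly inside radius `r` and make the
  -- error `L ε ‖f‖₁` at most `δ`.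
  obtain ⟨ε, hε, hε1, hε2⟩ : ∃ ε, 0 < ε ∧ s + ε < r ∧ L * ε * I ≤ δ := by
    refine ⟨min ((r - s) / 2) (δ / (L * (I + 1))), ?_, ?_, ?_⟩
    · have : 0 < r - s := by linarith
      positivity
    · linarith [min_le_left ((r - s) / 2) (δ / (L * (I + 1)))]
    · calc L * min ((r - s) / 2) (δ / (L * (I + 1))) * I
          ≤ L * (δ / (L * (I + 1))) * (I + 1) := by
            gcongr
            · exact min_le_right _ _
            · linarith
        _ = δ := by field_simp
  obtain ⟨ψ', h1, h2, h3, h4⟩ := exists_smooth_approx hL.le hlip hs hε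
  have e1 := enorm_integral_mul_smooth_le hb hK f hL hr hε1 h1 h2 h3 hx
  have e2 : ‖∫ z, f z * ψ' z‖ ≤ L * r ^ (n + 1) / K * α := by
    have : ‖∫ z, f z * ψ' z‖ₑ ≤ ENNReal.ofReal (L * r ^ (n + 1) / K * α) := by
      refine e1.trans ?_
      rw [ENNReal.ofReal_mul (by positivity)]
      gcongr
    rw [← ofReal_norm] at this
    exact (ENNReal.ofReal_le_ofReal_iff (by positivity)).1 this
  have i1 := hbd ψ (continuous_of_lip hL.le hlip) (hasCompactSupport_of_ball hs)
  have i2 := hbd ψ' h1.continuous (hasCompactSupport_of_ball h3)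
  have e3 : ‖(∫ z, f z * ψ z) - ∫ z, f z * ψ' z‖ ≤ δ := by
    rw [← integral_sub i1 i2]
    refine (norm_integral_le_of_norm_le (hf.norm.mul_const (L * ε))
      (Eventually.of_forall fun z => ?_)).trans ?_
    · rw [← mul_sub, norm_mul]
      gcongr
      rw [norm_sub_rev]; exact h4 z
    · rw [integral_mul_const]; linarith
  have := norm_le_norm_add_norm_sub' (∫ z, f z * ψ z) (∫ z, f z * ψ' z)
  linarith

/-- The tent function of height one over the ball `B(c, r)`. -/
noncomputable def tent (c : Eucl n) (r : ℝ) (x : Eucl n) : ℝ := max 0 (1 - dist x c / r)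

lemma tent_nonneg (c : Eucl n) (r : ℝ) (x : Eucl n) : 0 ≤ tent c r x := le_max_left _ _

lemma tent_le_one (c : Eucl n) {r : ℝ} (hr : 0 < r) (x : Eucl n) : tent c r x ≤ 1 :=
  max_le zero_le_one (by have : 0 ≤ dist x c / r := by positivity
                         linarith)

lemma tent_lip (c : Eucl n) {r : ℝ} (hr : 0 < r) (x y : Eucl n) :
    |tent c r x - tent c r y| ≤ r⁻¹ * dist x y := by
  unfold tent
  refine (abs_max_sub_max_le_max _ _ _ _).trans (max_le (by simp; positivity) ?_)
  have : 1 - dist x c / r - (1 - dist y c / r) = r⁻¹ * (dist y c - dist x c) := by ring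
  rw [this, abs_mul, abs_of_pos (inv_pos.2 hr)]
  gcongr
  rw [dist_comm x y]
  exact abs_dist_sub_le _ _ _

lemma tent_eq_zero {c : Eucl n} {r : ℝ} (hr : 0 < r) {x : Eucl n} (h : r ≤ dist x c) :
    tent c r x = 0 := by
  refine max_eq_left ?_
  have : 1 ≤ dist x c / r := by rwa [le_div_iff₀ hr, one_mul]
  linarith

lemma continuous_tent (c : Eucl n) (r : ℝ) : Continuous (tent c r) := by
  unfold tent; fun_prop

lemma integrable_tent (c : Eucl n) {r : ℝ} (hr : 0 < r) : Integrable (tent c r) := by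
  refine (continuous_tent c r).integrable_of_hasCompactSupport ?_
  exact HasCompactSupport.intro (isCompact_closedBall c r) fun z hz =>
    tent_eq_zero hr (le_of_lt (by simpa using hz))

/-- The tent is at least `1/2` on the concentric ball of half the radius. -/
lemma integral_tent_ge (c : Eucl n) {r : ℝ} (hr : 0 < r) :
    2⁻¹ * ((r / 2) ^ n * unitVol n) ≤ ∫ x, tent c r x := by
  rw [← volumeReal_ball c (half_pos hr)]
  have h : ∫ x in ball c (r / 2), (2⁻¹ : ℝ) ≤ ∫ x in ball c (r / 2), tent c r x := by
    refine setIntegral_mono_on (integrableOn_const measure_ball_lt_top.ne)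
      (integrable_tent c hr).integrableOn measurableSet_ball fun x hx => ?_
    refine le_max_of_le_right ?_
    have : dist x c / r ≤ 2⁻¹ := by
      rw [div_le_iff₀ hr]
      have := mem_ball.1 hx
      linarith
    linarith
  rw [setIntegral_const, smul_eq_mul, mul_comm] at h
  exact h.trans (setIntegral_le_integral (integrable_tent c hr)
    (Eventually.of_forall fun x => tent_nonneg c r x))

/-- Almost everywhere, an integrable function is dominated by its grand maximal function. -/
lemma ae_norm_le_grandMax {b K : ℝ} (hb : 1 < b) (hK : 0 < K) {f : Eucl n → ℂ}
    (hf : Integrable f) : ∀ᵐ x, ∀ α : ℝ, 0 ≤ α → grandMax b K f x ≤ ENNReal.ofReal α →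
      ‖f x‖ ≤ 4 * 4 ^ n / (K * unitVol n) * α := by
  have hω := unitVol_pos (n := n)
  filter_upwards [IsUnifLocDoublingMeasure.ae_tendsto_average_norm_sub (volume : Measure (Eucl n))
    hf.locallyIntegrable 1] with x hx α hα hM
  have ht := hx (fun _ : ℝ => x) (fun r : ℝ => r) (l := 𝓝[>] 0) tendsto_id
    (by filter_upwards [self_mem_nhdsWithin] with r hr
        simp only [one_mul, mem_closedBall, dist_self]; exact (mem_Ioi.1 hr).le)
  have ht2 := ht.const_mul (2 * 4 ^ n)
  rw [mul_zero] at ht2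
  -- The integral of `f` against a tent at `x` is controlled by the maximal function and differs
  -- from `f x ∫ tent` by an oscillation that disappears in the limit at a Lebesgue point. The tent
  -- has radius `r / 2` because the support must be strictly smaller than the testing scale.
  have key : ∀ r : ℝ, 0 < r → ‖f x‖ ≤ 4 * 4 ^ n / (K * unitVol n) * α +
      2 * 4 ^ n * ⨍ y in closedBall x r, ‖f y - f x‖ := by
    intro r hr
    have hr2 : 0 < r / 2 := half_pos hr
    set T := ∫ z, tent x (r / 2) z with hT
    have hTge := integral_tent_ge x hr2
    rw [← hT] at hTge
    have hlipC : ∀ y z, ‖((tent x (r / 2) y : ℝ) : ℂ) - (tent x (r / 2) z : ℝ)‖ ≤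
        (r / 2)⁻¹ * dist y z := by
      intro y z
      rw [← Complex.ofReal_sub, Complex.norm_real]
      exact tent_lip x hr2 y z
    have h1 := norm_integral_mul_lip_le hb hK hf (ψ := fun z => (tent x (r / 2) z : ℂ))
      (L := (r / 2)⁻¹) (s := r / 2) (r := r) (x₀ := x) (x := x) (by positivity) hr (by linarith)
      hlipC (fun z hz => by simp [tent_eq_zero hr2 hz.le]) (by simp [hr.le]) hα hM
    have hfT : Integrable fun z => f z * (tent x (r / 2) z : ℂ) := by
      refine hf.mul_bdd (c := 1)
        (Complex.continuous_ofReal.comp (continuous_tent _ _)).aestronglyMeasurable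
        (Eventually.of_forall fun z => ?_)
      rw [Complex.norm_real, Real.norm_eq_abs, abs_of_nonneg (tent_nonneg _ _ _)]
      exact tent_le_one _ hr2 _
    have hcT : Integrable fun z => f x * (tent x (r / 2) z : ℂ) :=
      ((integrable_tent x hr2).ofReal).const_mul _
    have hfi : IntegrableOn (fun z => ‖f z - f x‖) (closedBall x r) :=
      (hf.integrableOn.sub (integrableOn_const measure_closedBall_lt_top.ne)).norm
    have h2 : ‖(∫ z, f z * (tent x (r / 2) z : ℂ)) - f x * T‖ ≤
        ∫ z in closedBall x r, ‖f z - f x‖ := by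
      have : f x * T = ∫ z, f x * (tent x (r / 2) z : ℂ) := by
        rw [integral_const_mul, hT, integral_complex_ofReal]
      rw [this, ← integral_sub hfT hcT, ← integral_indicator measurableSet_closedBall]
      refine norm_integral_le_of_norm_le (hfi.integrable_indicator measurableSet_closedBall)
        (Eventually.of_forall fun z => ?_)
      rw [← sub_mul, norm_mul, Complex.norm_real, Real.norm_eq_abs,
        abs_of_nonneg (tent_nonneg _ _ _)]
      by_cases hz : z ∈ closedBall x r
      · rw [indicator_of_mem hz]
        exact mul_le_of_le_one_right (norm_nonneg _) (tent_le_one _ hr2 _)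
      · rw [indicator_of_notMem hz, tent_eq_zero hr2, mul_zero]
        have : r < dist z x := by simpa using hz
        linarith
    have h3 : ∫ z in closedBall x r, ‖f z - f x‖ =
        r ^ n * unitVol n * ⨍ y in closedBall x r, ‖f y - f x‖ := by
      rw [setAverage_eq, volumeReal_closedBall x hr, smul_eq_mul, mul_inv_cancel_left₀]
      positivity
    rw [h3] at h2
    set A := ⨍ y in closedBall x r, ‖f y - f x‖
    have hT0 : 0 ≤ T := le_trans (by positivity) hTge
    have h4 : ‖f x‖ * T ≤ (r / 2)⁻¹ * r ^ (n + 1) / K * α + r ^ n * unitVol n * A := by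
      have : ‖f x‖ * T = ‖f x * T‖ := by
        rw [norm_mul, Complex.norm_real, Real.norm_eq_abs, abs_of_nonneg hT0]
      rw [this]
      have := norm_le_norm_add_norm_sub (∫ z, f z * (tent x (r / 2) z : ℂ)) (f x * T)
      linarith
    have h5 : ‖f x‖ * (2⁻¹ * ((r / 2 / 2) ^ n * unitVol n)) ≤
        (r / 2)⁻¹ * r ^ (n + 1) / K * α + r ^ n * unitVol n * A :=
      (mul_le_mul_of_nonneg_left hTge (norm_nonneg _)).trans h4
    have e1 : ‖f x‖ * (2⁻¹ * ((r / 2 / 2) ^ n * unitVol n)) =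
        ‖f x‖ * (r ^ n * unitVol n * (2 * 4 ^ n)⁻¹) := by
      rw [div_div, div_pow, show (2 * 2 : ℝ) = 4 by norm_num]; field_simp
    have e2 : (r / 2)⁻¹ * r ^ (n + 1) / K * α + r ^ n * unitVol n * A =
        (4 * 4 ^ n / (K * unitVol n) * α + 2 * 4 ^ n * A) * (r ^ n * unitVol n * (2 * 4 ^ n)⁻¹) := by
      field_simp
      ring
    rw [e1, e2] at h5
    exact le_of_mul_le_mul_right h5 (by positivity)
  have hlim := ht2.const_add (4 * 4 ^ n / (K * unitVol n) * α)
  rw [add_zero] at hlim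
  refine ge_of_tendsto hlim ?_
  filter_upwards [self_mem_nhdsWithin] with r hr using key r hr

end Lipschitz

/-! ### Whitney coverings and partitions of unity. -/

/-- A partition of unity of the open set `O` adapted to a Whitney covering: the `i`-th function is
supported near `ctr i`, at the scale `rad i` of the distance from `ctr i` to the complement. -/
structure WhitneyPartition {n : ℕ} (O : Set (Eucl n)) (C κ : ℝ) where
  ι : Type
  countable : Countable ι
  ctr : ι → Eucl n
  rad : ι → ℝ
  η : ι → Eucl n → ℝ
  rad_eq : ∀ i, rad i = infDist (ctr i) Oᶜ
  rad_pos : ∀ i, 0 < rad i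
  nonneg : ∀ i x, 0 ≤ η i x
  eq_zero : ∀ i x, rad i / 5 ≤ dist x (ctr i) → η i x = 0
  lip : ∀ i x y, |η i x - η i y| ≤ C / rad i * dist x y
  finite : ∀ x, {i | η i x ≠ 0}.Finite
  hasSum : ∀ x ∈ O, HasSum (fun i => η i x) 1
  integral_ge : ∀ i, κ * rad i ^ n ≤ ∫ x, η i x
  sum_volume : ∑' i, volume (ball (ctr i) (rad i)) ≤ ENNReal.ofReal (50 ^ n) * volume O

section Whitney

variable {n : ℕ}

lemma infDist_pos_of_mem {O : Set (Eucl n)} (hO : IsOpen O) (hne : Oᶜ.Nonempty) {x : Eucl n}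
    (hx : x ∈ O) : 0 < infDist x Oᶜ := by
  rw [← hO.isClosed_compl.notMem_iff_infDist_pos hne]
  simpa using hx

lemma ball_infDist_subset {O : Set (Eucl n)} (x : Eucl n) : ball x (infDist x Oᶜ) ⊆ O := by
  intro y hy
  by_contra hcon
  have := infDist_le_dist_of_mem (x := x) (show y ∈ Oᶜ from hcon)
  rw [mem_ball, dist_comm] at hy
  linarith

/-- The ball around `x` with radius its distance to the complement lies in `O`, so its volume is at
most that of `O`. The bounded radii are what the Vitali covering lemma asks for. -/
lemma infDist_bounded (hn : 1 ≤ n) {O : Set (Eucl n)} (hfin : volume O ≠ ⊤) :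
    ∃ R : ℝ, ∀ x ∈ O, infDist x Oᶜ ≤ R := by
  refine ⟨1 + volume.real O / unitVol n, fun x _ => ?_⟩
  have hω := unitVol_pos (n := n)
  have h0 : 0 ≤ volume.real O / unitVol n := by positivity
  by_contra! hcon
  have hd : 1 < infDist x Oᶜ := by linarith
  have h1 : volume.real (ball x (infDist x Oᶜ)) ≤ volume.real O :=
    measureReal_mono (ball_infDist_subset x) hfin
  rw [volumeReal_ball x (by linarith)] at h1
  have h2 : infDist x Oᶜ ≤ infDist x Oᶜ ^ n := le_self_pow₀ hd.le (by omega)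
  have h3 : infDist x Oᶜ ≤ volume.real O / unitVol n := by
    rw [le_div_iff₀ hω]
    exact (mul_le_mul_of_nonneg_right h2 hω.le).trans h1
  linarith

/-- The centres of a Whitney covering. -/
lemma exists_whitney_centers (hn : 1 ≤ n) {O : Set (Eucl n)} (hO : IsOpen O)
    (hne : Oᶜ.Nonempty) (hfin : volume O ≠ ⊤) :
    ∃ u : Set (Eucl n), u.Countable ∧ u ⊆ O ∧
      u.PairwiseDisjoint (fun c => closedBall c (infDist c Oᶜ / 50)) ∧
      ∀ x ∈ O, ∃ c ∈ u, dist x c ≤ infDist c Oᶜ / 10 := by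
  obtain ⟨R, hR⟩ := infDist_bounded hn hfin
  -- Enlarging the disjoint balls of radius `d / 50` five times gives a cover by balls of radius `d
  -- / 10`, half of the radius `d / 5` on which the bumps will live.
  obtain ⟨u, huO, hdisj, hcov⟩ := Vitali.exists_disjoint_subfamily_covering_enlargement_closedBall
    O (fun x => x) (fun x => infDist x Oᶜ / 50) (R / 50)
    (fun a ha => by linarith [hR a ha]) 5 (by norm_num)
  refine ⟨u, ?_, huO, hdisj, fun x hx => ?_⟩
  · refine hdisj.countable_of_nonempty_interior fun c hc => ?_
    have := infDist_pos_of_mem hO hne (huO hc)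
    exact ⟨c, ball_subset_interior_closedBall (mem_ball_self (by linarith))⟩
  · obtain ⟨c, hc, hsub⟩ := hcov x hx
    refine ⟨c, hc, ?_⟩
    have := hsub (mem_closedBall_self (by linarith [infDist_pos_of_mem hO hne hx]))
    rw [mem_closedBall] at this
    linarith

/-- The distance to a set is 1-Lipschitz, so the scale is essentially constant on each enlarged
ball. -/
lemma infDist_compare {O : Set (Eucl n)} {x c : Eucl n} (h : dist x c ≤ infDist c Oᶜ / 5) :
    4 / 5 * infDist c Oᶜ ≤ infDist x Oᶜ ∧ infDist x Oᶜ ≤ 6 / 5 * infDist c Oᶜ := by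
  have h1 := infDist_le_infDist_add_dist (s := Oᶜ) (x := c) (y := x)
  have h2 := infDist_le_infDist_add_dist (s := Oᶜ) (x := x) (y := c)
  rw [dist_comm c x] at h1
  constructor <;> linarith

/-- The enlarged Whitney balls have bounded overlap. -/
lemma whitney_overlap {O u : Set (Eucl n)} (hO : IsOpen O) (hne : Oᶜ.Nonempty) (huO : u ⊆ O)
    (hdisj : u.PairwiseDisjoint (fun c => closedBall c (infDist c Oᶜ / 50))) {x : Eucl n}
    (hx : x ∈ O) (t : Finset u) (ht : ∀ c ∈ t, dist x c < infDist (c : Eucl n) Oᶜ / 5) :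
    t.card ≤ 18 ^ n := by
  have hω := unitVol_pos (n := n)
  have hd := infDist_pos_of_mem hO hne hx
  set d := infDist x Oᶜ with hd_def
  have hcpos : ∀ c : u, 0 < infDist (c : Eucl n) Oᶜ := fun c => infDist_pos_of_mem hO hne (huO c.2)
  have hm : volume.real (⋃ c ∈ t, closedBall (c : Eucl n) (infDist (c : Eucl n) Oᶜ / 50)) =
      ∑ c ∈ t, volume.real (closedBall (c : Eucl n) (infDist (c : Eucl n) Oᶜ / 50)) := by
    refine measureReal_biUnion_finset (fun a _ b _ hab => ?_)
      (fun _ _ => measurableSet_closedBall) (fun _ _ => measure_closedBall_lt_top.ne)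
    exact hdisj a.2 b.2 (fun h => hab (Subtype.ext h))
  -- A packing argument: the small balls are disjoint, have radius at least `d / 60` and lie within
  -- `3 d / 10` of `x`, and the ratio of these radii is 18.
  have hsub : (⋃ c ∈ t, closedBall (c : Eucl n) (infDist (c : Eucl n) Oᶜ / 50)) ⊆
      closedBall x (3 / 10 * d) := by
    refine iUnion₂_subset fun c hc => ?_
    refine closedBall_subset_closedBall' ?_
    have h1 := ht c hc
    have h2 := (infDist_compare h1.le).1
    rw [dist_comm]
    linarith
  have hle := measureReal_mono hsub measure_closedBall_lt_top.ne (μ := volume)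
  rw [hm, volumeReal_closedBall x (by positivity)] at hle
  have hlow : ∑ c ∈ t, (d / 60) ^ n * unitVol n ≤
      ∑ c ∈ t, volume.real (closedBall (c : Eucl n) (infDist (c : Eucl n) Oᶜ / 50)) := by
    refine Finset.sum_le_sum fun c hc => ?_
    rw [volumeReal_closedBall _ (by linarith [hcpos c])]
    have h2 : d / 60 ≤ infDist (c : Eucl n) Oᶜ / 50 := by
      linarith [(infDist_compare (ht c hc).le).2]
    have h3 := hd.le
    refine mul_le_mul_of_nonneg_right (pow_le_pow_left₀ (by positivity) h2 n) hω.le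
  rw [Finset.sum_const, nsmul_eq_mul] at hlow
  have h3 : (t.card : ℝ) * ((d / 60) ^ n * unitVol n) ≤ 18 ^ n * ((d / 60) ^ n * unitVol n) := by
    refine (hlow.trans hle).trans (le_of_eq ?_)
    rw [← mul_assoc, ← mul_pow]
    congr 2
    ring
  have h4 := le_of_mul_le_mul_right h3 (by positivity)
  exact_mod_cast h4

/-- Every proper open set of finite measure has a Whitney partition, with constants depending only
on the dimension. -/
theorem exists_whitneyPartition (hn : 1 ≤ n) {O : Set (Eucl n)} (hO : IsOpen O)
    (hne : Oᶜ.Nonempty) (hfin : volume O ≠ ⊤) :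
    Nonempty (WhitneyPartition O (10 + 40 * 18 ^ n) (2⁻¹ * ((1 / 10) ^ n * unitVol n) / 18 ^ n)) := by
  obtain ⟨u, hucount, huO, hdisj, hcov⟩ := exists_whitney_centers hn hO hne hfin
  have hω := unitVol_pos (n := n)
  set d : Eucl n → ℝ := fun x => infDist x Oᶜ with hd
  have hcpos : ∀ c : u, 0 < d c := fun c => infDist_pos_of_mem hO hne (huO c.2)
  have hr5 : ∀ c : u, 0 < d c / 5 := fun c => by linarith [hcpos c]
  -- These tents are at least `1/2` on the covering balls of radius `d / 10` and overlap at most `18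
  -- ^ n` times. Their sum therefore lies between `1/2` and `18 ^ n` on `O`, and dividing by it
  -- gives the partition.
  set ψ : u → Eucl n → ℝ := fun c => tent (c : Eucl n) (d c / 5) with hψ
  have hψ0 : ∀ c x, 0 ≤ ψ c x := fun c x => tent_nonneg _ _ _
  have hψ1 : ∀ c x, ψ c x ≤ 1 := fun c x => tent_le_one _ (hr5 c) _
  have hψz : ∀ c x, ψ c x ≠ 0 → dist x c < d c / 5 := by
    intro c x h
    by_contra! hcon
    exact h (tent_eq_zero (hr5 c) hcon)
  have hψO : ∀ c x, ψ c x ≠ 0 → x ∈ O := by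
    intro c x h
    have := hψz c x h
    exact ball_infDist_subset (c : Eucl n) (mem_ball.2 (by simp only [hd] at *; linarith [hcpos c]))
  have hψlip : ∀ c x y, |ψ c x - ψ c y| ≤ 5 / d c * dist x y := by
    intro c x y
    have := tent_lip (c : Eucl n) (hr5 c) x y
    rwa [inv_div] at this
  have hcard : ∀ x, ∀ t : Finset u, (∀ c ∈ t, ψ c x ≠ 0) → t.card ≤ 18 ^ n := by
    intro x t ht
    rcases t.eq_empty_or_nonempty with rfl | ⟨c, hc⟩
    · simp
    · exact whitney_overlap hO hne huO hdisj (hψO c x (ht c hc)) t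
        fun c hc => hψz c x (ht c hc)
  have hfinite : ∀ x, {c | ψ c x ≠ 0}.Finite := by
    intro x
    by_contra hcon
    obtain ⟨t, ht, htc⟩ := Set.Infinite.exists_subset_card_eq hcon (18 ^ n + 1)
    have := hcard x t fun c hc => ht hc
    omega
  set S : Eucl n → ℝ := fun x => ∑' c, ψ c x with hS
  have hSfin : ∀ x (s : Finset u), (∀ c, ψ c x ≠ 0 → c ∈ s) → S x = ∑ c ∈ s, ψ c x := by
    intro x s hs
    exact tsum_eq_sum fun c hc => by
      by_contra h
      exact hc (hs c h)
  have hSsum : ∀ x, HasSum (fun c => ψ c x) (S x) := fun x =>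
    (summable_of_hasFiniteSupport (hfinite x)).hasSum
  have hSge : ∀ x ∈ O, 1 / 2 ≤ S x := by
    intro x hx
    obtain ⟨c, hc, hxc⟩ := hcov x hx
    have h1 : 1 / 2 ≤ ψ ⟨c, hc⟩ x := by
      refine le_max_of_le_right ?_
      have hp := hcpos ⟨c, hc⟩
      have : dist x c / (d c / 5) ≤ 1 / 2 := by
        rw [div_le_iff₀ (hr5 ⟨c, hc⟩)]
        simp only [hd]
        linarith
      simp only
      linarith
    exact h1.trans (le_hasSum (hSsum x) _ fun _ _ => hψ0 _ _)
  have hSle : ∀ x, S x ≤ 18 ^ n := by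
    intro x
    rw [hSfin x (hfinite x).toFinset (by simp)]
    calc ∑ c ∈ (hfinite x).toFinset, ψ c x ≤ ∑ c ∈ (hfinite x).toFinset, 1 :=
          Finset.sum_le_sum fun c _ => hψ1 c x
      _ = ((hfinite x).toFinset.card : ℝ) := by simp
      _ ≤ 18 ^ n := by exact_mod_cast hcard x _ (by simp)
  have hS0 : ∀ x, 0 ≤ S x := fun x => tsum_nonneg fun c => hψ0 c x
  have hη1 : ∀ c x, ψ c x / S x ≤ 1 := fun c x =>
    div_le_one_of_le₀ (le_hasSum (hSsum x) c fun _ _ => hψ0 _ _) (hS0 x)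
  have hη0 : ∀ c x, 0 ≤ ψ c x / S x := fun c x => div_nonneg (hψ0 c x) (hS0 x)
  -- the local Lipschitz estimate
  have hloc : ∀ (c : u) (x y : Eucl n), dist x y < d c / 10 → dist x c < d c / 5 →
      |ψ c x / S x - ψ c y / S y| ≤ (10 + 40 * 18 ^ n) / d c * dist x y := by
    intro c x y hxy hxc
    have hp := hcpos c
    have hxO : x ∈ O := ball_infDist_subset (c : Eucl n) (mem_ball.2 (by simp only [hd] at *; linarith))
    have hyO : y ∈ O := by
      refine ball_infDist_subset (c : Eucl n) (mem_ball.2 ?_)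
      have := dist_triangle_left y (c : Eucl n) x
      simp only [hd] at *
      linarith
    have hSx := hSge x hxO
    have hSy := hSge y hyO
    have hdx : 4 / 5 * d c ≤ d x := (infDist_compare hxc.le).1
    have hdy : 7 / 10 * d c ≤ d y := by
      have := infDist_le_infDist_add_dist (s := Oᶜ) (x := x) (y := y)
      simp only [hd] at *
      linarith
    classical
    set s : Finset u := (hfinite x).toFinset ∪ (hfinite y).toFinset with hs
    have hsc : (s.card : ℝ) ≤ 2 * 18 ^ n := by
      have h1 := hcard x (hfinite x).toFinset (by simp)
      have h2 := hcard y (hfinite y).toFinset (by simp)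
      have h3 : s.card ≤ (hfinite x).toFinset.card + (hfinite y).toFinset.card :=
        Finset.card_union_le _ _
      have : s.card ≤ 2 * 18 ^ n := by omega
      exact_mod_cast this
    have hSS : |S x - S y| ≤ 2 * 18 ^ n * (10 / d c * dist x y) := by
      rw [hSfin x s (fun e he => by simp [hs, he]), hSfin y s (fun e he => by simp [hs, he]),
        ← Finset.sum_sub_distrib]
      refine (Finset.abs_sum_le_sum_abs _ _).trans ?_
      have hterm : ∀ e ∈ s, |ψ e x - ψ e y| ≤ 10 / d c * dist x y := by
        intro e he
        refine (hψlip e x y).trans ?_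
        gcongr ?_ * dist x y
        have hpe := hcpos e
        -- A tent that is nonzero at `x` or `y` has a scale comparable with that of `c`, so its
        -- Lipschitz constant `5 / d e` is at most `10 / d c`.
        have : d c ≤ 2 * d e := by
          rcases Finset.mem_union.1 he with h | h
          · have h' : ψ e x ≠ 0 := by simpa using h
            have := (infDist_compare (hψz e x h').le).2
            simp only [hd] at *
            linarith
          · have h' : ψ e y ≠ 0 := by simpa using h
            have := (infDist_compare (hψz e y h').le).2
            simp only [hd] at *
            linarith
        rw [div_le_div_iff₀ hpe hp]
        linarith
      refine (Finset.sum_le_card_nsmul _ _ _ hterm).trans ?_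
      rw [nsmul_eq_mul]
      gcongr
    -- The first term costs the Lipschitz bound of one tent, the second that of the sum. Each is
    -- doubled by `S ≥ 1/2`, and `2 * 5 + 2 * (2 * 18 ^ n * 10)` is the constant of the partition.
    have hid : ψ c x / S x - ψ c y / S y =
        (ψ c x - ψ c y) / S x + ψ c y / S y * ((S y - S x) / S x) := by
      have : S x ≠ 0 := by linarith
      have : S y ≠ 0 := by linarith
      field_simp
      ring
    rw [hid]
    have hinv : ∀ a : ℝ, |a / S x| ≤ 2 * |a| := by
      intro a
      rw [abs_div, abs_of_pos (show 0 < S x by linarith), div_le_iff₀ (by linarith)]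
      nlinarith [abs_nonneg a]
    calc |(ψ c x - ψ c y) / S x + ψ c y / S y * ((S y - S x) / S x)|
        ≤ |(ψ c x - ψ c y) / S x| + |ψ c y / S y * ((S y - S x) / S x)| := abs_add_le _ _
      _ ≤ 2 * (5 / d c * dist x y) + 1 * (2 * (2 * 18 ^ n * (10 / d c * dist x y))) := by
          rw [abs_mul]
          gcongr
          · exact (hinv _).trans (by gcongr; exact hψlip c x y)
          · rw [abs_of_nonneg (hη0 c y)]; exact hη1 c y
          · refine (hinv _).trans ?_
            rw [abs_sub_comm]
            gcongr
      _ = (10 + 40 * 18 ^ n) / d c * dist x y := by ring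
  refine ⟨{
    ι := u
    countable := hucount.to_subtype
    ctr := fun c => c
    rad := fun c => d c
    η := fun c x => ψ c x / S x
    rad_eq := fun _ => rfl
    rad_pos := hcpos
    nonneg := hη0
    eq_zero := fun c x h => by simp only [hψ, tent_eq_zero (hr5 c) h, zero_div]
    lip := ?_
    finite := fun x => (hfinite x).subset fun c hc h => hc (by simp [h])
    hasSum := ?_
    integral_ge := ?_
    sum_volume := ?_ }⟩
  · intro c x y
    have hp := hcpos c
    by_cases hxy : dist x y < d c / 10
    · by_cases hx : dist x c < d c / 5
      · exact hloc c x y hxy hx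
      · by_cases hy : dist y c < d c / 5
        · rw [abs_sub_comm, dist_comm]
          exact hloc c y x (by rwa [dist_comm]) hy
        · rw [show ψ c x = 0 from tent_eq_zero (hr5 c) (not_lt.1 hx),
            show ψ c y = 0 from tent_eq_zero (hr5 c) (not_lt.1 hy)]
          simp only [zero_div, sub_zero, abs_zero]
          positivity
    -- For points at least `d c / 10` apart, the trivial bound by 1 is already Lipschitz with
    -- constant `10 / d c`.
    · have h1 : |ψ c x / S x - ψ c y / S y| ≤ 1 := by
        rw [abs_le]
        constructor <;> linarith [hη0 c x, hη0 c y, hη1 c x, hη1 c y]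
      refine h1.trans ?_
      rw [div_mul_eq_mul_div, le_div_iff₀ hp]
      have : (0 : ℝ) ≤ 40 * 18 ^ n * dist x y := by positivity
      linarith
  · intro x hx
    have := (hSsum x).div_const (S x)
    rwa [div_self (by linarith [hSge x hx])] at this
  · intro c
    have hp := hcpos c
    have hmeas : Measurable S := by
      have := hucount.to_subtype
      exact Measurable.tsum fun c => (continuous_tent _ _).measurable
    have h1 := integral_tent_ge (c : Eucl n) (hr5 c)
    have h2 : ∫ x, ψ c x / 18 ^ n ≤ ∫ x, ψ c x / S x := by
      refine integral_mono ((integrable_tent _ (hr5 c)).div_const _) ?_ fun x => ?_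
      · refine Integrable.mono' ((integrable_tent (c : Eucl n) (hr5 c)).const_mul 2) ?_
          (Eventually.of_forall fun x => ?_)
        · exact ((continuous_tent _ _).measurable.div hmeas).aestronglyMeasurable
        · rw [Real.norm_eq_abs, abs_of_nonneg (hη0 c x)]
          by_cases hx : ψ c x = 0
          · simp only [hx, zero_div]
            exact mul_nonneg zero_le_two (hψ0 c x)
          · have := hSge x (hψO c x hx)
            rw [div_le_iff₀ (by linarith)]
            have h0 := hψ0 c x
            simp only [hψ] at *
            nlinarith
      · simp only
        by_cases hx : ψ c x = 0
        · simp [hx]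
        · have := hSge x (hψO c x hx)
          have := hSle x
          have := hψ0 c x
          gcongr
    rw [integral_div] at h2
    refine le_trans ?_ h2
    rw [div_mul_eq_mul_div]
    gcongr
    refine le_trans (le_of_eq ?_) h1
    simp only [div_pow, one_pow]
    rw [show (10 : ℝ) = 5 * 2 by norm_num, mul_pow]
    field_simp
  · have := hucount.to_subtype
    have hv : ∀ c : u, volume (ball (c : Eucl n) (d c)) =
        ENNReal.ofReal (50 ^ n) * volume (closedBall (c : Eucl n) (d c / 50)) := by
      intro c
      have hp := hcpos c
      rw [volume_ball_eq_ofReal _ hp, volume_closedBall_eq_ofReal _ (by linarith),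
        ← ENNReal.ofReal_mul (by positivity)]
      congr 1
      rw [div_pow]
      field_simp
    simp only [hv]
    rw [ENNReal.tsum_mul_left]
    gcongr
    have hdisj' : Pairwise (Function.onFun Disjoint
        fun c : u => closedBall (c : Eucl n) (d c / 50)) :=
      fun a b hab => hdisj a.2 b.2 (fun h => hab (Subtype.ext h))
    rw [← measure_iUnion hdisj' (fun _ => measurableSet_closedBall)]
    refine measure_mono (iUnion_subset fun c => ?_)
    refine (closedBall_subset_ball ?_).trans (ball_infDist_subset (c : Eucl n))
    have hp := hcpos c
    simp only [hd] at *
    linarith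

end Whitney

/-! ### Averages of a function along a Whitney partition. -/

/-- Every point outside `O` gives the bound `L rⁿ⁺¹ β` for the integral of `f` against a Lipschitz
bump at scale `r` from that point. -/
def TestBound {n : ℕ} (f : Eucl n → ℂ) (O : Set (Eucl n)) (β : ℝ) : Prop :=
  ∀ (ψ : Eucl n → ℂ) (L s r : ℝ) (x₀ x : Eucl n), 0 < L → 0 < r → s < r →
    (∀ x y, ‖ψ x - ψ y‖ ≤ L * dist x y) → (∀ z, s < dist z x₀ → ψ z = 0) → dist x₀ x ≤ r →
    x ∉ O → ‖∫ z, f z * ψ z‖ ≤ L * r ^ (n + 1) * β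

namespace WhitneyPartition

variable {n : ℕ} {O : Set (Eucl n)} {C κ : ℝ} (W : WhitneyPartition O C κ)

lemma mem_of_dist_lt {i : W.ι} {x : Eucl n} (h : dist x (W.ctr i) < W.rad i) : x ∈ O := by
  rw [W.rad_eq] at h
  exact ball_infDist_subset _ (mem_ball.2 h)

lemma dist_lt_of_ne_zero {i : W.ι} {x : Eucl n} (h : W.η i x ≠ 0) :
    dist x (W.ctr i) < W.rad i / 5 := by
  by_contra! hcon
  exact h (W.eq_zero i x hcon)

lemma eq_zero_of_notMem (i : W.ι) {x : Eucl n} (hx : x ∉ O) : W.η i x = 0 := by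
  by_contra h
  exact hx (W.mem_of_dist_lt ((W.dist_lt_of_ne_zero h).trans (by linarith [W.rad_pos i])))

lemma hasSum_mul {𝕜 : Type*} [RCLike 𝕜] (x : Eucl n) (c : 𝕜) (hc : x ∉ O → c = 0) :
    HasSum (fun i => c * (W.η i x : 𝕜)) c := by
  by_cases hx : x ∈ O
  · have := (RCLike.hasSum_ofReal (𝕜 := 𝕜) (L := .unconditional W.ι)).2 (W.hasSum x hx)
    simpa using this.mul_left c
  · simp only [hc hx, zero_mul]
    exact hasSum_zero

lemma le_one (i : W.ι) (x : Eucl n) : W.η i x ≤ 1 := by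
  by_cases hx : x ∈ O
  · exact le_hasSum (W.hasSum x hx) i fun _ _ => W.nonneg _ _
  · rw [W.eq_zero_of_notMem i hx]; exact zero_le_one

lemma norm_le_one (i : W.ι) (x : Eucl n) : ‖(W.η i x : ℂ)‖ ≤ 1 := by
  rw [Complex.norm_real, Real.norm_eq_abs, abs_of_nonneg (W.nonneg i x)]
  exact W.le_one i x

lemma continuous (i : W.ι) : Continuous (W.η i) := by
  refine (LipschitzWith.of_dist_le_mul (K := (C / W.rad i).toNNReal) fun x y => ?_).continuous
  rw [Real.dist_eq]
  exact (W.lip i x y).trans (mul_le_mul_of_nonneg_right (Real.le_coe_toNNReal _) dist_nonneg)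

lemma continuous_ofReal (i : W.ι) : Continuous fun x => (W.η i x : ℂ) :=
  Complex.continuous_ofReal.comp (W.continuous i)

lemma integrable (i : W.ι) : Integrable (W.η i) :=
  (W.continuous i).integrable_of_hasCompactSupport <|
    HasCompactSupport.intro (isCompact_closedBall (W.ctr i) (W.rad i / 5)) fun z hz =>
      W.eq_zero i z (le_of_lt (by simpa using hz))

lemma integral_pos (hκ : 0 < κ) (i : W.ι) : 0 < ∫ x, W.η i x :=
  lt_of_lt_of_le (mul_pos hκ (pow_pos (W.rad_pos i) n)) (W.integral_ge i)

/-- This is a point from which `TestBound` can be applied at the scale of the `i`-th ball. -/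
lemma exists_boundary_point (hO : IsOpen O) (hne : Oᶜ.Nonempty) (i : W.ι) :
    ∃ p, p ∉ O ∧ dist (W.ctr i) p ≤ W.rad i := by
  obtain ⟨p, hp, h⟩ := hO.isClosed_compl.exists_infDist_eq_dist hne (W.ctr i)
  exact ⟨p, hp, by rw [W.rad_eq, h]⟩

/-- The mean of `f` with respect to the `i`-th weight. -/
noncomputable def avg (f : Eucl n → ℂ) (i : W.ι) : ℂ :=
  (∫ z, f z * (W.η i z : ℂ)) / ((∫ z, W.η i z : ℝ) : ℂ)

/-- The Calderón–Zygmund good part of `f` at the level of `O`. -/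
noncomputable def good (f : Eucl n → ℂ) (x : Eucl n) : ℂ :=
  O.indicator (fun x => ∑' i, W.avg f i * (W.η i x : ℂ)) x + Oᶜ.indicator f x

variable {f : Eucl n → ℂ} {β : ℝ}

/-- Testing from a nearest point of the complement at scale `rad i` gives `(c / rad i) * rad i ^ (n
+ 1) * β = c * β * rad i ^ n`, and the normalizing integral is at least `κ * rad i ^ n`. So weighted
averages do not exceed the level, uniformly in the scale. -/
lemma norm_div_le (hκ : 0 < κ) (hO : IsOpen O) (hne : Oᶜ.Nonempty) (hβ : 0 ≤ β)
    (hf : TestBound f O β) (i : W.ι) {ψ : Eucl n → ℂ} {c : ℝ} (hc : 0 < c)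
    (hlip : ∀ x y, ‖ψ x - ψ y‖ ≤ c / W.rad i * dist x y)
    (hs : ∀ z, W.rad i / 5 < dist z (W.ctr i) → ψ z = 0) :
    ‖(∫ z, f z * ψ z) / ((∫ z, W.η i z : ℝ) : ℂ)‖ ≤ c * β / κ := by
  obtain ⟨p, hp, hd⟩ := W.exists_boundary_point hO hne i
  have hr := W.rad_pos i
  have h1 := hf ψ (c / W.rad i) (W.rad i / 5) (W.rad i) (W.ctr i) p (by positivity) hr
    (by linarith) hlip hs hd hp
  have h2 := W.integral_pos hκ i
  rw [norm_div, Complex.norm_real, Real.norm_eq_abs, abs_of_pos h2, div_le_div_iff₀ h2 hκ]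
  have h3 : c / W.rad i * W.rad i ^ (n + 1) * β = c * β * W.rad i ^ n := by
    field_simp
    ring
  rw [h3] at h1
  calc ‖∫ z, f z * ψ z‖ * κ ≤ c * β * W.rad i ^ n * κ := by gcongr
    _ = c * β * (κ * W.rad i ^ n) := by ring
    _ ≤ c * β * ∫ z, W.η i z := by
      gcongr
      exact W.integral_ge i

lemma norm_avg_le (hC : 0 < C) (hκ : 0 < κ) (hO : IsOpen O) (hne : Oᶜ.Nonempty) (hβ : 0 ≤ β)
    (hf : TestBound f O β) (i : W.ι) : ‖W.avg f i‖ ≤ C * β / κ := by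
  refine W.norm_div_le hκ hO hne hβ hf i hC (fun x y => ?_) fun z hz => ?_
  · rw [← Complex.ofReal_sub, Complex.norm_real]
    exact W.lip i x y
  · rw [W.eq_zero i z hz.le, Complex.ofReal_zero]

lemma integrable_mul (hf : Integrable f) (i : W.ι) :
    Integrable fun z => f z * (W.η i z : ℂ) :=
  hf.mul_bdd (c := 1) (W.continuous_ofReal i).aestronglyMeasurable
    (Eventually.of_forall (W.norm_le_one i))

lemma integrable_const_mul (c : ℂ) (i : W.ι) : Integrable fun z => c * (W.η i z : ℂ) :=
  (W.integrable i).ofReal.const_mul c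

lemma integral_bad (hκ : 0 < κ) (hf : Integrable f) (i : W.ι) :
    ∫ z, (f z - W.avg f i) * (W.η i z : ℂ) = 0 := by
  simp only [sub_mul]
  rw [integral_sub (W.integrable_mul hf i) (W.integrable_const_mul _ i),
    integral_const_mul, avg]
  have h : ((∫ z, W.η i z : ℝ) : ℂ) ≠ 0 := by exact_mod_cast (W.integral_pos hκ i).ne'
  have h2 : ∫ z, (W.η i z : ℂ) = ((∫ z, W.η i z : ℝ) : ℂ) := integral_complex_ofReal
  rw [h2, div_mul_cancel₀ _ h, sub_self]

lemma summable_mul (c : W.ι → ℂ) (x : Eucl n) : Summable fun i => c i * (W.η i x : ℂ) :=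
  summable_of_hasFiniteSupport ((W.finite x).subset fun i hi h => hi (by simp [h]))

lemma norm_tsum_le {c : W.ι → ℂ} {B : ℝ} (hB : 0 ≤ B) (x : Eucl n)
    (hc : ∀ i, ‖c i‖ ≤ B) : ‖∑' i, c i * (W.η i x : ℂ)‖ ≤ B := by
  have hle : ∀ i, ‖c i * (W.η i x : ℂ)‖ ≤ B * W.η i x := by
    intro i
    rw [norm_mul, Complex.norm_real, Real.norm_eq_abs, abs_of_nonneg (W.nonneg i x)]
    exact mul_le_mul_of_nonneg_right (hc i) (W.nonneg i x)
  by_cases hx : x ∈ O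
  · refine tsum_of_norm_bounded ?_ hle
    simpa using (W.hasSum x hx).mul_left B
  · simp only [W.eq_zero_of_notMem _ hx, Complex.ofReal_zero, mul_zero, tsum_zero, norm_zero]
    exact hB

end WhitneyPartition

/-! ### Splitting the difference of two consecutive good parts. -/

section ConsecutiveLevels

open WhitneyPartition

variable {n : ℕ} {O O' : Set (Eucl n)} {C κ : ℝ} (W : WhitneyPartition O C κ)
  (W' : WhitneyPartition O' C κ) (f : Eucl n → ℂ)

/-- The correction coefficients which restore cancellation. -/
noncomputable def crossCoeff (i : W.ι) (j : W'.ι) : ℂ :=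
  (∫ z, (f z - W'.avg f j) * (W'.η j z : ℂ) * (W.η i z : ℂ)) / ((∫ z, W'.η j z : ℝ) : ℂ)

/-- The unnormalized atoms arising from two consecutive levels. -/
noncomputable def piece (i : W.ι) (x : Eucl n) : ℂ :=
  O'ᶜ.indicator f x * (W.η i x : ℂ) - W.avg f i * (W.η i x : ℂ) +
    ∑' j, (W'.avg f j * (W.η i x : ℂ) + crossCoeff W W' f i j) * (W'.η j x : ℂ)

variable {W W' f} {β β' : ℝ}

/-- Shrinking `O` to `O'` only decreases distances to the complement, and both radii are compared
with these distances at `z`; the factor is `(6/5) / (4/5)`. -/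
lemma rad_le_of_inter (hne : Oᶜ.Nonempty) (hOO : O' ⊆ O) {i : W.ι} {j : W'.ι} {z : Eucl n}
    (hi : W.η i z ≠ 0) (hj : W'.η j z ≠ 0) : W'.rad j ≤ 3 / 2 * W.rad i := by
  have h1 := W.dist_lt_of_ne_zero hi
  have h2 := W'.dist_lt_of_ne_zero hj
  rw [W.rad_eq] at *
  rw [W'.rad_eq] at *
  have h3 := (infDist_compare h1.le).2
  have h4 := (infDist_compare h2.le).1
  have h5 := infDist_le_infDist_of_subset (x := z) (compl_subset_compl.2 hOO) hne
  linarith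

lemma crossCoeff_eq_zero {i : W.ι} {j : W'.ι} (h : ¬ ∃ z, W.η i z ≠ 0 ∧ W'.η j z ≠ 0) :
    crossCoeff W W' f i j = 0 := by
  unfold crossCoeff
  rw [integral_eq_zero_of_ae, zero_div]
  refine Eventually.of_forall fun z => ?_
  push Not at h
  by_cases hz : W.η i z = 0
  · simp [hz]
  · simp [h z hz]

lemma integrable_mul_mul (hf : Integrable f) (i : W.ι) (j : W'.ι) :
    Integrable fun z => f z * (W'.η j z : ℂ) * (W.η i z : ℂ) :=
  W.integrable_mul (W'.integrable_mul hf j) i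

lemma integrable_cross (hf : Integrable f) (c : ℂ) (i : W.ι) (j : W'.ι) :
    Integrable fun z => (f z - c) * (W'.η j z : ℂ) * (W.η i z : ℂ) := by
  refine W.integrable_mul (f := fun z => (f z - c) * (W'.η j z : ℂ)) ?_ i
  simp only [sub_mul]
  exact (W'.integrable_mul hf j).sub (W'.integrable_const_mul _ j)

/-- By `rad_le_of_inter` the product of the two weights is still a Lipschitz bump at the smaller
scale `W'.rad j`, with constant `1 + 3/2` times that of a single weight. The average term
contributes the remaining 1 of `7/2`. -/
lemma norm_crossCoeff_le (hC : 0 < C) (hκ : 0 < κ) (hne : Oᶜ.Nonempty)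
    (hO' : IsOpen O') (hOO : O' ⊆ O) (hβ' : 0 ≤ β') (hf : Integrable f)
    (hT' : TestBound f O' β') (i : W.ι) (j : W'.ι) :
    ‖crossCoeff W W' f i j‖ ≤ 7 / 2 * (C * β' / κ) := by
  by_cases hex : ∃ z, W.η i z ≠ 0 ∧ W'.η j z ≠ 0
  swap
  · rw [crossCoeff_eq_zero hex, norm_zero]; positivity
  obtain ⟨z₀, hi, hj⟩ := hex
  have hne' : O'ᶜ.Nonempty := hne.mono (compl_subset_compl.2 hOO)
  have hrad := rad_le_of_inter hne hOO hi hj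
  have hri := W.rad_pos i
  have hrj := W'.rad_pos j
  have hIpos := W'.integral_pos hκ j
  set I := ∫ z, W'.η j z
  have hpi : Integrable fun z => W'.η j z * W.η i z :=
    (W'.integrable j).mul_bdd (c := 1) (W.continuous i).aestronglyMeasurable
      (Eventually.of_forall fun z => by
        rw [Real.norm_eq_abs, abs_of_nonneg (W.nonneg i z)]; exact W.le_one i z)
  have hsplit : crossCoeff W W' f i j =
      (∫ z, f z * ((W'.η j z * W.η i z : ℝ) : ℂ)) / (I : ℂ) -
        W'.avg f j * (((∫ z, W'.η j z * W.η i z : ℝ) : ℂ) / (I : ℂ)) := by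
    have e1 : ∫ z, (f z - W'.avg f j) * (W'.η j z : ℂ) * (W.η i z : ℂ) =
        (∫ z, f z * ((W'.η j z * W.η i z : ℝ) : ℂ)) -
          W'.avg f j * ((∫ z, W'.η j z * W.η i z : ℝ) : ℂ) := by
      have e2 : ((∫ z, W'.η j z * W.η i z : ℝ) : ℂ) =
          ∫ z, ((W'.η j z * W.η i z : ℝ) : ℂ) := integral_complex_ofReal.symm
      rw [e2, ← integral_const_mul, ← integral_sub]
      · congr 1
        ext z
        push_cast
        ring
      · have := integrable_mul_mul hf i j
        simpa only [Complex.ofReal_mul, mul_assoc] using this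
      · exact hpi.ofReal.const_mul _
    rw [crossCoeff, e1, sub_div, mul_div_assoc]
  rw [hsplit]
  have h1 : ‖(∫ z, f z * ((W'.η j z * W.η i z : ℝ) : ℂ)) / (I : ℂ)‖ ≤
      (5 / 2 * C) * β' / κ := by
    refine W'.norm_div_le hκ hO' hne' hβ' hT' j (by positivity) (fun x y => ?_) fun z hz => ?_
    · rw [← Complex.ofReal_sub, Complex.norm_real, Real.norm_eq_abs]
      have e : W'.η j x * W.η i x - W'.η j y * W.η i y =
          (W'.η j x - W'.η j y) * W.η i x + W'.η j y * (W.η i x - W.η i y) := by ring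
      rw [e]
      have a1 : |(W'.η j x - W'.η j y) * W.η i x| ≤ C / W'.rad j * dist x y := by
        rw [abs_mul, abs_of_nonneg (W.nonneg i x)]
        exact (mul_le_of_le_one_right (abs_nonneg _) (W.le_one i x)).trans (W'.lip j x y)
      have a2 : |W'.η j y * (W.η i x - W.η i y)| ≤ C / W.rad i * dist x y := by
        rw [abs_mul, abs_of_nonneg (W'.nonneg j y)]
        exact (mul_le_of_le_one_left (abs_nonneg _) (W'.le_one j y)).trans (W.lip i x y)
      have a3 : C / W.rad i ≤ 3 / 2 * (C / W'.rad j) := by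
        rw [← mul_div_assoc, div_le_div_iff₀ hri hrj]
        nlinarith
      calc _ ≤ _ := abs_add_le _ _
        _ ≤ C / W'.rad j * dist x y + 3 / 2 * (C / W'.rad j) * dist x y := by
          refine add_le_add a1 (a2.trans ?_)
          gcongr
        _ = 5 / 2 * C / W'.rad j * dist x y := by ring
    · rw [W'.eq_zero j z hz.le, zero_mul, Complex.ofReal_zero]
  have h2 : ‖W'.avg f j * (((∫ z, W'.η j z * W.η i z : ℝ) : ℂ) / (I : ℂ))‖ ≤
      C * β' / κ * 1 := by
    rw [norm_mul]
    gcongr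
    · exact W'.norm_avg_le hC hκ hO' hne' hβ' hT' j
    · rw [norm_div, Complex.norm_real, Complex.norm_real, Real.norm_eq_abs, Real.norm_eq_abs,
        abs_of_pos hIpos, div_le_one hIpos, abs_of_nonneg
          (integral_nonneg fun z => mul_nonneg (W'.nonneg j z) (W.nonneg i z))]
      exact integral_mono hpi (W'.integrable j) fun z =>
        mul_le_of_le_one_right (W'.nonneg j z) (W.le_one i z)
  refine (norm_sub_le _ _).trans ((add_le_add h1 h2).trans (le_of_eq ?_))
  ring

/-- Summing over `i` removes the weight `W.η i`, since `O'` lies in `O`, and leaves the integral of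
the `j`-th bad part of the inner level, which is zero. Hence the corrections cancel when the pieces
are added up. -/
lemma hasSum_crossCoeff (hκ : 0 < κ) (hOO : O' ⊆ O) (hf : Integrable f) (j : W'.ι) :
    HasSum (fun i => crossCoeff W W' f i j) 0 := by
  have := W.countable
  have hbad : Integrable fun z => (f z - W'.avg f j) * (W'.η j z : ℂ) := by
    simp only [sub_mul]
    exact (W'.integrable_mul hf j).sub (W'.integrable_const_mul _ j)
  have hz : ∀ x, x ∉ O → W'.η j x = 0 := fun x hx => W'.eq_zero_of_notMem j fun h => hx (hOO h)
  have hb : ∀ x, HasSum (fun i => ‖(f x - W'.avg f j) * (W'.η j x : ℂ)‖ * W.η i x)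
      ‖(f x - W'.avg f j) * (W'.η j x : ℂ)‖ := fun x =>
    W.hasSum_mul (𝕜 := ℝ) x _ fun hx => by simp [hz x hx]
  have h := hasSum_integral_of_dominated_convergence (μ := volume)
    (F := fun i x => (f x - W'.avg f j) * (W'.η j x : ℂ) * (W.η i x : ℂ))
    (f := fun x => (f x - W'.avg f j) * (W'.η j x : ℂ))
    (fun i x => ‖(f x - W'.avg f j) * (W'.η j x : ℂ)‖ * W.η i x)
    (fun i => (W.integrable_mul hbad i).aestronglyMeasurable)
    (fun i => Eventually.of_forall fun x => by
      rw [norm_mul, Complex.norm_real, Real.norm_eq_abs, abs_of_nonneg (W.nonneg i x)])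
    (Eventually.of_forall fun x => (hb x).summable)
    (by simp only [fun x => (hb x).tsum_eq]; exact hbad.norm)
    (Eventually.of_forall fun x => W.hasSum_mul (𝕜 := ℂ) x _ fun hx => by simp [hz x hx])
  rw [W'.integral_bad hκ hf j] at h
  simpa [crossCoeff] using h.div_const ((∫ z, W'.η j z : ℝ) : ℂ)

/-- Apart from the corrections, the pieces are the difference of the good parts distributed by a
partition of unity on `O`. Off `O` both good parts equal `f`. -/
lemma hasSum_piece (hκ : 0 < κ) (hOO : O' ⊆ O) (hf : Integrable f) (x : Eucl n) :
    HasSum (fun i => piece W W' f i x) (W'.good f x - W.good f x) := by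
  by_cases hx : x ∈ O
  swap
  · have hx' : x ∉ O' := fun h => hx (hOO h)
    simp only [piece, good, W.eq_zero_of_notMem _ hx, W'.eq_zero_of_notMem _ hx',
      indicator_of_notMem hx, indicator_of_notMem hx', indicator_of_mem (mem_compl hx),
      indicator_of_mem (mem_compl hx'), Complex.ofReal_zero, mul_zero, tsum_zero, sub_self,
      add_zero]
    exact hasSum_zero
  have h1 := W.hasSum_mul (𝕜 := ℂ) x (O'ᶜ.indicator f x) fun h => absurd hx h
  have h2 := (W.summable_mul (W.avg f) x).hasSum
  have h3 := W.hasSum_mul (𝕜 := ℂ) x (∑' j, W'.avg f j * (W'.η j x : ℂ)) fun h => absurd hx h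
  have hfin : ∀ c : W'.ι → ℂ, ∑' j, c j * (W'.η j x : ℂ) =
      ∑ j ∈ (W'.finite x).toFinset, c j * (W'.η j x : ℂ) := by
    intro c
    refine tsum_eq_sum fun j hj => ?_
    have : W'.η j x = 0 := by simpa using hj
    simp [this]
  have h4 : HasSum (fun i => ∑' j, crossCoeff W W' f i j * (W'.η j x : ℂ)) 0 := by
    simp only [hfin]
    have := hasSum_sum (f := fun j i => crossCoeff W W' f i j * (W'.η j x : ℂ))
      (s := (W'.finite x).toFinset) (a := fun _ => 0) (L := .unconditional W.ι) fun j _ => by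
        simpa using (hasSum_crossCoeff (W := W) hκ hOO hf j).mul_right (W'.η j x : ℂ)
    simpa using this
  have h := ((h1.sub h2).add h3).add h4
  have hfun : (fun i => piece W W' f i x) = fun b =>
      O'ᶜ.indicator f x * (W.η b x : ℂ) - W.avg f b * (W.η b x : ℂ) +
        (∑' j, W'.avg f j * (W'.η j x : ℂ)) * (W.η b x : ℂ) +
        ∑' j, crossCoeff W W' f b j * (W'.η j x : ℂ) := by
    ext i
    simp only [piece, add_mul]
    rw [Summable.tsum_add, ← tsum_mul_right, ← add_assoc]
    · congr 2
      exact tsum_congr fun j => by ring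
    · simpa only [mul_assoc] using
        W'.summable_mul (fun j => W'.avg f j * (W.η i x : ℂ)) x
    · exact W'.summable_mul _ x
  have hval : W'.good f x - W.good f x = O'ᶜ.indicator f x -
      (∑' b, W.avg f b * (W.η b x : ℂ)) + (∑' j, W'.avg f j * (W'.η j x : ℂ)) + 0 := by
    simp only [good, indicator_of_mem hx, indicator_of_notMem (notMem_compl_iff.2 hx)]
    by_cases hx' : x ∈ O'
    · simp only [indicator_of_mem hx', indicator_of_notMem (notMem_compl_iff.2 hx')]
      ring
    · simp only [indicator_of_notMem hx', indicator_of_mem (mem_compl hx'),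
        W'.eq_zero_of_notMem _ hx', Complex.ofReal_zero, mul_zero, tsum_zero]
      ring
  rw [hfun, hval]
  exact h

/-- A correction term survives only if its bump meets the `i`-th one. Its radius is then at most
`3/2 * W.rad i`, so it stays within `(1/5 + 2 * 3/10) W.rad i = 4/5 W.rad i` of the centre. -/
lemma piece_eq_zero (hne : Oᶜ.Nonempty) (hOO : O' ⊆ O) {i : W.ι} {x : Eucl n}
    (hx : W.rad i ≤ dist x (W.ctr i)) : piece W W' f i x = 0 := by
  have hr := W.rad_pos i
  have h0 : W.η i x = 0 := W.eq_zero i x (by linarith)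
  have h1 : ∀ j, crossCoeff W W' f i j * (W'.η j x : ℂ) = 0 := by
    intro j
    by_cases hj : W'.η j x = 0
    · simp [hj]
    · rw [crossCoeff_eq_zero, zero_mul]
      rintro ⟨z, hz, hz'⟩
      have a1 := W.dist_lt_of_ne_zero hz
      have a2 := W'.dist_lt_of_ne_zero hz'
      have a3 := W'.dist_lt_of_ne_zero hj
      have a4 := rad_le_of_inter hne hOO hz hz'
      have a5 := dist_triangle x (W'.ctr j) (W.ctr i)
      have a6 := dist_triangle_left (W'.ctr j) (W.ctr i) z
      linarith
  simp only [piece, h0, Complex.ofReal_zero, mul_zero, sub_self, zero_add, h1, tsum_zero]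

lemma measurable_piece_tail (i : W.ι) : Measurable fun x =>
    ∑' j, (W'.avg f j * (W.η i x : ℂ) + crossCoeff W W' f i j) * (W'.η j x : ℂ) := by
  have := W'.countable
  refine Measurable.tsum fun j => Continuous.measurable ?_
  exact ((continuous_const.mul (W.continuous_ofReal i)).add continuous_const).mul
    (W'.continuous_ofReal j)

lemma aestronglyMeasurable_piece (hO' : IsOpen O') (hf : Integrable f) (i : W.ι) :
    AEStronglyMeasurable (piece W W' f i) := by
  refine (((hf.1.indicator hO'.measurableSet.compl).mul
    (W.continuous_ofReal i).aestronglyMeasurable).sub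
    ((W.continuous_ofReal i).aestronglyMeasurable.const_mul _)).add ?_
  exact (measurable_piece_tail i).aestronglyMeasurable

lemma norm_coeff_le (hC : 0 < C) (hκ : 0 < κ) (hne : Oᶜ.Nonempty)
    (hO' : IsOpen O') (hOO : O' ⊆ O) (hβ' : 0 ≤ β') (hf : Integrable f)
    (hT' : TestBound f O' β') (i : W.ι) (j : W'.ι) (x : Eucl n) :
    ‖W'.avg f j * (W.η i x : ℂ) + crossCoeff W W' f i j‖ ≤ 9 / 2 * (C * β' / κ) := by
  have hne' : O'ᶜ.Nonempty := hne.mono (compl_subset_compl.2 hOO)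
  have h1 := norm_crossCoeff_le (W := W) hC hκ hne hO' hOO hβ' hf hT' i j
  have h2 := W'.norm_avg_le hC hκ hO' hne' hβ' hT' j
  have h3 : ‖W'.avg f j * (W.η i x : ℂ)‖ ≤ C * β' / κ := by
    rw [norm_mul]
    exact (mul_le_of_le_one_right (norm_nonneg _) (W.norm_le_one i x)).trans h2
  refine (norm_add_le _ _).trans ?_
  linarith

lemma norm_piece_le (hC : 0 < C) (hκ : 0 < κ) (hO : IsOpen O) (hne : Oᶜ.Nonempty)
    (hO' : IsOpen O') (hOO : O' ⊆ O) (hβ : 0 ≤ β) (hβ' : 0 ≤ β') (hf : Integrable f)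
    (hT : TestBound f O β) (hT' : TestBound f O' β') {D : ℝ} (hD : 0 ≤ D)
    (i : W.ι) {x : Eucl n} (hx : x ∉ O' → ‖f x‖ ≤ D) :
    ‖piece W W' f i x‖ ≤ D + C * β / κ + 9 / 2 * (C * β' / κ) := by
  have h1 : ‖O'ᶜ.indicator f x * (W.η i x : ℂ)‖ ≤ D := by
    rw [norm_mul]
    refine (mul_le_of_le_one_right (norm_nonneg _) (W.norm_le_one i x)).trans ?_
    by_cases hx' : x ∈ O'
    · rw [indicator_of_notMem (notMem_compl_iff.2 hx'), norm_zero]; exact hD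
    · rw [indicator_of_mem (mem_compl hx')]; exact hx hx'
  have h2 : ‖W.avg f i * (W.η i x : ℂ)‖ ≤ C * β / κ := by
    rw [norm_mul]
    exact (mul_le_of_le_one_right (norm_nonneg _) (W.norm_le_one i x)).trans
      (W.norm_avg_le hC hκ hO hne hβ hT i)
  have h3 : ‖∑' j, (W'.avg f j * (W.η i x : ℂ) + crossCoeff W W' f i j) * (W'.η j x : ℂ)‖ ≤
      9 / 2 * (C * β' / κ) :=
    W'.norm_tsum_le (by positivity) x
      (norm_coeff_le hC hκ hne hO' hOO hβ' hf hT' i · x)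
  exact (norm_add_le _ _).trans (add_le_add ((norm_sub_le _ _).trans (add_le_add h1 h2)) h3)

/-- The difference between the `i`-th bad part of `O` and the piece is the sum over `j` of the inner
bad parts times `W.η i`, minus their corrections. The cross coefficients are chosen so that each
summand has integral zero, and the `i`-th bad part has integral zero as well. Integration term by
term is dominated by `|f|` plus a constant on `O'`, which has finite measure. -/
lemma integral_piece (hC : 0 < C) (hκ : 0 < κ) (hne : Oᶜ.Nonempty)
    (hO' : IsOpen O') (hfin' : volume O' ≠ ⊤) (hOO : O' ⊆ O) (hβ' : 0 ≤ β') (hf : Integrable f)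
    (hT' : TestBound f O' β') (i : W.ι) : ∫ x, piece W W' f i x = 0 := by
  have := W'.countable
  set B := 9 / 2 * (C * β' / κ) with hB
  have hB0 : 0 ≤ B := by positivity
  have hG : ∀ j, Integrable fun x => (f x - W'.avg f j) * (W'.η j x : ℂ) * (W.η i x : ℂ) -
      crossCoeff W W' f i j * (W'.η j x : ℂ) := fun j =>
    (integrable_cross hf _ i j).sub (W'.integrable_const_mul _ j)
  have hbsum : ∀ x, HasSum (fun j => O'.indicator (fun x => ‖f x‖ + B) x * W'.η j x)
      (O'.indicator (fun x => ‖f x‖ + B) x) := fun x =>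
    W'.hasSum_mul (𝕜 := ℝ) x _ fun hx => by simp [hx]
  have hbint : Integrable (O'.indicator (fun x => ‖f x‖ + B)) := by
    rw [integrable_indicator_iff hO'.measurableSet]
    exact hf.norm.integrableOn.add (integrableOn_const hfin')
  have h := hasSum_integral_of_dominated_convergence (μ := volume)
    (F := fun j x => (f x - W'.avg f j) * (W'.η j x : ℂ) * (W.η i x : ℂ) -
      crossCoeff W W' f i j * (W'.η j x : ℂ))
    (f := fun x => (f x - W.avg f i) * (W.η i x : ℂ) - piece W W' f i x)
    (fun j x => O'.indicator (fun x => ‖f x‖ + B) x * W'.η j x)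
    (fun j => (hG j).aestronglyMeasurable)
    (fun j => Eventually.of_forall fun x => by
      by_cases hx : x ∈ O'
      · have e : (f x - W'.avg f j) * (W'.η j x : ℂ) * (W.η i x : ℂ) -
            crossCoeff W W' f i j * (W'.η j x : ℂ) = (f x * (W.η i x : ℂ) -
            (W'.avg f j * (W.η i x : ℂ) + crossCoeff W W' f i j)) * (W'.η j x : ℂ) := by ring
        rw [e, norm_mul, Complex.norm_real, Real.norm_eq_abs, abs_of_nonneg (W'.nonneg j x),
          indicator_of_mem hx]
        refine mul_le_mul_of_nonneg_right ((norm_sub_le _ _).trans (add_le_add ?_ ?_))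
          (W'.nonneg j x)
        · rw [norm_mul]
          exact mul_le_of_le_one_right (norm_nonneg _) (W.norm_le_one i x)
        · exact norm_coeff_le hC hκ hne hO' hOO hβ' hf hT' i j x
      · simp [W'.eq_zero_of_notMem j hx])
    (Eventually.of_forall fun x => (hbsum x).summable)
    (by simp only [fun x => (hbsum x).tsum_eq]; exact hbint)
    (Eventually.of_forall fun x => by
      have a1 := W'.hasSum_mul (𝕜 := ℂ) x (O'.indicator f x * (W.η i x : ℂ))
        fun hx => by simp [hx]
      have a2 := (W'.summable_mul
        (fun j => W'.avg f j * (W.η i x : ℂ) + crossCoeff W W' f i j) x).hasSum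
      have a3 := a1.sub a2
      convert a3 using 1
      · ext j
        by_cases hx : x ∈ O'
        · simp only [indicator_of_mem hx, Complex.coe_algebraMap]
          ring
        · simp [W'.eq_zero_of_notMem j hx]
      · have : O'.indicator f x = f x - O'ᶜ.indicator f x := by
          rw [eq_sub_iff_add_eq, indicator_self_add_compl_apply]
        rw [this, piece]
        ring)
  have hzero : ∀ j, ∫ x, ((f x - W'.avg f j) * (W'.η j x : ℂ) * (W.η i x : ℂ) -
      crossCoeff W W' f i j * (W'.η j x : ℂ)) = 0 := by
    intro j
    rw [integral_sub (integrable_cross hf _ i j) (W'.integrable_const_mul _ j),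
      integral_const_mul]
    have h : ((∫ z, W'.η j z : ℝ) : ℂ) ≠ 0 := by exact_mod_cast (W'.integral_pos hκ j).ne'
    have h2 : ∫ z, ((W'.η j z : ℝ) : ℂ) = ((∫ z, W'.η j z : ℝ) : ℂ) := integral_complex_ofReal
    rw [h2, crossCoeff, div_mul_cancel₀ _ h, sub_self]
  simp only [hzero] at h
  have h0 := h.unique hasSum_zero
  have hbad := W.integral_bad hκ hf i
  -- Integrability of the piece need not be known yet: without it the integral is zero by
  -- convention.
  by_cases hint : Integrable (piece W W' f i)
  · rw [integral_sub, hbad, zero_sub, neg_eq_zero] at h0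
    · exact h0
    · simp only [sub_mul]
      exact (W.integrable_mul hf i).sub (W.integrable_const_mul _ i)
    · exact hint
  · exact integral_undef hint

end ConsecutiveLevels

/-! ### Dyadic sums, convergence in `L¹`, and normalization of atoms. -/

section Generic

variable {n : ℕ}

lemma isOpen_lt_grandMax (b K : ℝ) (f : Eucl n → ℂ) (α : ℝ≥0∞) :
    IsOpen {x | α < grandMax b K f x} := by
  rw [isOpen_iff_mem_nhds]
  intro x hx
  simp only [mem_ofPred_eq, grandMax, lt_iSup_iff] at hx
  obtain ⟨φ, hφ, t, ht, y, hy, h⟩ := hx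
  have : ball y (b * t) ∈ 𝓝 x := isOpen_ball.mem_nhds (by rwa [mem_ball, dist_comm])
  filter_upwards [this] with z hz
  refine lt_of_lt_of_le h (le_iSup₂_of_le φ hφ (le_iSup₂_of_le t ht (le_iSup₂_of_le y ?_ le_rfl)))
  rwa [dist_comm, ← mem_ball]

lemma sum_toL1 {ι : Type*} {F : ι → Eucl n → ℂ} (hF : ∀ i, Integrable (F i)) (s : Finset ι) :
    ∑ i ∈ s, (hF i).toL1 (F i) = (integrable_finsetSum s fun i _ => hF i).toL1 _ := by
  classical
  induction s using Finset.induction_on with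
  | empty =>
    simp only [Finset.sum_empty]
    exact (Integrable.toL1_zero _).symm
  | insert i s hi ih =>
    rw [Finset.sum_insert hi, ih, ← Integrable.toL1_add, Integrable.toL1_eq_toL1_iff]
    exact Eventually.of_forall fun x => by simp [Finset.sum_insert hi]

/-- An absolutely convergent series of integrable functions converges in `L¹` to its pointwise
sum. -/
lemma hasSum_toL1 {ι : Type*} [Countable ι] {F : ι → Eucl n → ℂ} (hF : ∀ i, Integrable (F i))
    (hs : ∑' i, ∫⁻ x, ‖F i x‖ₑ ≠ ⊤) {g : Eucl n → ℂ} (hg : Integrable g)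
    (hpt : ∀ᵐ x, Summable (fun i => ‖F i x‖) → HasSum (fun i => F i x) (g x)) :
    HasSum (fun i => (hF i).toL1 (F i)) (hg.toL1 g) := by
  have hae : ∀ᵐ x, ∑' i, ‖F i x‖ₑ < ⊤ := by
    refine ae_lt_top' (AEMeasurable.tsum fun i => (hF i).1.enorm) ?_
    rwa [lintegral_tsum fun i => (hF i).1.enorm]
  rw [HasSum, tendsto_iff_edist_tendsto_0]
  refine tendsto_of_tendsto_of_tendsto_of_le_of_le tendsto_const_nhds
    (ENNReal.tendsto_tsum_compl_atTop_zero hs) (fun _ => zero_le) fun s => ?_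
  simp only
  rw [sum_toL1 hF s, Integrable.edist_toL1_toL1,
    ← lintegral_tsum fun i : {i // i ∉ s} => (hF i).1.enorm]
  refine lintegral_mono_ae ?_
  filter_upwards [hae, hpt] with x hx hx'
  have hsm : Summable fun i => ‖F i x‖ := by
    have := ENNReal.summable_toReal hx.ne
    simpa using this
  have hsum := hx' hsm
  have hsm' : Summable fun i => F i x := hsum.summable
  have e : g x - ∑ i ∈ s, F i x = ∑' i : {i // i ∉ s}, F i x := by
    rw [← hsum.tsum_eq, ← hsm'.sum_add_tsum_subtype_compl s, add_sub_cancel_left]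
  rw [edist_comm, edist_eq_enorm_sub, e]
  have h2 : Summable fun i : {i // i ∉ s} => ‖F i x‖ :=
    hsm.comp_injective Subtype.val_injective
  exact enorm_tsum_le_tsum_enorm

lemma sum_zpow_two_le (s : Finset ℤ) : ∀ a : ℤ, (∀ k ∈ s, k < a) → ∑ k ∈ s, (2 : ℝ) ^ k ≤ 2 ^ a := by
  induction s using Finset.induction_on_max with
  | empty => intro a _; simp only [Finset.sum_empty]; positivity
  | insert m s hm ih =>
    intro a ha
    have h1 := ih m hm
    rw [Finset.sum_insert fun h => lt_irrefl _ (hm m h)]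
    calc (2 : ℝ) ^ m + ∑ k ∈ s, (2 : ℝ) ^ k ≤ 2 ^ m + 2 ^ m := by gcongr
      _ = 2 ^ (m + 1) := by rw [zpow_add_one₀ two_ne_zero]; ring
      _ ≤ 2 ^ a := zpow_le_zpow_right₀ one_le_two (ha m (Finset.mem_insert_self _ _))

/-- The powers of 2 below `m` form a geometric progression, whose sum is at most twice its largest
member. -/
lemma tsum_indicator_le (m : ℝ≥0∞) :
    ∑' k : ℤ, (if ENNReal.ofReal (2 ^ k) < m then ENNReal.ofReal (2 ^ k) else 0) ≤ 2 * m := by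
  refine ENNReal.summable.tsum_le_of_sum_le fun s => ?_
  rw [← Finset.sum_filter]
  set t := s.filter fun k : ℤ => ENNReal.ofReal ((2 : ℝ) ^ k) < m with ht
  rcases t.eq_empty_or_nonempty with h | h
  · rw [h]; simp
  · have hmem := t.max'_mem h
    set k := t.max' h
    rw [← ENNReal.ofReal_sum_of_nonneg fun _ _ => by positivity]
    have h1 := sum_zpow_two_le t (k + 1) fun j hj => by
      have := t.le_max' j hj
      omega
    refine (ENNReal.ofReal_le_ofReal h1).trans ?_
    rw [zpow_add_one₀ two_ne_zero, mul_comm, ENNReal.ofReal_mul zero_le_two, ENNReal.ofReal_ofNat]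
    gcongr
    exact (Finset.mem_filter.1 hmem).2.le

/-- The dyadic layer-cake estimate. -/
lemma tsum_level_le {M : Eucl n → ℝ≥0∞} (hM : Measurable M) :
    ∑' k : ℤ, ENNReal.ofReal (2 ^ k) * volume {x | ENNReal.ofReal (2 ^ k) < M x} ≤
      2 * ∫⁻ x, M x := by
  have hms : ∀ k : ℤ, MeasurableSet {x | ENNReal.ofReal (2 ^ k) < M x} := fun k =>
    measurableSet_lt measurable_const hM
  have h : ∀ k : ℤ, ENNReal.ofReal (2 ^ k) * volume {x | ENNReal.ofReal (2 ^ k) < M x} =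
      ∫⁻ x, (if ENNReal.ofReal (2 ^ k) < M x then ENNReal.ofReal (2 ^ k) else 0) := by
    intro k
    rw [← lintegral_indicator_const (hms k)]
    exact lintegral_congr fun x => indicator_apply _ _ _
  simp only [h]
  rw [← lintegral_tsum, ← lintegral_const_mul _ hM]
  · exact lintegral_mono fun x => tsum_indicator_le (M x)
  · exact fun k => (Measurable.ite (hms k) measurable_const measurable_const).aemeasurable

/-- Unconditional convergence over `ℤ` allows summation along the symmetric intervals from `-N` to
`N`, where the sum telescopes. -/
lemma eq_of_hasSum_telescope {G : ℤ → ℂ} {S L : ℂ} (h : HasSum (fun k => G (k + 1) - G k) S)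
    (hL : Tendsto (fun N : ℕ => G N - G (-N)) atTop (𝓝 L)) : S = L := by
  refine tendsto_nhds_unique ?_ hL
  refine (h.comp (Finset.tendsto_Ico_neg (R := ℤ))).congr fun N => ?_
  have h1 := Finset.sum_Ico_int_sub N G
  simp only [Function.comp]
  rw [← neg_sub, ← h1, ← Finset.sum_neg_distrib]
  simp only [neg_sub]

lemma WhitneyPartition.norm_good_le {O : Set (Eucl n)} {C κ : ℝ} (W : WhitneyPartition O C κ)
    {f : Eucl n → ℂ} {β : ℝ} (hC : 0 < C) (hκ : 0 < κ) (hO : IsOpen O) (hne : Oᶜ.Nonempty)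
    (hβ : 0 ≤ β) (hT : TestBound f O β) {D : ℝ} (hD : 0 ≤ D) {x : Eucl n}
    (hx : x ∉ O → ‖f x‖ ≤ D) : ‖W.good f x‖ ≤ D + C * β / κ := by
  have h0 : 0 ≤ C * β / κ := by positivity
  by_cases h : x ∈ O
  · rw [good, indicator_of_mem h, indicator_of_notMem (notMem_compl_iff.2 h), add_zero]
    have := W.norm_tsum_le h0 x (W.norm_avg_le hC hκ hO hne hβ hT)
    linarith
  · rw [good, indicator_of_notMem h, indicator_of_mem (mem_compl h), zero_add]
    linarith [hx h]

lemma IsHardyAtom.zero {q : ℝ≥0∞} : IsHardyAtom q (0 : LOne n) := by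
  refine ⟨0, 1, one_pos, ?_, ?_, ?_⟩
  · filter_upwards [Lp.coeFn_zero ℂ 1 (volume : Measure (Eucl n))] with x hx _
    rw [hx]; rfl
  · rw [eLpNorm_congr_ae (Lp.coeFn_zero ℂ 1 (volume : Measure (Eucl n))), eLpNorm_zero]
    exact zero_le
  · rw [integral_congr_ae (ae_restrict_of_ae (Lp.coeFn_zero ℂ 1 (volume : Measure (Eucl n))))]
    simp

/-- A decomposition indexed by a countable type can be indexed by the natural numbers. -/
lemma IsAtomicDecomposition.of_countable {ι : Type*} [Countable ι] {q : ℝ≥0∞} {μ : ι → ℂ}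
    {a : ι → LOne n} {f : LOne n} (ha : ∀ i, IsHardyAtom q (a i))
    (hμ : Summable fun i => ‖μ i‖) (h : HasSum (fun i => μ i • a i) f) :
    ∃ (μ' : ℕ → ℂ) (a' : ℕ → LOne n), IsAtomicDecomposition q μ' a' f ∧
      ∑' j, ‖μ' j‖ = ∑' i, ‖μ i‖ := by
  obtain ⟨e, he⟩ := exists_injective_nat ι
  have h1 : (fun j => ‖Function.extend e μ 0 j‖) = Function.extend e (fun i => ‖μ i‖) 0 := by
    ext j
    by_cases hj : ∃ i, e i = j
    · obtain ⟨i, rfl⟩ := hj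
      rw [he.extend_apply, he.extend_apply]
    · simp [Function.extend_apply' _ _ _ hj]
  have h2 : (fun j => Function.extend e μ 0 j • Function.extend e a 0 j) =
      Function.extend e (fun i => μ i • a i) 0 := by
    ext1 j
    by_cases hj : ∃ i, e i = j
    · obtain ⟨i, rfl⟩ := hj
      rw [he.extend_apply, he.extend_apply, he.extend_apply]
    · simp [Function.extend_apply' _ _ _ hj]
  have h3 := (hasSum_extend_zero he).2 hμ.hasSum
  rw [← h1] at h3
  refine ⟨Function.extend e μ 0, Function.extend e a 0, ⟨fun j => ?_, h3.summable, ?_⟩,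
    h3.tsum_eq⟩
  · clear h1 h2 h3
    by_cases hj : ∃ i, e i = j
    · obtain ⟨i, rfl⟩ := hj
      rw [he.extend_apply]; exact ha i
    · rw [Function.extend_apply' _ _ _ hj]; exact IsHardyAtom.zero
  · rw [h2]
    exact (hasSum_extend_zero he).2 h

/-- A bounded function supported in a ball, with vanishing integral, is a multiple of an atom. -/
lemma isHardyAtom_of_bound {c : Eucl n} {r B : ℝ} (hr : 0 < r) (hB : 0 < B) {P : Eucl n → ℂ}
    (hP : Integrable P volume) (hz : ∀ x, x ∉ ball c r → P x = 0) (hb : ∀ᵐ x, ‖P x‖ ≤ B)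
    (h0 : ∫ x, P x = 0) :
    IsHardyAtom ⊤ (((B * volume.real (ball c r) : ℝ) : ℂ)⁻¹ • hP.toL1 P) := by
  set lam : ℝ := B * volume.real (ball c r) with hlam
  have hv : 0 < volume.real (ball c r) := by
    rw [volumeReal_ball c hr]
    have := unitVol_pos (n := n)
    positivity
  have hlpos : 0 < lam := by positivity
  have hco : (((lam : ℂ)⁻¹ • hP.toL1 P : LOne n) : Eucl n → ℂ) =ᵐ[volume]
      fun x => (lam : ℂ)⁻¹ * P x := by
    filter_upwards [Lp.coeFn_smul (lam : ℂ)⁻¹ (hP.toL1 P), hP.coeFn_toL1] with x h1 h2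
    rw [h1, Pi.smul_apply, h2, smul_eq_mul]
  refine ⟨c, r, hr, ?_, ?_, ?_⟩
  · filter_upwards [hco] with x hx hxb
    rw [hx, hz x hxb, mul_zero]
  · rw [eLpNorm_congr_ae hco, eLpNorm_exponent_top]
    refine (eLpNormEssSup_le_of_ae_bound (C := (volume.real (ball c r))⁻¹) ?_).trans ?_
    · filter_upwards [hb] with x hx
      rw [norm_mul, norm_inv, Complex.norm_real, Real.norm_eq_abs, abs_of_pos hlpos, hlam]
      calc (B * volume.real (ball c r))⁻¹ * ‖P x‖ ≤ (B * volume.real (ball c r))⁻¹ * B := by gcongr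
        _ = (volume.real (ball c r))⁻¹ := by field_simp
    · rw [ENNReal.inv_top, ENNReal.toReal_zero, add_zero, ENNReal.rpow_neg_one,
        ENNReal.ofReal_inv_of_pos hv, ofReal_measureReal measure_ball_lt_top.ne]
  · rw [integral_congr_ae (ae_restrict_of_ae hco), integral_const_mul,
      setIntegral_eq_integral_of_forall_compl_eq_zero hz, h0, mul_zero]

end Generic

/-! ### The atomic decomposition. -/

section Decomposition

variable {n : ℕ}

/-- **Atomic decomposition** of the functions with integrable grand maximal function. -/
theorem exists_atomic_decomposition (hn : 1 ≤ n) {b K : ℝ} (hb : 1 < b) (hK : 0 < K) :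
    ∃ A : ℝ, 0 < A ∧ ∀ f : LOne n, hardyENorm b K f < ⊤ →
      ∃ (μ : ℕ → ℂ) (a : ℕ → LOne n), IsAtomicDecomposition ⊤ μ a f ∧
        ∑' j, ‖μ j‖ ≤ A * (hardyENorm b K f).toReal := by
  have hω := unitVol_pos (n := n)
  set C : ℝ := 10 + 40 * 18 ^ n with hC_def
  set κ : ℝ := 2⁻¹ * ((1 / 10) ^ n * unitVol n) / 18 ^ n with hκ_def
  have hC : 0 < C := by positivity
  have hκ : 0 < κ := by positivity
  set D : ℝ := 4 * 4 ^ n / (K * unitVol n) with hD_def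
  have hD : 0 < D := by positivity
  -- At levels `k` and `k + 1`, in units of `2 ^ k`, the bound of `norm_piece_le` is `2 D` from `f`
  -- off the inner set, `C / (K κ)` from the outer average and `9/2 * 2` times that from the inner
  -- terms.
  set A₀ : ℝ := 2 * D + 10 * (C / (K * κ)) with hA₀_def
  have hA₀ : 0 < A₀ := by positivity
  refine ⟨A₀ * (50 ^ n * 2), by positivity, fun f hfin => ?_⟩
  have hf : Integrable f := L1.integrable_coeFn f
  have hmeas := measurable_grandMax b K (f : Eucl n → ℂ)
  set M := grandMax b K (f : Eucl n → ℂ) with hM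
  have hfinM : ∫⁻ x, M x < ⊤ := hfin
  set O : ℤ → Set (Eucl n) := fun k => {x | ENNReal.ofReal (2 ^ k) < M x} with hO_def
  have hO : ∀ k, IsOpen (O k) := fun k => isOpen_lt_grandMax b K f _
  have hOfin : ∀ k, volume (O k) ≠ ⊤ := by
    intro k
    have h1 := tsum_level_le hmeas
    have h2 := (ENNReal.le_tsum k).trans h1
    intro h
    rw [show {x | ENNReal.ofReal (2 ^ k) < M x} = O k from rfl, h, ENNReal.mul_top
      (ENNReal.ofReal_pos.2 (by positivity)).ne', top_le_iff] at h2
    exact (ENNReal.mul_lt_top (by simp) hfinM).ne h2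
  -- In positive dimension the whole space has infinite measure, while the level sets have finite
  -- measure.
  have hne : ∀ k, (O k)ᶜ.Nonempty := by
    intro k
    rw [nonempty_compl]
    intro h
    have : Nontrivial (Eucl n) := by
      have : Nonempty (Fin n) := ⟨⟨0, hn⟩⟩
      infer_instance
    have : NoncompactSpace (Eucl n) := NormedSpace.noncompactSpace ℝ (Eucl n)
    exact hOfin k (by rw [h]; exact measure_univ_of_isAddLeftInvariant volume)
  have hmono : ∀ k, O (k + 1) ⊆ O k := by
    intro k x hx
    refine lt_of_le_of_lt (ENNReal.ofReal_le_ofReal ?_) hx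
    exact zpow_le_zpow_right₀ one_le_two (by omega)
  have hTB : ∀ k : ℤ, TestBound (f : Eucl n → ℂ) (O k) (2 ^ k / K) := by
    intro k ψ L s r x₀ x hL hr hsr hlip hs hx hxO
    have := norm_integral_mul_lip_le hb hK hf hL hr hsr hlip hs hx (α := 2 ^ k) (by positivity)
      (not_lt.1 hxO)
    calc _ ≤ _ := this
      _ = _ := by ring
  have W : ∀ k, WhitneyPartition (O k) C κ := fun k =>
    (exists_whitneyPartition hn (hO k) (hne k) (hOfin k)).some
  have hcount : ∀ k, Countable (W k).ι := fun k => (W k).countable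
  let P : (Σ k, (W k).ι) → Eucl n → ℂ := fun p => piece (W p.1) (W (p.1 + 1)) f p.2
  have hPz : ∀ p x, x ∉ ball ((W p.1).ctr p.2) ((W p.1).rad p.2) → P p x = 0 := by
    intro p x hx
    exact piece_eq_zero (hne p.1) (hmono p.1) (by simpa using hx)
  have hPb : ∀ p, ∀ᵐ x, ‖P p x‖ ≤ A₀ * 2 ^ p.1 := by
    intro p
    filter_upwards [ae_norm_le_grandMax hb hK hf] with x hx
    have h2 : (2 : ℝ) ^ (p.1 + 1) = 2 * 2 ^ p.1 := by rw [zpow_add_one₀ two_ne_zero]; ring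
    have := norm_piece_le (W := W p.1) (W' := W (p.1 + 1)) hC hκ (hO _) (hne _) (hO _) (hmono _)
      (β := 2 ^ p.1 / K) (β' := 2 ^ (p.1 + 1) / K) (by positivity) (by positivity) hf (hTB _)
      (hTB _) (D := D * 2 ^ (p.1 + 1)) (by positivity) p.2 (x := x)
      (fun hxO => hx _ (by positivity) (not_lt.1 hxO))
    refine this.trans (le_of_eq ?_)
    rw [h2, hA₀_def]
    field_simp
    ring
  have hPint : ∀ p, Integrable (P p) := by
    intro p
    have hon : IntegrableOn (P p) (ball ((W p.1).ctr p.2) ((W p.1).rad p.2)) :=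
      Measure.integrableOn_of_bounded measure_ball_lt_top.ne
        (aestronglyMeasurable_piece (hO _) hf p.2) (ae_restrict_of_ae (hPb p))
    rwa [integrableOn_iff_integrable_of_support_subset] at hon
    intro x hx
    by_contra h
    exact hx (hPz p x h)
  have hP0 : ∀ p, ∫ x, P p x = 0 := fun p =>
    integral_piece (β' := 2 ^ (p.1 + 1) / K) hC hκ (hne _) (hO _) (hOfin _) (hmono _)
      (by positivity) hf (hTB _) p.2
  set V : (Σ k, (W k).ι) → ℝ := fun p =>
    volume.real (ball ((W p.1).ctr p.2) ((W p.1).rad p.2)) with hV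
  have hVpos : ∀ p, 0 < V p := by
    intro p
    simp only [hV]
    rw [volumeReal_ball _ ((W p.1).rad_pos p.2)]
    have := (W p.1).rad_pos p.2
    positivity
  set lam : (Σ k, (W k).ι) → ℝ := fun p => A₀ * 2 ^ p.1 * V p with hlam
  have hlpos : ∀ p, 0 < lam p := fun p => mul_pos (by positivity) (hVpos p)
  -- At level `k` the Whitney balls have total volume at most `50 ^ n` times that of `O k`; the
  -- dyadic layer-cake estimate then sums over the levels.
  have hlsum : ∑' p, ENNReal.ofReal (lam p) ≤
      ENNReal.ofReal (A₀ * (50 ^ n * 2)) * hardyENorm b K f := by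
    rw [ENNReal.tsum_sigma' fun p : (Σ k, (W k).ι) => ENNReal.ofReal (lam p)]
    have h1 : ∀ k i, ENNReal.ofReal (lam ⟨k, i⟩) = ENNReal.ofReal A₀ * (ENNReal.ofReal (2 ^ k) *
        volume (ball ((W k).ctr i) ((W k).rad i))) := by
      intro k i
      simp only [hlam, hV]
      rw [ENNReal.ofReal_mul (by positivity), ENNReal.ofReal_mul hA₀.le,
        ofReal_measureReal measure_ball_lt_top.ne, mul_assoc]
    simp only [h1, ENNReal.tsum_mul_left]
    calc ENNReal.ofReal A₀ * ∑' k : ℤ, ENNReal.ofReal (2 ^ k) *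
          ∑' i, volume (ball ((W k).ctr i) ((W k).rad i))
        ≤ ENNReal.ofReal A₀ * ∑' k : ℤ, ENNReal.ofReal (50 ^ n) * (ENNReal.ofReal (2 ^ k) *
          volume (O k)) := by
          refine mul_le_mul_right (ENNReal.tsum_le_tsum fun k => ?_) _
          rw [mul_left_comm]
          exact mul_le_mul_right (W k).sum_volume _
      _ ≤ ENNReal.ofReal A₀ * (ENNReal.ofReal (50 ^ n) * (2 * ∫⁻ x, M x)) := by
          rw [ENNReal.tsum_mul_left]
          gcongr
          exact tsum_level_le hmeas
      _ = _ := by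
          rw [ENNReal.ofReal_mul hA₀.le, ENNReal.ofReal_mul (by positivity), ENNReal.ofReal_ofNat]
          simp only [mul_assoc]
          rfl
  have hltop : ∑' p, ENNReal.ofReal (lam p) ≠ ⊤ :=
    (hlsum.trans_lt (ENNReal.mul_lt_top ENNReal.ofReal_lt_top hfin)).ne
  have hPe : ∀ p, ∫⁻ x, ‖P p x‖ₑ ≤ ENNReal.ofReal (lam p) := by
    intro p
    rw [← setLIntegral_eq_of_support_subset (s := ball ((W p.1).ctr p.2) ((W p.1).rad p.2))]
    · have : ∀ᵐ x ∂volume.restrict (ball ((W p.1).ctr p.2) ((W p.1).rad p.2)),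
          ‖P p x‖ₑ ≤ ENNReal.ofReal (A₀ * 2 ^ p.1) := by
        filter_upwards [ae_restrict_of_ae (hPb p)] with x hx
        rw [← ofReal_norm]
        exact ENNReal.ofReal_le_ofReal hx
      refine (lintegral_mono_ae this).trans ?_
      simp only [hlam, hV]
      rw [setLIntegral_const, ENNReal.ofReal_mul (by positivity : 0 ≤ A₀ * 2 ^ p.1),
        ofReal_measureReal measure_ball_lt_top.ne]
    · intro x hx
      by_contra h
      exact hx (by simp [hPz p x h])
  -- Where the maximal function is finite, `x` leaves `O N` for large `N` and the good part is `f
  -- x`. As the level falls, the good part is bounded by a multiple of the level and tends to zero.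
  have hgood : ∀ᵐ x, Tendsto (fun N : ℕ => (W N).good f x - (W (-N)).good f x) atTop
      (𝓝 (f x)) := by
    filter_upwards [ae_lt_top hmeas hfinM.ne, ae_norm_le_grandMax hb hK hf] with x hx hxD
    have h1 : ∀ᶠ N : ℕ in atTop, (W N).good f x = f x := by
      obtain ⟨N₀, hN₀⟩ := pow_unbounded_of_one_lt (M x).toReal (one_lt_two)
      filter_upwards [eventually_ge_atTop N₀] with N hN
      have hxO : x ∉ O N := by
        simp only [hO_def, mem_ofPred_eq, not_lt]
        rw [← ENNReal.ofReal_toReal hx.ne]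
        refine ENNReal.ofReal_le_ofReal (hN₀.le.trans ?_)
        rw [zpow_natCast]
        exact pow_le_pow_right₀ one_le_two hN
      rw [WhitneyPartition.good, indicator_of_notMem hxO, indicator_of_mem (mem_compl hxO),
        zero_add]
    have h2 : Tendsto (fun N : ℕ => (W (-N)).good f x) atTop (𝓝 0) := by
      have hbd : ∀ N : ℕ, ‖(W (-N)).good f x‖ ≤ (D + C / (K * κ)) * (1 / 2) ^ N := by
        intro N
        have hpw : (2 : ℝ) ^ (-N : ℤ) = (1 / 2) ^ N := by
          rw [zpow_neg, zpow_natCast, one_div, inv_pow]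
        have := (W (-N)).norm_good_le hC hκ (hO _) (hne _) (by positivity) (hTB _)
          (D := D * 2 ^ (-N : ℤ)) (by positivity) (x := x)
          (fun hxO => hxD _ (by positivity) (not_lt.1 hxO))
        refine this.trans (le_of_eq ?_)
        rw [hpw]
        field_simp
      refine squeeze_zero_norm hbd ?_
      have := (tendsto_pow_atTop_nhds_zero_of_lt_one (r := (1 / 2 : ℝ)) (by norm_num)
        (by norm_num)).const_mul (D + C / (K * κ))
      rwa [mul_zero] at this
    have h3 : Tendsto (fun N : ℕ => (W N).good f x) atTop (𝓝 (f x)) :=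
      tendsto_const_nhds.congr' (h1.mono fun _ h => h.symm)
    simpa using h3.sub h2
  have hHS : HasSum (fun p => (hPint p).toL1 (P p)) (hf.toL1 f) := by
    refine hasSum_toL1 hPint ((ENNReal.tsum_le_tsum hPe).trans_lt hltop.lt_top).ne hf ?_
    filter_upwards [hgood] with x hx hsm
    have hs := hsm.of_norm.hasSum
    -- Summing first within each level turns the double series into the telescoping series of good
    -- parts.
    have h1 : HasSum (fun k : ℤ => (W (k + 1)).good f x - (W k).good f x) (∑' p, P p x) :=
      HasSum.sigma (γ := fun k => (W k).ι) hs fun k =>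
        hasSum_piece (W := W k) (W' := W (k + 1)) hκ (hmono k) hf x
    rw [← eq_of_hasSum_telescope (G := fun k => (W k).good f x) h1 hx]
    exact hs
  have htoL1 : hf.toL1 f = f := Integrable.toL1_coeFn f hf
  rw [htoL1] at hHS
  obtain ⟨μ', a', h1, h2⟩ := IsAtomicDecomposition.of_countable (q := ⊤) (f := f)
    (μ := fun p => ((lam p : ℝ) : ℂ)) (a := fun p => ((lam p : ℝ) : ℂ)⁻¹ • (hPint p).toL1 (P p))
    (fun p => isHardyAtom_of_bound ((W p.1).rad_pos p.2) (by positivity) (hPint p) (hPz p) (hPb p)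
      (hP0 p))
    (by
      have := ENNReal.summable_toReal hltop
      refine this.congr fun p => ?_
      rw [ENNReal.toReal_ofReal (hlpos p).le, Complex.norm_real, Real.norm_eq_abs,
        abs_of_pos (hlpos p)])
    (by
      refine hHS.congr_fun fun p => ?_
      rw [smul_smul, mul_inv_cancel₀ (by exact_mod_cast (hlpos p).ne'), one_smul])
  refine ⟨μ', a', h1, h2.trans_le ?_⟩
  have h3 : ∑' p, ‖((lam p : ℝ) : ℂ)‖ = (∑' p, ENNReal.ofReal (lam p)).toReal := by
    rw [ENNReal.tsum_toReal_eq fun p => ENNReal.ofReal_ne_top]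
    refine tsum_congr fun p => ?_
    rw [ENNReal.toReal_ofReal (hlpos p).le, Complex.norm_real, Real.norm_eq_abs,
      abs_of_pos (hlpos p)]
  rw [h3]
  have h4 := ENNReal.toReal_mono (ENNReal.mul_lt_top ENNReal.ofReal_lt_top hfin).ne hlsum
  rwa [ENNReal.toReal_mul, ENNReal.toReal_ofReal (by positivity)] at h4

end Decomposition

/-! ### Size, support and smoothness of dilated test functions. -/

section TestFun

variable {n : ℕ} {b K : ℝ} {φ : Eucl n → ℂ}

lemma IsTestFun.lip (hK : 0 ≤ K) (hφ : IsTestFun n K φ) (u v : Eucl n) :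
    ‖φ u - φ v‖ ≤ K * dist u v := by
  have h : LipschitzWith ⟨K, hK⟩ φ :=
    lipschitzWith_of_nnnorm_fderiv_le (hφ.1.differentiable (by simp)) fun x => hφ.2.2 x
  have := h.dist_le_mul u v
  rwa [dist_eq_norm] at this

lemma IsTestFun.eq_zero (hφ : IsTestFun n K φ) {u : Eucl n} (hu : 1 ≤ ‖u‖) : φ u = 0 :=
  image_eq_zero_of_notMem_tsupport fun h => by
    have := hφ.2.1 h
    rw [mem_ball_zero_iff] at this
    linarith

/-- In positive dimension a translation of length 2 carries any point of the unit ball out of the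
support, and the gradient bound is applied along it. -/
lemma IsTestFun.norm_le (hn : 1 ≤ n) (hK : 0 ≤ K) (hφ : IsTestFun n K φ) (u : Eucl n) :
    ‖φ u‖ ≤ 2 * K := by
  by_cases hu : 1 ≤ ‖u‖
  · rw [hφ.eq_zero hu, norm_zero]; positivity
  have : Nonempty (Fin n) := ⟨⟨0, hn⟩⟩
  obtain ⟨e, he⟩ := exists_norm_eq (Eucl n) zero_le_two
  have h1 : 1 ≤ ‖u + e‖ := by
    have := norm_sub_norm_le e (-u)
    rw [sub_neg_eq_add, norm_neg, add_comm] at this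
    linarith
  have := hφ.lip hK u (u + e)
  rw [hφ.eq_zero h1, sub_zero, dist_self_add_right, he] at this
  linarith

lemma dilate_eq_zero (hφ : IsTestFun n K φ) {t : ℝ} (ht : 0 < t) {w : Eucl n} (hw : t ≤ ‖w‖) :
    dilate φ t w = 0 := by
  rw [dilate, hφ.eq_zero, smul_zero]
  rw [norm_smul, norm_inv, Real.norm_eq_abs, abs_of_pos ht, ← div_eq_inv_mul, one_le_div ht]
  exact hw

lemma norm_dilate_le (hn : 1 ≤ n) (hK : 0 ≤ K) (hφ : IsTestFun n K φ) {t : ℝ} (ht : 0 < t)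
    (w : Eucl n) : ‖dilate φ t w‖ ≤ (t ^ n)⁻¹ * (2 * K) := by
  rw [dilate, norm_smul, Real.norm_eq_abs, abs_of_pos (by positivity)]
  gcongr
  exact hφ.norm_le hn hK _

lemma dilate_lip (hK : 0 ≤ K) (hφ : IsTestFun n K φ) {t : ℝ} (ht : 0 < t) (v w : Eucl n) :
    ‖dilate φ t v - dilate φ t w‖ ≤ (t ^ n)⁻¹ * (K * (t⁻¹ * dist v w)) := by
  rw [dilate, dilate, ← smul_sub, norm_smul, Real.norm_eq_abs, abs_of_pos (by positivity)]
  gcongr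
  have := hφ.lip hK (t⁻¹ • v) (t⁻¹ • w)
  rwa [dist_smul₀, norm_inv, Real.norm_eq_abs, abs_of_pos ht] at this

lemma continuous_dilate (hφ : IsTestFun n K φ) (t : ℝ) (y : Eucl n) :
    Continuous fun z => dilate φ t (y - z) := by
  have := hφ.1.continuous
  unfold dilate
  fun_prop

lemma hasCompactSupport_dilate (hφ : IsTestFun n K φ) {t : ℝ} (ht : 0 < t) (y : Eucl n) :
    HasCompactSupport fun z => dilate φ t (y - z) :=
  HasCompactSupport.intro (isCompact_closedBall y t) fun z hz => by
    refine dilate_eq_zero hφ ht ?_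
    rw [← dist_eq_norm, dist_comm]
    exact le_of_lt (by simpa using hz)

end TestFun

/-! ### Integrability of the grand maximal function of an atom. -/

section AtomBound

variable {n : ℕ} {b K : ℝ}

/-- The pointwise decay of the grand maximal function of an atom. -/
lemma grandMax_atom_le (hn : 1 ≤ n) (hb : 1 < b) (hK : 0 < K) {a : Eucl n → ℂ} {c : Eucl n}
    {r B : ℝ} (hr : 0 < r) (hB : 0 ≤ B) (ha : Integrable a) (hz : ∀ x, x ∉ ball c r → a x = 0)
    (hbd : ∀ x, ‖a x‖ ≤ B) (h0 : ∫ x, a x = 0) (x : Eucl n) :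
    grandMax b K a x ≤ ENNReal.ofReal
      (B * (unitVol n * K * (2 * 3 ^ (n + 1) + (3 * (b + 1)) ^ (n + 1))) *
        (1 + ‖r⁻¹ • (x - c)‖) ^ (-((n : ℝ) + 1))) := by
  have hω := unitVol_pos (n := n)
  set R := dist x c with hR
  have hRr : ‖r⁻¹ • (x - c)‖ = R / r := by
    rw [norm_smul, norm_inv, Real.norm_eq_abs, abs_of_pos hr, ← dist_eq_norm, div_eq_inv_mul]
  have hR0 : 0 ≤ R := dist_nonneg
  set S := 1 + R / r with hS
  have hS0 : 0 < S := by positivity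
  have hpow : S ^ (-((n : ℝ) + 1)) = (S ^ (n + 1))⁻¹ := by
    rw [Real.rpow_neg hS0.le]
    congr 1
    exact_mod_cast Real.rpow_natCast S (n + 1)
  rw [hRr, hpow]
  refine iSup_le fun φ => iSup_le fun hφ => iSup_le fun t => iSup_le fun ht => iSup_le fun y =>
    iSup_le fun hy => ?_
  rw [← ofReal_norm]
  refine ENNReal.ofReal_le_ofReal ?_
  by_cases hcv : convDilate a φ t y = 0
  · rw [hcv, norm_zero]; positivity
  by_cases hnear : R < 2 * r
  -- Near the ball no cancellation is needed: the dilates have uniformly bounded `L¹`-norms.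
  · have h1 : ‖convDilate a φ t y‖ ≤ B * ((t ^ n)⁻¹ * (2 * K)) * volume.real (ball y t) := by
      unfold convDilate
      rw [← setIntegral_eq_integral_of_forall_compl_eq_zero (s := ball y t)]
      · refine norm_setIntegral_le_of_norm_le_const measure_ball_lt_top fun z _ => ?_
        rw [norm_mul]
        exact mul_le_mul (hbd z) (norm_dilate_le hn hK.le hφ ht _) (norm_nonneg _) hB
      · intro z hz
        rw [dilate_eq_zero hφ ht, mul_zero]
        rw [← dist_eq_norm, dist_comm]
        simpa using hz
    rw [volumeReal_ball y ht] at h1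
    have hS3 : S ≤ 3 := by
      have : R / r ≤ 2 := by rw [div_le_iff₀ hr]; linarith
      linarith
    calc ‖convDilate a φ t y‖ ≤ _ := h1
      _ = B * (unitVol n * K * 2) := by field_simp
      _ = B * (unitVol n * K * (2 * 3 ^ (n + 1))) * (3 ^ (n + 1))⁻¹ := by field_simp
      _ ≤ _ := by
        gcongr
        exact le_add_of_nonneg_right (by positivity)
  · rw [not_lt] at hnear
    -- Far away, a nonzero convolution forces the support of the dilate to reach the ball, so `t` is
    -- at least comparable with the distance `R`.
    have hex : ∃ z ∈ ball c r, dist y z < t := by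
      by_contra! hcon
      apply hcv
      unfold convDilate
      rw [integral_eq_zero_of_ae]
      refine Eventually.of_forall fun z => ?_
      by_cases hzb : z ∈ ball c r
      · simp only [Pi.zero_apply]
        rw [dilate_eq_zero hφ ht, mul_zero]
        rw [← dist_eq_norm]
        exact hcon z hzb
      · simp [hz z hzb]
    obtain ⟨z₀, hz₀, hyz⟩ := hex
    have htR : R ≤ (b + 1) * t + r := by
      have d1 := dist_triangle4 x y z₀ c
      have d2 := mem_ball.1 hz₀
      rw [dist_comm] at hy
      linarith
    -- The vanishing integral allows the value of the dilate at the centre to be subtracted. This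
    -- gains a factor `r / t`, and the total power `n + 1` makes the decay integrable.
    have hconv : convDilate a φ t y =
        ∫ z in ball c r, a z * (dilate φ t (y - z) - dilate φ t (y - c)) := by
      rw [setIntegral_eq_integral_of_forall_compl_eq_zero fun z hzb => by rw [hz z hzb, zero_mul]]
      simp only [mul_sub]
      rw [integral_sub (integrable_mul_dilate ha hφ t y) (ha.mul_const _), integral_mul_const, h0,
        zero_mul, sub_zero]
      rfl
    have h1 : ‖convDilate a φ t y‖ ≤ B * ((t ^ n)⁻¹ * (K * (t⁻¹ * r))) *
        volume.real (ball c r) := by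
      rw [hconv]
      refine norm_setIntegral_le_of_norm_le_const measure_ball_lt_top fun z hzb => ?_
      rw [norm_mul]
      refine mul_le_mul (hbd z) ((dilate_lip hK.le hφ ht _ _).trans ?_) (norm_nonneg _) hB
      rw [dist_sub_left]
      have := (mem_ball.1 hzb).le
      gcongr
    rw [volumeReal_ball c hr] at h1
    have hb1 : 0 < b + 1 := by linarith
    have ht2 : r / t ≤ 3 * (b + 1) / S := by
      have e : S = (r + R) / r := by rw [hS]; field_simp
      rw [e, div_div_eq_mul_div, div_le_div_iff₀ ht (by positivity)]
      -- From `2 r ≤ R` one gets `r + R ≤ 3 (R - r)`, and `R - r ≤ (b + 1) t`.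
      have : r + R ≤ 3 * (b + 1) * t := by linarith
      nlinarith
    calc ‖convDilate a φ t y‖ ≤ _ := h1
      _ = B * (unitVol n * K) * (r / t) ^ (n + 1) := by
        rw [div_pow]
        field_simp
        try ring
      _ ≤ B * (unitVol n * K) * (3 * (b + 1) / S) ^ (n + 1) := by gcongr
      _ = B * (unitVol n * K * (3 * (b + 1)) ^ (n + 1)) * (S ^ (n + 1))⁻¹ := by
        rw [div_pow]; field_simp
      _ ≤ _ := by
        gcongr
        exact le_add_of_nonneg_left (by positivity)

/-- Bounded functions with vanishing integral supported in a ball have uniformly integrable grand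
maximal functions. -/
theorem exists_lintegral_grandMax_le (hn : 1 ≤ n) (hb : 1 < b) (hK : 0 < K) :
    ∃ A : ℝ, 0 ≤ A ∧ ∀ (a : Eucl n → ℂ) (c : Eucl n) (r B : ℝ), 0 < r → 0 ≤ B → Integrable a →
      (∀ x, x ∉ ball c r → a x = 0) → (∀ x, ‖a x‖ ≤ B) → ∫ x, a x = 0 →
      ∫⁻ x, grandMax b K a x ≤ ENNReal.ofReal (A * (B * r ^ n)) := by
  have hω := unitVol_pos (n := n)
  set J : ℝ := ∫ u : Eucl n, (1 + ‖u‖) ^ (-((n : ℝ) + 1)) with hJ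
  have hJ0 : 0 ≤ J := integral_nonneg fun u => by positivity
  have hJi : Integrable fun u : Eucl n => (1 + ‖u‖) ^ (-((n : ℝ) + 1)) :=
    integrable_one_add_norm (by simp)
  set C₁ := unitVol n * K * (2 * 3 ^ (n + 1) + (3 * (b + 1)) ^ (n + 1)) with hC₁
  have hb1 : 0 < b + 1 := by linarith
  refine ⟨C₁ * J, by positivity, fun a c r B hr hB ha hz hbd h0 => ?_⟩
  refine (lintegral_mono fun x => grandMax_atom_le hn hb hK hr hB ha hz hbd h0 x).trans ?_
  have hi : Integrable fun x : Eucl n => (1 + ‖r⁻¹ • (x - c)‖) ^ (-((n : ℝ) + 1)) :=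
    (hJi.comp_smul (inv_ne_zero hr.ne')).comp_sub_right c
  rw [← ofReal_integral_eq_lintegral_ofReal (hi.const_mul _)
    (Eventually.of_forall fun x => by positivity), integral_const_mul]
  refine ENNReal.ofReal_le_ofReal (le_of_eq ?_)
  have e1 : ∫ x : Eucl n, (1 + ‖r⁻¹ • (x - c)‖) ^ (-((n : ℝ) + 1)) = r ^ n * J := by
    rw [integral_sub_right_eq_self (fun x : Eucl n => (1 + ‖r⁻¹ • x‖) ^ (-((n : ℝ) + 1))) c,
      Measure.integral_comp_inv_smul volume
        (fun x : Eucl n => (1 + ‖x‖) ^ (-((n : ℝ) + 1))) r, finrank_euclideanSpace_fin,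
      abs_of_pos (by positivity), smul_eq_mul]
  rw [e1]
  ring

end AtomBound

/-! ### The John–Nirenberg inequality. -/

section JohnNirenberg

variable {n : ℕ} {g : Eucl n → ℂ} {β : ℝ}

/-- The mean of a function over a ball. -/
noncomputable def ballAvg (g : Eucl n → ℂ) (c : Eucl n) (r : ℝ) : ℂ := ⨍ y in ball c r, g y

lemma ball_ae_eq_closedBall (c : Eucl n) {r : ℝ} (hr : 0 < r) :
    (ball c r : Set (Eucl n)) =ᵐ[volume] closedBall c r := by
  refine ae_eq_of_subset_of_measure_ge ball_subset_closedBall ?_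
    measurableSet_ball.nullMeasurableSet measure_closedBall_lt_top.ne
  rw [volume_ball_eq_ofReal c hr, volume_closedBall_eq_ofReal c hr]

lemma integrableOn_sub_const (hg : LocallyIntegrable g) (k : ℂ) (c : Eucl n) (r : ℝ) :
    IntegrableOn (fun x => g x - k) (ball c r) :=
  (integrableOn_ball_of_loc hg c r).sub (integrableOn_const measure_ball_lt_top.ne)

lemma lintegral_osc_le (hβ : bmoENorm g ≤ ENNReal.ofReal β) (c : Eucl n) {r : ℝ} (hr : 0 < r) :
    ∫⁻ x in ball c r, ‖g x - ballAvg g c r‖ₑ ≤ ENNReal.ofReal β * volume (ball c r) := by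
  have h : meanOsc g c r ≤ ENNReal.ofReal β :=
    (le_iSup₂_of_le (f := fun c r => ⨆ (_ : 0 < r), meanOsc g c r) c r
      (le_iSup_of_le hr le_rfl)).trans hβ
  rw [meanOsc, mul_comm, ← div_eq_mul_inv, ENNReal.div_le_iff
    (measure_ball_pos volume c hr).ne' measure_ball_lt_top.ne] at h
  exact h

lemma enorm_ballAvg_sub_mul_le (hg : LocallyIntegrable g) (k : ℂ) (c : Eucl n) {r : ℝ}
    (hr : 0 < r) :
    ‖ballAvg g c r - k‖ₑ * volume (ball c r) ≤ ∫⁻ x in ball c r, ‖g x - k‖ₑ := by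
  have h0 := (measure_ball_pos volume c hr).ne'
  have hav : ballAvg g c r - k = ⨍ x in ball c r, (g x - k) := by
    rw [ballAvg, setAverage_eq, setAverage_eq, integral_sub (integrableOn_ball_of_loc hg c r)
      (integrableOn_const measure_ball_lt_top.ne), smul_sub,
      setIntegral_const, inv_smul_smul₀
        (show volume.real (ball c r) ≠ 0 from (ENNReal.toReal_pos h0 measure_ball_lt_top.ne).ne')]
  have hsm : volume.real (ball c r) • (⨍ x in ball c r, (g x - k)) =
      ∫ x in ball c r, (g x - k) := by
    rw [setAverage_eq, smul_inv_smul₀]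
    exact (ENNReal.toReal_pos h0 measure_ball_lt_top.ne).ne'
  have := enorm_integral_le_lintegral_enorm (μ := volume.restrict (ball c r)) fun x => g x - k
  rw [← hsm, enorm_smul, ← hav] at this
  rwa [Real.enorm_of_nonneg measureReal_nonneg, ofReal_measureReal measure_ball_lt_top.ne,
    mul_comm] at this

/-- The deviation of the smaller mean from the larger is at most the oscillation integral over the
larger ball, divided by the volume of the smaller one. -/
lemma norm_ballAvg_sub_le (hg : LocallyIntegrable g) (hβ0 : 0 ≤ β)
    (hβ : bmoENorm g ≤ ENNReal.ofReal β) {c₁ c₂ : Eucl n} {r₁ r₂ : ℝ} (h₁ : 0 < r₁) (h₂ : 0 < r₂)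
    (hsub : ball c₁ r₁ ⊆ ball c₂ r₂) :
    ‖ballAvg g c₁ r₁ - ballAvg g c₂ r₂‖ ≤ (r₂ / r₁) ^ n * β := by
  have h := (enorm_ballAvg_sub_mul_le hg (ballAvg g c₂ r₂) c₁ h₁).trans
    ((lintegral_mono_set hsub).trans (lintegral_osc_le hβ c₂ h₂))
  have hω := unitVol_pos (n := n)
  rw [volume_ball_eq_ofReal c₁ h₁, volume_ball_eq_ofReal c₂ h₂, ← ofReal_norm,
    ← ENNReal.ofReal_mul (norm_nonneg _), ← ENNReal.ofReal_mul hβ0,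
    ENNReal.ofReal_le_ofReal_iff (by positivity)] at h
  rw [div_pow, div_mul_eq_mul_div, le_div_iff₀ (by positivity)]
  refine le_of_mul_le_mul_right ?_ hω
  linarith

lemma ae_tendsto_ballAvg (hg : LocallyIntegrable g) {R : ℝ} (hR : 0 < R) :
    ∀ᵐ x, Tendsto (fun k : ℕ => ballAvg g x (R / 2 ^ k)) atTop (𝓝 (g x)) := by
  filter_upwards [IsUnifLocDoublingMeasure.ae_tendsto_average (volume : Measure (Eucl n)) hg 1]
    with x hx
  have hδ : Tendsto (fun k : ℕ => R / 2 ^ k) atTop (𝓝[>] 0) := by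
    refine tendsto_nhdsWithin_iff.2 ⟨?_, Eventually.of_forall fun k => ?_⟩
    · have := (tendsto_pow_atTop_nhds_zero_of_lt_one (r := (1 / 2 : ℝ)) (by norm_num)
        (by norm_num)).const_mul R
      rw [mul_zero] at this
      refine this.congr fun k => ?_
      rw [one_div, inv_pow, div_eq_mul_inv]
    · simp only [mem_Ioi]; positivity
  have := hx (fun _ : ℕ => x) (fun k => R / 2 ^ k) hδ (Eventually.of_forall fun k => by
    simp only [mem_closedBall, dist_self]; positivity)
  refine this.congr fun k => ?_
  rw [ballAvg, setAverage_congr (ball_ae_eq_closedBall x (by positivity))]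

/-- The exponential decay rate in the John–Nirenberg inequality. -/
noncomputable def jnConst (n : ℕ) : ℝ := 4 * 24 ^ n + 6 ^ n

lemma jnConst_pos : 0 < jnConst n := by unfold jnConst; positivity

/-- Stopping radii for the John–Nirenberg inequality. -/
lemma exists_stopping_radius (hg : LocallyIntegrable g) (hβ0 : 0 < β)
    (hβ : bmoENorm g ≤ ENNReal.ofReal β) {c x : Eucl n} {R : ℝ} (hR : 0 < R) (hx : x ∈ ball c R)
    (hlim : Tendsto (fun k : ℕ => ballAvg g x (R / 2 ^ k)) atTop (𝓝 (g x)))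
    (hgx : 4 * 24 ^ n * β < ‖g x - ballAvg g c R‖) :
    ∃ ρ, 0 < ρ ∧ ρ ≤ R / 2 ∧ 4 * 24 ^ n * β < ‖ballAvg g x ρ - ballAvg g c R‖ ∧
      ‖ballAvg g x (2 * ρ) - ballAvg g c R‖ ≤ 4 * 24 ^ n * β := by
  have hex : ∃ k : ℕ, 4 * 24 ^ n * β < ‖ballAvg g x (R / 2 ^ k) - ballAvg g c R‖ :=
    ((hlim.sub_const _).norm.eventually_const_lt hgx).exists
  classical
  have hspec := Nat.find_spec hex
  -- The first radius `R` cannot qualify: the balls of radius `R` about `x` and `c` both lie in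
  -- `B(c, 2R)`, so their means differ by at most `2 * 2 ^ n * β`, below the threshold.
  have h0 : Nat.find hex ≠ 0 := by
    intro h0
    rw [h0, pow_zero, div_one] at hspec
    have h2R : 0 < 2 * R := by positivity
    have a1 := norm_ballAvg_sub_le hg hβ0.le hβ (c₁ := x) (c₂ := c) hR h2R
      (ball_subset_ball' (by linarith [mem_ball.1 hx]))
    have a2 := norm_ballAvg_sub_le hg hβ0.le hβ (c₁ := c) (c₂ := c) hR h2R
      (ball_subset_ball (by linarith))
    have a3 := norm_sub_le_norm_sub_add_norm_sub (ballAvg g x R) (ballAvg g c (2 * R))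
      (ballAvg g c R)
    rw [norm_sub_rev (ballAvg g c (2 * R))] at a3
    rw [mul_div_assoc, div_self hR.ne', mul_one] at a1 a2
    have a4 : (2 : ℝ) ^ n ≤ 24 ^ n := pow_le_pow_left₀ (by norm_num) (by norm_num) n
    have a5 : (2 : ℝ) ^ n * β ≤ 24 ^ n * β := by gcongr
    have a6 : 0 < (24 : ℝ) ^ n * β := by positivity
    linarith
  obtain ⟨j, hj⟩ := Nat.exists_eq_succ_of_ne_zero h0
  have hmin := Nat.find_min hex (m := j) (by omega)
  rw [hj] at hspec
  refine ⟨R / 2 ^ (j + 1), by positivity, ?_, hspec, ?_⟩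
  · rw [pow_succ, ← div_div]
    refine div_le_div_of_nonneg_right (div_le_self hR.le (one_le_pow₀ one_le_two)) zero_le_two
  · have : 2 * (R / 2 ^ (j + 1)) = R / 2 ^ j := by rw [pow_succ]; field_simp
    rw [this]
    exact not_lt.1 hmin

/-- The **John–Nirenberg inequality**. -/
theorem john_nirenberg (hg : LocallyIntegrable g) (hβ0 : 0 < β)
    (hβ : bmoENorm g ≤ ENNReal.ofReal β) (m : ℕ) : ∀ (c : Eucl n) (R : ℝ), 0 < R →
    volume {x | x ∈ ball c R ∧ m * jnConst n * β < ‖g x - ballAvg g c R‖} ≤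
      ENNReal.ofReal ((1 / 2) ^ m) * volume (ball c R) := by
  induction m with
  | zero =>
    intro c R _
    simp only [pow_zero, ENNReal.ofReal_one, one_mul]
    exact measure_mono fun x hx => hx.1
  | succ m ih =>
    intro c R hR
    set k := ballAvg g c R with hk
    -- In `24 ^ n = 6 ^ n * 4 ^ n`, the factor `6 ^ n` pays for enlarging the stopping balls and `4
    -- ^ n` for the estimate on `B(c, 2R)`; the 4 in front leaves a total volume of at most half
    -- that of `B(c, R)`.
    set τ := 4 * 24 ^ n * β with hτ
    have hτ0 : 0 < τ := by positivity
    have hAτ : jnConst n * β = τ + 6 ^ n * β := by rw [jnConst, hτ]; ring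
    have h6 : 0 < (6 : ℝ) ^ n * β := by positivity
    set E := {x | x ∈ ball c R ∧ ((m + 1 : ℕ) : ℝ) * jnConst n * β < ‖g x - k‖} with hE
    set G := {x | Tendsto (fun k : ℕ => ballAvg g x (R / 2 ^ k)) atTop (𝓝 (g x))} with hG
    have hm0 : (0 : ℝ) ≤ m * (jnConst n * β) := by
      have := jnConst_pos (n := n)
      positivity
    have hEx : ∀ x ∈ E, m * jnConst n * β + (τ + 6 ^ n * β) < ‖g x - k‖ := by
      intro x hx
      have := hx.2
      push_cast at this
      rw [← hAτ]
      linarith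
    have hradius : ∀ x : Eucl n, ∃ ρ, x ∈ E ∩ G → 0 < ρ ∧ ρ ≤ R / 2 ∧ τ < ‖ballAvg g x ρ - k‖ ∧
        ‖ballAvg g x (2 * ρ) - k‖ ≤ τ := by
      intro x
      by_cases hx : x ∈ E ∩ G
      · obtain ⟨ρ, h⟩ := exists_stopping_radius hg hβ0 hβ hR hx.1.1 hx.2
          (by have := hEx x hx.1
              rw [mul_assoc] at this
              linarith)
        exact ⟨ρ, fun _ => h⟩
      · exact ⟨0, fun h => absurd h hx⟩
    choose ρ hρ using hradius
    obtain ⟨u, hu, hdisj, hcov⟩ :=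
      Vitali.exists_disjoint_subfamily_covering_enlargement_closedBall (E ∩ G) (fun x => x) ρ
        (R / 2) (fun x hx => (hρ x hx).2.1) 5 (by norm_num)
    have hucount : u.Countable := hdisj.countable_of_nonempty_interior fun x hx =>
      ⟨x, ball_subset_interior_closedBall (mem_ball_self (hρ x (hu hx)).1)⟩
    -- At twice the stopping radius the mean is still within `τ` of `k`, and passing to radius `6 ρ`
    -- costs at most `6 ^ n * β`. So a deviation beyond level `m + 1` from `k` is one beyond level
    -- `m` from the local mean, which is the induction hypothesis. Radius 6 instead of Vitali's 5 is
    -- used because the balls here are open.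
    have hcov' : E ∩ G ⊆ ⋃ x ∈ u, {z | z ∈ ball x (6 * ρ x) ∧
        m * jnConst n * β < ‖g z - ballAvg g x (6 * ρ x)‖} := by
      intro z hz
      obtain ⟨x, hx, hsub⟩ := hcov z hz
      have hzx := hsub (mem_closedBall_self (hρ z hz).1.le)
      obtain ⟨p1, p2, p3, p4⟩ := hρ x (hu hx)
      refine mem_iUnion₂.2 ⟨x, hx, ?_, ?_⟩
      · rw [mem_closedBall] at hzx
        rw [mem_ball]
        linarith
      · have a1 := norm_ballAvg_sub_le hg hβ0.le hβ (c₁ := x) (c₂ := x)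
          (show 0 < 2 * ρ x by linarith) (show 0 < 6 * ρ x by linarith)
          (ball_subset_ball (by linarith))
        have a2 : (6 * ρ x / (2 * ρ x)) ^ n ≤ 6 ^ n := by
          rw [mul_div_mul_right _ _ p1.ne']
          exact pow_le_pow_left₀ (by norm_num) (by norm_num) n
        have a3 := mul_le_mul_of_nonneg_right a2 hβ0.le
        have a4 := hEx z hz.1
        have a5 : ‖g z - k‖ ≤ ‖g z - ballAvg g x (6 * ρ x)‖ +
            (‖ballAvg g x (2 * ρ x) - ballAvg g x (6 * ρ x)‖ + ‖ballAvg g x (2 * ρ x) - k‖) := by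
          have e : g z - k = (g z - ballAvg g x (6 * ρ x)) +
            (-(ballAvg g x (2 * ρ x) - ballAvg g x (6 * ρ x)) + (ballAvg g x (2 * ρ x) - k)) := by
            ring
          rw [e]
          refine (norm_add_le _ _).trans (add_le_add le_rfl ((norm_add_le _ _).trans ?_))
          rw [norm_neg]
        linarith
    have hGae : volume Gᶜ = 0 := ae_iff.1 (ae_tendsto_ballAvg hg hR)
    have h1 : volume E ≤ ∑' x : u, ENNReal.ofReal ((1 / 2) ^ m) *
        volume (ball (x : Eucl n) (6 * ρ x)) := by
      calc volume E ≤ volume (E ∩ G) + volume Gᶜ := by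
            refine (measure_mono fun x hx => ?_).trans (measure_union_le _ _)
            by_cases h : x ∈ G
            · exact Or.inl ⟨hx, h⟩
            · exact Or.inr h
        _ = volume (E ∩ G) := by rw [hGae, add_zero]
        _ ≤ _ := measure_mono hcov'
        _ ≤ ∑' x : u, volume {z | z ∈ ball (x : Eucl n) (6 * ρ x) ∧
              m * jnConst n * β < ‖g z - ballAvg g x (6 * ρ x)‖} :=
            measure_biUnion_le volume hucount _
        _ ≤ _ := ENNReal.tsum_le_tsum fun x => ih x (6 * ρ x) (by linarith [(hρ x (hu x.2)).1])
    -- On each stopping ball the mean deviates from `k` by more than `τ`. The balls are disjoint and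
    -- lie in `B(c, 2R)`, so their total volume is bounded by the oscillation there.
    have h2 : ENNReal.ofReal τ * ∑' x : u, volume (ball (x : Eucl n) (ρ x)) ≤
        ENNReal.ofReal (2 * 4 ^ n * β) * volume (ball c R) := by
      have hcnt := hucount.to_subtype
      have h2R : 0 < 2 * R := by linarith
      calc ENNReal.ofReal τ * ∑' x : u, volume (ball (x : Eucl n) (ρ x))
          = ∑' x : u, ENNReal.ofReal τ * volume (ball (x : Eucl n) (ρ x)) :=
            ENNReal.tsum_mul_left.symm
        _ ≤ ∑' x : u, ∫⁻ z in ball (x : Eucl n) (ρ x), ‖g z - k‖ₑ := by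
            refine ENNReal.tsum_le_tsum fun x => ?_
            obtain ⟨p1, p2, p3, p4⟩ := hρ x (hu x.2)
            refine le_trans ?_ (enorm_ballAvg_sub_mul_le hg k x p1)
            gcongr
            rw [← ofReal_norm]
            exact ENNReal.ofReal_le_ofReal p3.le
        _ = ∫⁻ z in ⋃ x : u, ball (x : Eucl n) (ρ x), ‖g z - k‖ₑ := by
            refine (lintegral_iUnion (fun _ => measurableSet_ball) (fun x y hxy => ?_) _).symm
            have := hdisj x.2 y.2 fun h => hxy (Subtype.ext h)
            exact this.mono ball_subset_closedBall ball_subset_closedBall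
        _ ≤ ∫⁻ z in ball c (2 * R), ‖g z - k‖ₑ := by
            refine lintegral_mono_set (iUnion_subset fun x => ball_subset_ball' ?_)
            obtain ⟨p1, p2, p3, p4⟩ := hρ x (hu x.2)
            have := mem_ball.1 (hu x.2).1.1
            linarith
        _ ≤ ∫⁻ z in ball c (2 * R), (‖g z - ballAvg g c (2 * R)‖ₑ +
              ‖ballAvg g c (2 * R) - k‖ₑ) := by
            refine lintegral_mono fun z => ?_
            refine le_trans (le_of_eq ?_) (enorm_add_le _ _)
            rw [sub_add_sub_cancel]
        _ ≤ ENNReal.ofReal β * volume (ball c (2 * R)) +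
              ENNReal.ofReal (2 ^ n * β) * volume (ball c (2 * R)) := by
            rw [lintegral_add_right _ measurable_const, setLIntegral_const]
            refine add_le_add (lintegral_osc_le hβ c h2R) (mul_le_mul_left ?_ _)
            rw [← ofReal_norm, norm_sub_rev]
            refine ENNReal.ofReal_le_ofReal ?_
            have := norm_ballAvg_sub_le hg hβ0.le hβ (c₁ := c) (c₂ := c) hR h2R
              (ball_subset_ball (by linarith))
            rwa [mul_div_assoc, div_self hR.ne', mul_one] at this
        _ ≤ _ := by
            rw [volume_ball_eq_ofReal c h2R, volume_ball_eq_ofReal c hR]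
            have hω := unitVol_pos (n := n)
            rw [← ENNReal.ofReal_mul hβ0.le, ← ENNReal.ofReal_mul (by positivity),
              ← ENNReal.ofReal_mul (by positivity), ← ENNReal.ofReal_add (by positivity)
              (by positivity)]
            refine ENNReal.ofReal_le_ofReal ?_
            have h4 : (4 : ℝ) ^ n = 2 ^ n * 2 ^ n := by rw [← mul_pow]; norm_num
            have h5 : (1 : ℝ) ≤ 2 ^ n := one_le_pow₀ one_le_two
            rw [mul_pow, h4]
            have h6 : 0 ≤ 2 ^ n * β * (R ^ n * unitVol n) := by positivity
            nlinarith
    have h3 : ∑' x : u, volume (ball (x : Eucl n) (6 * ρ x)) ≤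
        ENNReal.ofReal (1 / 2) * volume (ball c R) := by
      have e1 : ∀ x : u, volume (ball (x : Eucl n) (6 * ρ x)) =
          ENNReal.ofReal (6 ^ n / τ) * (ENNReal.ofReal τ * volume (ball (x : Eucl n) (ρ x))) := by
        intro x
        have p1 := (hρ x (hu x.2)).1
        have hω := unitVol_pos (n := n)
        rw [volume_ball_eq_ofReal _ p1, volume_ball_eq_ofReal _ (by linarith),
          ← ENNReal.ofReal_mul hτ0.le, ← ENNReal.ofReal_mul (by positivity)]
        congr 1
        rw [mul_pow]
        field_simp
      simp only [e1, ENNReal.tsum_mul_left]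
      refine (mul_le_mul_right h2 _).trans (le_of_eq ?_)
      rw [← mul_assoc, ← ENNReal.ofReal_mul (by positivity)]
      congr 2
      rw [hτ, show (24 : ℝ) = 6 * 4 by norm_num, mul_pow]
      field_simp
      norm_num
    refine h1.trans ?_
    rw [ENNReal.tsum_mul_left]
    refine (mul_le_mul_right h3 _).trans (le_of_eq ?_)
    rw [← mul_assoc, ← ENNReal.ofReal_mul (by positivity), pow_succ]

lemma summable_jn (p : ℝ) : Summable fun m : ℕ => ((m : ℝ) + 1) ^ p * (1 / 2) ^ m := by
  have h := summable_pow_mul_geometric_of_norm_lt_one ⌈p⌉₊ (r := (1 / 2 : ℝ)) (by norm_num)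
  have h2 := (summable_nat_add_iff 1).2 h
  refine Summable.of_nonneg_of_le (fun m => by positivity) (fun m => ?_) (h2.mul_left 2)
  have e : 2 * (((m + 1 : ℕ) : ℝ) ^ ⌈p⌉₊ * (1 / 2) ^ (m + 1)) =
      ((m : ℝ) + 1) ^ ⌈p⌉₊ * (1 / 2) ^ m := by
    rw [pow_succ]; push_cast; ring
  rw [e]
  gcongr
  rw [← Real.rpow_natCast]
  exact Real.rpow_le_rpow_of_exponent_le (by linarith [Nat.cast_nonneg (α := ℝ) m])
    (Nat.le_ceil p)

/-- The `Lᵖ` form of the John–Nirenberg inequality. -/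
theorem exists_lintegral_rpow_osc_le (n : ℕ) {p : ℝ} (hp : 0 < p) :
    ∃ S : ℝ, 0 < S ∧ ∀ (g : Eucl n → ℂ) (β : ℝ), LocallyIntegrable g → 0 < β →
      bmoENorm g ≤ ENNReal.ofReal β → ∀ (c : Eucl n) (r : ℝ), 0 < r →
      ∫⁻ x in ball c r, ‖g x - ballAvg g c r‖ₑ ^ p ≤
        ENNReal.ofReal ((S * β) ^ p) * volume (ball c r) := by
  set T := ∑' m : ℕ, ((m : ℝ) + 1) ^ p * (1 / 2) ^ m with hT
  have hsum := summable_jn p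
  have hT0 : 0 < T := hsum.tsum_pos (fun m => by positivity) 0 (by simp)
  have hA := jnConst_pos (n := n)
  refine ⟨T ^ (1 / p) * jnConst n, by positivity, fun g β hg hβ0 hβ c r hr => ?_⟩
  set k := ballAvg g c r with hk
  set L := jnConst n * β with hL
  have hL0 : 0 < L := by positivity
  have hme : AEMeasurable (fun x => ‖g x - k‖) (volume.restrict (ball c r)) :=
    (integrableOn_sub_const hg k c r).aestronglyMeasurable.norm.aemeasurable
  set F : ℕ → Eucl n → ℝ≥0∞ := fun m x =>
    if m * jnConst n * β < ‖g x - k‖ then ENNReal.ofReal (((m + 1) * L) ^ p) else 0 with hF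
  -- The single layer with `m L < |g x - k| ≤ (m + 1) L` already dominates, and each layer has
  -- exponentially small measure.
  have hpt : ∀ x, ‖g x - k‖ₑ ^ p ≤ ∑' m : ℕ, F m x := by
    intro x
    rcases (norm_nonneg (g x - k)).eq_or_lt with h | h
    · have : ‖g x - k‖ₑ = 0 := by rw [← ofReal_norm, ← h, ENNReal.ofReal_zero]
      rw [this, ENNReal.zero_rpow_of_pos hp]
      exact zero_le
    · obtain ⟨m, hm1, hm2⟩ : ∃ m : ℕ, m * L < ‖g x - k‖ ∧ ‖g x - k‖ ≤ (m + 1) * L := by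
        have hpos : 0 < ⌈‖g x - k‖ / L⌉₊ := Nat.ceil_pos.2 (by positivity)
        refine ⟨⌈‖g x - k‖ / L⌉₊ - 1, ?_, ?_⟩
        · rw [← lt_div_iff₀ hL0]
          exact Nat.lt_ceil.1 (by omega)
        · rw [← div_le_iff₀ hL0]
          have := Nat.le_ceil (‖g x - k‖ / L)
          rw [← Nat.cast_add_one, Nat.sub_add_cancel hpos]
          exact this
      refine le_trans ?_ (ENNReal.le_tsum m)
      simp only [hF]
      rw [if_pos (by rw [mul_assoc]; exact hm1), ← ofReal_norm,
        ENNReal.ofReal_rpow_of_nonneg (norm_nonneg _) hp.le]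
      exact ENNReal.ofReal_le_ofReal (Real.rpow_le_rpow (norm_nonneg _) hm2 hp.le)
  have hFm : ∀ m, AEMeasurable (F m) (volume.restrict (ball c r)) := by
    intro m
    have hm : Measurable fun s : ℝ =>
        if m * jnConst n * β < s then ENNReal.ofReal (((m + 1) * L) ^ p) else 0 :=
      Measurable.ite measurableSet_Ioi measurable_const measurable_const
    exact hm.comp_aemeasurable hme
  have hFi : ∀ m, ∫⁻ x in ball c r, F m x ≤
      ENNReal.ofReal (L ^ p * (((m : ℝ) + 1) ^ p * (1 / 2) ^ m)) * volume (ball c r) := by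
    intro m
    have hnull : NullMeasurableSet {x | m * jnConst n * β < ‖g x - k‖}
        (volume.restrict (ball c r)) := nullMeasurableSet_lt aemeasurable_const hme
    have e : ∫⁻ x in ball c r, F m x = ENNReal.ofReal (((m + 1) * L) ^ p) *
        (volume.restrict (ball c r)) {x | m * jnConst n * β < ‖g x - k‖} := by
      rw [← lintegral_indicator_const₀ hnull]
      exact lintegral_congr fun x => by simp only [hF, indicator_apply, mem_ofPred_eq]
    rw [e, Measure.restrict_apply₀ hnull]
    have hj := john_nirenberg hg hβ0 hβ m c r hr
    have hset : {x | m * jnConst n * β < ‖g x - k‖} ∩ ball c r =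
        {x | x ∈ ball c r ∧ m * jnConst n * β < ‖g x - ballAvg g c r‖} := by
      ext x; exact and_comm
    rw [hset]
    refine (mul_le_mul_right hj _).trans (le_of_eq ?_)
    rw [← mul_assoc, ← ENNReal.ofReal_mul (by positivity),
      Real.mul_rpow (by positivity) hL0.le]
    congr 2
    ring
  calc ∫⁻ x in ball c r, ‖g x - k‖ₑ ^ p ≤ ∫⁻ x in ball c r, ∑' m : ℕ, F m x :=
        lintegral_mono fun x => hpt x
    _ = ∑' m : ℕ, ∫⁻ x in ball c r, F m x := lintegral_tsum hFm
    _ ≤ ∑' m : ℕ, ENNReal.ofReal (L ^ p * (((m : ℝ) + 1) ^ p * (1 / 2) ^ m)) *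
          volume (ball c r) := ENNReal.tsum_le_tsum hFi
    _ = ENNReal.ofReal (L ^ p * T) * volume (ball c r) := by
        rw [ENNReal.tsum_mul_right, ← ENNReal.ofReal_tsum_of_nonneg (fun m => by positivity)
          (hsum.mul_left _), tsum_mul_left]
    _ = _ := by
        congr 2
        rw [mul_assoc, ← hL, Real.mul_rpow (x := T ^ (1 / p)) (by positivity) hL0.le,
          ← Real.rpow_mul hT0.le, one_div, inv_mul_cancel₀ hp.ne', Real.rpow_one, mul_comm]

end JohnNirenberg

/-! ### The pairing of atoms with functions of bounded mean oscillation. -/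

section Pairing

variable {n : ℕ}

/-- Atoms for the exponent `∞` are atoms for every exponent. -/
lemma IsHardyAtom.of_top {q : ℝ≥0∞} {a : LOne n} (h : IsHardyAtom ⊤ a) : IsHardyAtom q a := by
  obtain ⟨c, r, hr, hz, hb, h0⟩ := h
  refine ⟨c, r, hr, hz, ?_, h0⟩
  have hv0 := (measure_ball_pos volume c hr).ne'
  have hind : (a : Eucl n → ℂ) =ᵐ[volume] (ball c r).indicator a := by
    filter_upwards [hz] with x hx
    by_cases hxb : x ∈ ball c r
    · rw [indicator_of_mem hxb]
    · rw [indicator_of_notMem hxb, hx hxb]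
  rw [eLpNorm_congr_ae hind, eLpNorm_indicator_eq_eLpNorm_restrict measurableSet_ball] at hb ⊢
  refine (eLpNorm_le_eLpNorm_mul_rpow_measure_univ le_top
    (Lp.aestronglyMeasurable a).restrict).trans ?_
  refine (mul_le_mul_left hb _).trans (le_of_eq ?_)
  rw [Measure.restrict_apply_univ, ← ENNReal.rpow_add _ _ hv0 measure_ball_lt_top.ne]
  congr 1
  simp [ENNReal.toReal_inv]

/-- For `q = ∞` this is the definition of the `BMO`-norm. For finite `q` it is Hölder's inequality
with the John–Nirenberg estimate at the conjugate exponent, and the powers of the volume cancel. -/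
lemma lintegral_atom_mul_osc_le (n : ℕ) {q : ℝ≥0∞} (hq : 1 < q) :
    ∃ S : ℝ, 0 < S ∧ ∀ (a g : Eucl n → ℂ) (β : ℝ) (c : Eucl n) (r : ℝ),
      AEStronglyMeasurable a → LocallyIntegrable g → 0 < β → bmoENorm g ≤ ENNReal.ofReal β →
      0 < r → eLpNorm a q volume ≤ volume (ball c r) ^ (-1 + (q⁻¹).toReal) →
      ∫⁻ x in ball c r, ‖a x‖ₑ * ‖g x - ballAvg g c r‖ₑ ≤ ENNReal.ofReal (S * β) := by
  rcases eq_or_ne q ⊤ with rfl | hqt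
  · refine ⟨1, one_pos, fun a g β c r ha hg hβ0 hβ hr hb => ?_⟩
    have hv0 := (measure_ball_pos volume c hr).ne'
    rw [eLpNorm_exponent_top, ENNReal.inv_top, ENNReal.toReal_zero, add_zero,
      ENNReal.rpow_neg_one] at hb
    have hae : ∀ᵐ x ∂volume.restrict (ball c r), ‖a x‖ₑ ≤ (volume (ball c r))⁻¹ := by
      filter_upwards [ae_restrict_of_ae (enorm_ae_le_eLpNormEssSup a volume)] with x hx
      exact hx.trans hb
    calc ∫⁻ x in ball c r, ‖a x‖ₑ * ‖g x - ballAvg g c r‖ₑ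
        ≤ ∫⁻ x in ball c r, (volume (ball c r))⁻¹ * ‖g x - ballAvg g c r‖ₑ :=
          lintegral_mono_ae (hae.mono fun x hx => mul_le_mul_left hx _)
      _ = (volume (ball c r))⁻¹ * ∫⁻ x in ball c r, ‖g x - ballAvg g c r‖ₑ :=
          lintegral_const_mul' _ _ (ENNReal.inv_ne_top.2 hv0)
      _ ≤ (volume (ball c r))⁻¹ * (ENNReal.ofReal β * volume (ball c r)) :=
          mul_le_mul_right (lintegral_osc_le hβ c hr) _
      _ = ENNReal.ofReal (1 * β) := by
          rw [mul_left_comm, ENNReal.inv_mul_cancel hv0 measure_ball_lt_top.ne, mul_one, one_mul]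
  · set s := q.toReal with hs
    have hs1 : 1 < s := by
      rw [hs, ← ENNReal.toReal_one]
      exact (ENNReal.toReal_lt_toReal ENNReal.one_ne_top hqt).2 hq
    have hconj : s.HolderConjugate (s.conjExponent) := Real.HolderConjugate.conjExponent hs1
    set p := s.conjExponent
    obtain ⟨S, hS, hjn⟩ := exists_lintegral_rpow_osc_le n hconj.symm.pos
    refine ⟨S, hS, fun a g β c r ha hg hβ0 hβ hr hb => ?_⟩
    have hv0 := (measure_ball_pos volume c hr).ne'
    have hgm := (integrableOn_sub_const hg (ballAvg g c r) c r).aestronglyMeasurable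
    have h1 := ENNReal.lintegral_mul_le_Lp_mul_Lq (volume.restrict (ball c r)) hconj
      ha.restrict.enorm hgm.enorm
    refine h1.trans ?_
    have h2 : (∫⁻ x in ball c r, ‖a x‖ₑ ^ s) ^ (1 / s) ≤
        volume (ball c r) ^ (-1 + (q⁻¹).toReal) := by
      refine le_trans ?_ hb
      rw [eLpNorm_eq_lintegral_rpow_enorm_toReal (by rintro rfl; simp at hq) hqt]
      exact ENNReal.rpow_le_rpow (setLIntegral_le_lintegral _ _) (by positivity)
    have h3 : (∫⁻ x in ball c r, ‖g x - ballAvg g c r‖ₑ ^ p) ^ (1 / p) ≤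
        ENNReal.ofReal (S * β) * volume (ball c r) ^ (1 / p) := by
      have hp := hconj.symm.pos
      refine (ENNReal.rpow_le_rpow (hjn g β hg hβ0 hβ c r hr) (by positivity)).trans (le_of_eq ?_)
      rw [ENNReal.mul_rpow_of_nonneg _ _ (by positivity),
        ← ENNReal.ofReal_rpow_of_nonneg (by positivity) hp.le, ← ENNReal.rpow_mul, mul_one_div,
        div_self hp.ne', ENNReal.rpow_one]
    refine (mul_le_mul' h2 h3).trans (le_of_eq ?_)
    rw [mul_left_comm, ← ENNReal.rpow_add _ _ hv0 measure_ball_lt_top.ne]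
    have he : -1 + (q⁻¹).toReal + 1 / p = 0 := by
      have := hconj.inv_add_inv_eq_one
      rw [ENNReal.toReal_inv, ← hs, one_div]
      linarith
    rw [he, ENNReal.rpow_zero, mul_one]

/-- Atoms define uniformly bounded functionals on `BMO`. -/
theorem exists_atom_pairing_le (n : ℕ) {q : ℝ≥0∞} (hq : 1 < q) :
    ∃ S : ℝ, 0 < S ∧ ∀ a : LOne n, IsHardyAtom q a → ∀ g : BMOFun n,
      Integrable (fun x => a x * g.toFun x) ∧ ‖∫ x, a x * g.toFun x‖ ≤ S * ‖g‖ := by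
  obtain ⟨S, hS, hkey⟩ := lintegral_atom_mul_osc_le n hq
  refine ⟨S, hS, fun a ⟨c, r, hr, hz, hb, h0⟩ g => ?_⟩
  have hg := g.locallyIntegrable
  have ha : Integrable a := L1.integrable_coeFn a
  set k := ballAvg g.toFun c r
  have hbmo : bmoENorm g.toFun = ENNReal.ofReal ‖g‖ := by
    rw [BMOFun.norm_def, ENNReal.ofReal_toReal g.bmoENorm_ne_top]
  have hm : AEStronglyMeasurable fun x => a x * (g.toFun x - k) :=
    ha.1.mul (hg.aestronglyMeasurable.sub aestronglyMeasurable_const)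
  -- The oscillation estimates need `β > 0`, but the seminorm of `g` may vanish; `β` is allowed to
  -- decrease to `‖g‖` at the end.
  have hle : ∀ β, ‖g‖ < β → ∫⁻ x, ‖a x * (g.toFun x - k)‖ₑ ≤ ENNReal.ofReal (S * β) := by
    intro β hβ
    refine le_trans (le_of_eq ?_) (hkey a g.toFun β c r ha.1 hg ((norm_nonneg g).trans_lt hβ)
      (hbmo.trans_le (ENNReal.ofReal_le_ofReal hβ.le)) hr hb)
    rw [← lintegral_indicator measurableSet_ball]
    refine lintegral_congr_ae ?_
    filter_upwards [hz] with x hx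
    by_cases hxb : x ∈ ball c r
    · rw [indicator_of_mem hxb, enorm_mul]
    · rw [indicator_of_notMem hxb, hx hxb, zero_mul, enorm_zero]
  have hint : Integrable fun x => a x * (g.toFun x - k) :=
    ⟨hm, (hle (‖g‖ + 1) (by linarith)).trans_lt ENNReal.ofReal_lt_top⟩
  -- The atom annihilates constants, so only the oscillation of `g` over its ball matters.
  have hsplit : (fun x => a x * g.toFun x) = fun x => a x * (g.toFun x - k) + a x * k := by
    ext x; ring
  have hak : ∫ x, a x * k = 0 := by
    rw [integral_mul_const]
    have : ∫ x, a x = ∫ x in ball c r, a x :=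
      (setIntegral_eq_integral_of_ae_compl_eq_zero hz).symm
    rw [this, h0, zero_mul]
  rw [hsplit]
  refine ⟨hint.add (ha.mul_const k), ?_⟩
  rw [integral_add hint (ha.mul_const k), hak, add_zero]
  refine le_of_forall_gt_imp_ge_of_dense fun s hs => ?_
  have hβ : ‖g‖ < s / S := by rwa [lt_div_iff₀' hS]
  have h1 := (enorm_integral_le_lintegral_enorm fun x => a x * (g.toFun x - k)).trans
    (hle (s / S) hβ)
  have hs0 : 0 ≤ s := le_trans (by positivity) hs.le
  rw [mul_div_cancel₀ _ hS.ne', ← ofReal_norm, ENNReal.ofReal_le_ofReal_iff hs0] at h1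
  exact h1

/-- The functional on `BMO` given by an atomic decomposition. -/
theorem exists_pairing_functional (n : ℕ) {q : ℝ≥0∞} (hq : 1 < q) :
    ∃ S : ℝ, 0 < S ∧ ∀ (μ : ℕ → ℂ) (a : ℕ → LOne n) (f : LOne n), IsAtomicDecomposition q μ a f →
      ∃ Λ : StrongDual ℂ (BMO n), ‖Λ‖ ≤ S * ∑' j, ‖μ j‖ ∧ ∀ g : BMOFun n,
        (∀ j, Integrable (fun x => a j x * g.toFun x)) ∧
        Summable (fun j => ‖μ j * ∫ x, a j x * g.toFun x‖) ∧
        Λ (BMO.mk g) = ∑' j, μ j * ∫ x, a j x * g.toFun x := by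
  obtain ⟨S, hS, hpair⟩ := exists_atom_pairing_le n hq
  refine ⟨S, hS, fun μ a f hdec => ?_⟩
  have hi : ∀ (g : BMOFun n) j, Integrable (fun x => a j x * g.toFun x) := fun g j =>
    (hpair (a j) (hdec.atom j) g).1
  have hle : ∀ (g : BMOFun n) j, ‖μ j * ∫ x, a j x * g.toFun x‖ ≤ S * ‖g‖ * ‖μ j‖ := by
    intro g j
    rw [norm_mul, mul_comm]
    gcongr
    exact (hpair (a j) (hdec.atom j) g).2
  have hs : ∀ g : BMOFun n, Summable (fun j => ‖μ j * ∫ x, a j x * g.toFun x‖) := fun g =>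
    Summable.of_nonneg_of_le (fun _ => norm_nonneg _) (hle g) (hdec.summable.mul_left _)
  let ℓ : BMOFun n →ₗ[ℂ] ℂ :=
    { toFun := fun g => ∑' j, μ j * ∫ x, a j x * g.toFun x
      map_add' := fun g h => by
        rw [← (hs g).of_norm.tsum_add (hs h).of_norm]
        refine tsum_congr fun j => ?_
        rw [← mul_add, ← integral_add (hi g j) (hi h j)]
        simp only [map_add, Pi.add_apply, mul_add]
      map_smul' := fun k g => by
        rw [RingHom.id_apply, smul_eq_mul, ← tsum_mul_left]
        refine tsum_congr fun j => ?_
        have e : (fun x => a j x * BMOFun.toFun (k • g) x) =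
            fun x => k * (a j x * g.toFun x) := by
          ext x
          rw [map_smul, Pi.smul_apply, smul_eq_mul, mul_left_comm]
        rw [e, integral_const_mul, mul_left_comm] }
  have hbound : ∀ g, ‖ℓ g‖ ≤ S * (∑' j, ‖μ j‖) * ‖g‖ := by
    intro g
    have h := tsum_of_norm_bounded ((hdec.summable.mul_left (S * ‖g‖)).hasSum) (hle g)
    rw [tsum_mul_left] at h
    refine h.trans (le_of_eq ?_)
    ring
  let ℓc : BMOFun n →L[ℂ] ℂ := ℓ.mkContinuous _ hbound
  let Λ : StrongDual ℂ (BMO n) := SeparationQuotient.liftCLM ℓc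
    fun x y hxy => (hxy.map ℓc.continuous).eq
  have hΛ : ∀ g, Λ (BMO.mk g) = ℓ g := fun g => rfl
  refine ⟨Λ, ?_, fun g => ⟨hi g, hs g, hΛ g⟩⟩
  have hT0 : 0 ≤ ∑' j, ‖μ j‖ := tsum_nonneg fun _ => norm_nonneg _
  refine ContinuousLinearMap.opNorm_le_bound _ (by positivity) fun v => ?_
  obtain ⟨g, rfl⟩ := SeparationQuotient.surjective_mk v
  rw [SeparationQuotient.norm_mk]
  exact hbound g

/-- Integration against a bounded continuous function, as a functional on `L¹`. -/
lemma hasSum_integral_mul {ι : Type*} {u : ι → LOne n} {f : LOne n} (h : HasSum u f)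
    {g : Eucl n → ℂ} (hg : Continuous g) {C : ℝ} (hC : ∀ x, ‖g x‖ ≤ C) :
    HasSum (fun i => ∫ x, u i x * g x) (∫ x, f x * g x) := by
  have hi : ∀ v : LOne n, Integrable fun x => v x * g x := fun v =>
    (L1.integrable_coeFn v).mul_bdd (c := C) hg.aestronglyMeasurable (Eventually.of_forall hC)
  let ℓ : LOne n →ₗ[ℂ] ℂ :=
    { toFun := fun v => ∫ x, v x * g x
      map_add' := fun v w => by
        rw [← integral_add (hi v) (hi w)]
        refine integral_congr_ae ?_
        filter_upwards [Lp.coeFn_add v w] with x hx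
        rw [hx, Pi.add_apply, add_mul]
      map_smul' := fun k v => by
        rw [RingHom.id_apply, smul_eq_mul, ← integral_const_mul]
        refine integral_congr_ae ?_
        filter_upwards [Lp.coeFn_smul k v] with x hx
        rw [hx, Pi.smul_apply, smul_eq_mul, mul_assoc] }
  have hb : ∀ v, ‖ℓ v‖ ≤ C * ‖v‖ := by
    intro v
    rw [L1.norm_eq_integral_norm, ← integral_const_mul]
    refine norm_integral_le_of_norm_le ((L1.integrable_coeFn v).norm.const_mul C)
      (Eventually.of_forall fun x => ?_)
    rw [norm_mul, mul_comm]
    gcongr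
    exact hC x
  exact h.mapL (ℓ.mkContinuous C hb)

/-- On continuous functions with compact support the atomic pairing is integration. -/
lemma tsum_pairing_eq_integral {q : ℝ≥0∞} {μ : ℕ → ℂ} {a : ℕ → LOne n} {f : LOne n}
    (hdec : IsAtomicDecomposition q μ a f) {g : Eucl n → ℂ} (hg : Continuous g)
    (hgs : HasCompactSupport g) :
    ∑' j, μ j * ∫ x, a j x * g x = ∫ x, f x * g x := by
  obtain ⟨C, hC⟩ := hg.bounded_above_of_compact_support hgs
  rw [← (hasSum_integral_mul hdec.hasSum hg hC).tsum_eq]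
  refine tsum_congr fun j => ?_
  rw [← integral_const_mul]
  refine integral_congr_ae ?_
  filter_upwards [Lp.coeFn_smul (μ j) (a j)] with x hx
  rw [hx, Pi.smul_apply, smul_eq_mul, mul_assoc]

/-- The canonical map from the continuous functions with compact support to `VMO`. -/
noncomputable def ccToVMO (n : ℕ) : ccSubmodule n →ₗ[ℂ] VMO n :=
  ((BMO.mk : BMOFun n →L[ℂ] BMO n).toLinearMap.comp (ccSubmodule n).subtype).codRestrict (VMO n)
    fun g => Submodule.le_topologicalClosure _ ⟨g, g.2, rfl⟩

lemma norm_ccToVMO (g : ccSubmodule n) : ‖ccToVMO n g‖ = ‖(g : BMOFun n)‖ := rfl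

/-- Continuous functions with compact support are dense in `VMO n` by definition. This makes the
pairing independent of the atomic decomposition and of the exponent. -/
lemma ext_on_cc {Λ₁ Λ₂ : StrongDual ℂ (VMO n)}
    (h : ∀ g : ccSubmodule n, Λ₁ (ccToVMO n g) = Λ₂ (ccToVMO n g)) : Λ₁ = Λ₂ := by
  set S := (ccSubmodule n).map (BMO.mk : BMOFun n →L[ℂ] BMO n).toLinearMap with hS
  have hsub : (S : Set (BMO n)) ⊆ (VMO n : Set (BMO n)) := S.le_topologicalClosure
  have hd : DenseRange (Set.inclusion hsub) :=
    (denseRange_inclusion_iff hsub).2 (le_of_eq S.topologicalClosure_coe)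
  refine ContinuousLinearMap.coeFn_injective ?_
  refine hd.equalizer Λ₁.continuous Λ₂.continuous ?_
  ext ⟨v, hv⟩
  obtain ⟨g, hg, rfl⟩ := hv
  exact h ⟨g, hg⟩

end Pairing

/-! ### Factoring functionals, and integrals of uncountable suprema. -/

section General

/-- A functional dominated by the norm of a linear image factors through that image. -/
lemma exists_dual_factor {V E : Type*} [AddCommGroup V] [Module ℂ V] [NormedAddCommGroup E]
    [NormedSpace ℂ E] (J : V →ₗ[ℂ] E) (ℓ : V →ₗ[ℂ] ℂ) {C : ℝ} (h : ∀ v, ‖ℓ v‖ ≤ C * ‖J v‖) :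
    ∃ Λ : StrongDual ℂ E, ∀ v, Λ (J v) = ℓ v := by
  -- Any linear section of `J` will do, because the bound makes `ℓ` vanish on the kernel of `J`.
  -- Hahn–Banach then extends the functional from the range.
  obtain ⟨s, hs⟩ := J.rangeRestrict.exists_rightInverse_of_surjective J.range_rangeRestrict
  have hs' : ∀ u : LinearMap.range J, J (s u) = u := fun u => by
    have := congrArg Subtype.val (LinearMap.congr_fun hs u)
    exact this
  let p : StrongDual ℂ (LinearMap.range J) := (ℓ.comp s).mkContinuous C fun u => by
    have := h (s u)
    rw [hs' u] at this
    exact this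
  obtain ⟨Λ, hΛ, -⟩ := exists_extension_norm_eq (LinearMap.range J) p
  refine ⟨Λ, fun v => ?_⟩
  have h1 : Λ (J v) = ℓ (s ⟨J v, LinearMap.mem_range_self J v⟩) :=
    hΛ ⟨J v, LinearMap.mem_range_self J v⟩
  rw [h1, ← sub_eq_zero, ← map_sub, ← norm_le_zero_iff]
  refine (h _).trans (le_of_eq ?_)
  rw [map_sub, hs', sub_self, norm_zero, mul_zero]

/-- For each rational level, the open sets whose constant exceeds the level have the same union as a
countable subfamily, by the Lindelöf property. Countably many levels suffice to recover the
supremum. -/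
lemma exists_countable_iSup_indicator {X α : Type*} [TopologicalSpace X]
    [SecondCountableTopology X] (c : α → ℝ≥0∞) (U : α → Set X) (hU : ∀ p, IsOpen (U p)) :
    ∃ T : Set α, T.Countable ∧ ∀ x, ⨆ p, (U p).indicator (fun _ => c p) x ≤
      ⨆ p : T, (U p).indicator (fun _ => c p) x := by
  classical
  have hop : ∀ (q : ℝ≥0∞) (p : α), IsOpen (if q < c p then U p else ∅) := by
    intro q p
    split_ifs
    · exact hU p
    · exact isOpen_empty
  choose T hTc hTU using fun q : ℚ =>
    TopologicalSpace.isOpen_iUnion_countable _ (hop ((q : ℝ).toNNReal : ℝ≥0∞))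
  refine ⟨⋃ q, T q, countable_iUnion hTc, fun x => ?_⟩
  refine le_of_forall_lt fun m hm => ?_
  obtain ⟨p, hp⟩ := lt_iSup_iff.1 hm
  obtain ⟨q, -, hmq, hqp⟩ := ENNReal.lt_iff_exists_rat_btwn.1 hp
  have hx : x ∈ U p := by
    by_contra h
    rw [indicator_of_notMem h] at hqp
    exact not_lt_bot hqp
  rw [indicator_of_mem hx] at hqp
  have hxU : x ∈ ⋃ p, (if ((q : ℝ).toNNReal : ℝ≥0∞) < c p then U p else ∅) :=
    mem_iUnion.2 ⟨p, by rw [if_pos hqp]; exact hx⟩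
  rw [← hTU q] at hxU
  obtain ⟨p', hp', hx'⟩ := mem_iUnion₂.1 hxU
  by_cases hlt : ((q : ℝ).toNNReal : ℝ≥0∞) < c p'
  · rw [if_pos hlt] at hx'
    refine hmq.trans (lt_of_lt_of_le hlt ?_)
    refine le_iSup_of_le (⟨p', mem_iUnion.2 ⟨q, hp'⟩⟩ : ↥(⋃ q, T q)) ?_
    simp only
    rw [indicator_of_mem hx']
  · rw [if_neg hlt] at hx'
    exact absurd hx' (notMem_empty x)

/-- By induction, each point of the union is assigned to an index attaining the maximum: a new index
takes exactly those points where its constant beats the current value. By disjointness the final sum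
has at most one nonzero term at each point. -/
lemma exists_disjoint_selection {X α : Type*} [MeasurableSpace X] (c : α → ℝ≥0∞) (U : α → Set X)
    (hU : ∀ p, MeasurableSet (U p)) (I : Finset α) :
    ∃ E : α → Set X, (∀ p, MeasurableSet (E p)) ∧ (∀ p, E p ⊆ U p) ∧
      (I : Set α).PairwiseDisjoint E ∧
      ∀ x, ∀ p ∈ I, (U p).indicator (fun _ => c p) x ≤
        ∑ j ∈ I, (E j).indicator (fun _ => c j) x := by
  classical
  induction I using Finset.induction_on with
  | empty => exact ⟨fun _ => ∅, fun _ => .empty, fun _ => empty_subset _, by simp, by simp⟩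
  | insert i I hi ih =>
    obtain ⟨E, hEm, hEU, hEd, hE⟩ := ih
    set m : X → ℝ≥0∞ := fun x => ∑ j ∈ I, (E j).indicator (fun _ => c j) x with hm
    have hmm : Measurable m :=
      Finset.measurable_sum _ fun j _ => measurable_const.indicator (hEm j)
    set N : Set X := U i ∩ {x | m x < c i} with hN
    have hNm : MeasurableSet N := (hU i).inter (measurableSet_lt hmm measurable_const)
    have hne : ∀ j ∈ I, j ≠ i := fun j hj h => hi (h ▸ hj)
    refine ⟨fun j => if j = i then N else E j \ N, fun j => ?_, fun j => ?_, ?_, ?_⟩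
    · by_cases h : j = i
      · simp only [h, if_true]; exact hNm
      · simp only [h, if_false]; exact (hEm j).diff hNm
    · by_cases h : j = i
      · simp only [h, if_true]; exact inter_subset_left
      · simp only [h, if_false]; exact sdiff_subset.trans (hEU j)
    · intro j hj k hk hjk
      simp only [Function.onFun]
      by_cases h : j = i
      · have hk' : k ≠ i := fun h' => hjk (h.trans h'.symm)
        simp only [h, if_true, hk', if_false]
        exact disjoint_sdiff_right
      · by_cases h' : k = i
        · simp only [h, h', if_true, if_false]
          exact disjoint_sdiff_left
        · simp only [h, h', if_false]
          have hj' : j ∈ I := (Finset.mem_insert.1 hj).resolve_left h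
          have hk' : k ∈ I := (Finset.mem_insert.1 hk).resolve_left h'
          exact (hEd hj' hk' hjk).mono sdiff_subset sdiff_subset
    · intro x p hp
      rw [Finset.sum_insert hi]
      have hsum : ∑ j ∈ I, (if j = i then N else E j \ N).indicator (fun _ => c j) x =
          ∑ j ∈ I, (E j \ N).indicator (fun _ => c j) x :=
        Finset.sum_congr rfl fun j hj => by rw [if_neg (hne j hj)]
      rw [hsum]; simp only [if_true]
      by_cases hx : x ∈ N
      · rw [indicator_of_mem hx]
        refine le_trans ?_ le_self_add
        rcases Finset.mem_insert.1 hp with rfl | hp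
        · exact indicator_le_self' (fun _ _ => zero_le) x
        · exact (hE x p hp).trans hx.2.le
      · rw [indicator_of_notMem hx, zero_add]
        have he : ∑ j ∈ I, (E j \ N).indicator (fun _ => c j) x = m x :=
          Finset.sum_congr rfl fun j _ => by
            by_cases hxj : x ∈ E j
            · rw [indicator_of_mem hxj, indicator_of_mem (show x ∈ E j \ N from ⟨hxj, hx⟩)]
            · rw [indicator_of_notMem hxj, indicator_of_notMem fun h => hxj h.1]
        rw [he]
        rcases Finset.mem_insert.1 hp with rfl | hp
        · by_cases hxU : x ∈ U p
          · rw [indicator_of_mem hxU]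
            by_contra hcon
            exact hx ⟨hxU, not_le.1 hcon⟩
          · rw [indicator_of_notMem hxU]; exact zero_le
        · exact hE x p hp

/-- The integral of a supremum of constants on open sets is controlled by its finite
sub-suprema. -/
lemma lintegral_iSup_indicator_le {X α : Type*} [TopologicalSpace X] [SecondCountableTopology X]
    [MeasurableSpace X] [BorelSpace X] {ν : Measure X} (c : α → ℝ≥0∞) (U : α → Set X)
    (hU : ∀ p, IsOpen (U p)) {B : ℝ≥0∞}
    (hB : ∀ (I : Finset α) (E : α → Set X), (∀ p, MeasurableSet (E p)) → (∀ p, E p ⊆ U p) →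
      (I : Set α).PairwiseDisjoint E → ∑ j ∈ I, c j * ν (E j) ≤ B) :
    ∫⁻ x, ⨆ p, (U p).indicator (fun _ => c p) x ∂ν ≤ B := by
  classical
  obtain ⟨T, hT, hle⟩ := exists_countable_iSup_indicator c U hU
  have := hT.to_subtype
  refine (lintegral_mono hle).trans ?_
  -- Monotone convergence over finite subfamilies; on each of them the disjoint selection replaces
  -- the maximum by a sum.
  simp only [iSup_eq_iSup_finset fun p : T => (U p).indicator (fun _ => c p) _]
  rw [lintegral_iSup_directed]
  · refine iSup_le fun I => ?_
    obtain ⟨E, hEm, hEU, hEd, hE⟩ := exists_disjoint_selection c U (fun p => (hU p).measurableSet)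
      (I.image Subtype.val)
    refine le_trans ?_ (hB (I.image Subtype.val) E hEm hEU hEd)
    calc ∫⁻ x, ⨆ p ∈ I, (U p).indicator (fun _ => c p) x ∂ν
        ≤ ∫⁻ x, ∑ j ∈ I.image Subtype.val, (E j).indicator (fun _ => c j) x ∂ν :=
          lintegral_mono fun x => iSup₂_le fun p hp =>
            hE x p (Finset.mem_image_of_mem _ hp)
      _ = ∑ j ∈ I.image Subtype.val, c j * ν (E j) := by
          rw [lintegral_finsetSum _ fun j _ => measurable_const.indicator (hEm j)]
          exact Finset.sum_congr rfl fun j _ => lintegral_indicator_const (hEm j) _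
  · intro I
    exact (Measurable.biSup _ I.countable_toSet fun p _ =>
      measurable_const.indicator (hU p).measurableSet).aemeasurable
  · intro I I'
    refine ⟨I ∪ I', fun x => ?_, fun x => ?_⟩
    · exact biSup_mono fun p hp => Finset.mem_union_left _ hp
    · exact biSup_mono fun p hp => Finset.mem_union_right _ hp

end General

/-! ### Estimating the `BMO`-norm by duality with bounded atoms. -/

section Cc

variable {n : ℕ}

/-- A continuous function with compact support as an element of `ccSubmodule`. -/
noncomputable def ofCc (ψ : Eucl n → ℂ) (hc : Continuous ψ) (hs : HasCompactSupport ψ) :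
    ccSubmodule n :=
  ⟨⟨ψ, mem_bmoSubmodule_of_cc hc hs⟩, hc, hs⟩

@[simp] lemma toFun_ofCc (ψ : Eucl n → ℂ) (hc : Continuous ψ) (hs : HasCompactSupport ψ) :
    (ofCc ψ hc hs : BMOFun n).toFun = ψ := rfl

/-- The `BMO`-norm is controlled by the pairing with bounded atoms. -/
lemma bmoENorm_le_of_atoms {ψ : Eucl n → ℂ} (hψ : Continuous ψ) {D : ℝ}
    (h : ∀ (a : Eucl n → ℂ) (c : Eucl n) (r : ℝ), 0 < r → Integrable a →
      (∀ x, x ∉ ball c r → a x = 0) → (∀ x, ‖a x‖ ≤ (volume.real (ball c r))⁻¹) →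
      ∫ x, a x = 0 → ‖∫ x, a x * ψ x‖ ≤ D) : bmoENorm ψ ≤ ENNReal.ofReal (2 * D) := by
  refine iSup_le fun c => iSup_le fun r => iSup_le fun hr => ?_
  have hv0 := (measure_ball_pos volume c hr).ne'
  have hvt : volume (ball c r) ≠ ⊤ := measure_ball_lt_top.ne
  set V := volume.real (ball c r) with hV
  have hVpos : 0 < V := ENNReal.toReal_pos hv0 hvt
  set k := ⨍ y in ball c r, ψ y with hk
  -- The extremal atom is the conjugate phase of `ψ - k` minus its mean, divided by twice the volume
  -- since the difference has size at most 2. As `ψ - k` has mean zero, removing the mean of the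
  -- phase does not change the pairing, which is half the mean oscillation.
  set s : Eucl n → ℂ := fun x => (starRingEnd ℂ) (ψ x - k) / (‖ψ x - k‖ : ℂ) with hs
  have hs1 : ∀ x, ‖s x‖ ≤ 1 := by
    intro x
    simp only [hs, norm_div, RCLike.norm_conj, Complex.norm_real, norm_norm]
    exact div_self_le_one _
  have hsψ : ∀ x, s x * (ψ x - k) = (‖ψ x - k‖ : ℂ) := by
    intro x
    simp only [hs]
    rw [div_mul_eq_mul_div, Complex.conj_mul']
    by_cases hz : (‖ψ x - k‖ : ℂ) = 0
    · simp [hz]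
    · rw [pow_two, mul_div_assoc, div_self hz, mul_one]
  have hsm : Measurable s := by
    have h1 : Measurable fun x => ψ x - k := (hψ.sub continuous_const).measurable
    exact (Complex.continuous_conj.measurable.comp h1).div
      (Complex.continuous_ofReal.measurable.comp h1.norm)
  have hsi : IntegrableOn s (ball c r) := Measure.integrableOn_of_bounded hvt
    hsm.aestronglyMeasurable (ae_of_all _ hs1)
  have hψi : IntegrableOn (fun x => ψ x - k) (ball c r) :=
    integrableOn_sub_const hψ.locallyIntegrable k c r
  set σ := ⨍ y in ball c r, s y with hσ
  have hVσ : (V : ℂ) * σ = ∫ x in ball c r, s x := by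
    rw [hσ, setAverage_eq, Complex.real_smul, ← mul_assoc, ← Complex.ofReal_mul,
      mul_inv_cancel₀ hVpos.ne', Complex.ofReal_one, one_mul]
  have hσ1 : ‖σ‖ ≤ 1 := by
    rw [hσ, setAverage_eq, norm_smul, norm_inv, Real.norm_eq_abs, abs_of_pos hVpos,
      inv_mul_le_iff₀ hVpos]
    have := norm_setIntegral_le_of_norm_le_const (μ := volume) (s := ball c r) (f := s) (C := 1)
      measure_ball_lt_top fun x _ => hs1 x
    linarith
  set a : Eucl n → ℂ := (ball c r).indicator fun x => ((2 * V : ℝ) : ℂ)⁻¹ * (s x - σ) with ha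
  have haon : IntegrableOn (fun x => ((2 * V : ℝ) : ℂ)⁻¹ * (s x - σ)) (ball c r) :=
    (hsi.sub (integrableOn_const hvt)).const_mul _
  have hai : Integrable a := haon.integrable_indicator measurableSet_ball
  have ha0 : ∫ x, a x = 0 := by
    rw [ha, integral_indicator measurableSet_ball, integral_const_mul,
      integral_sub hsi (integrableOn_const hvt), setIntegral_const, ← hVσ, Complex.real_smul,
      sub_self, mul_zero]
  have hab : ∀ x, ‖a x‖ ≤ V⁻¹ := by
    intro x
    by_cases hx : x ∈ ball c r
    · rw [ha, indicator_of_mem hx, norm_mul, norm_inv, Complex.norm_real, Real.norm_eq_abs,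
        abs_of_pos (by positivity)]
      have : ‖s x - σ‖ ≤ 2 := (norm_sub_le _ _).trans (by linarith [hs1 x])
      calc (2 * V)⁻¹ * ‖s x - σ‖ ≤ (2 * V)⁻¹ * 2 := by gcongr
        _ = V⁻¹ := by field_simp
    · rw [ha, indicator_of_notMem hx, norm_zero]; positivity
  have hpair : ∫ x, a x * ψ x = (((2 * V)⁻¹ * ∫ x in ball c r, ‖ψ x - k‖ : ℝ) : ℂ) := by
    have e1 : ∫ x, a x * ψ x = ∫ x, a x * (ψ x - k) := by
      have hb2 : Integrable fun x => a x * (ψ x - k) := by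
        have : (fun x => a x * (ψ x - k)) = (ball c r).indicator
            fun x => ((2 * V : ℝ) : ℂ)⁻¹ * (s x - σ) * (ψ x - k) := by
          ext x
          by_cases hx : x ∈ ball c r
          · simp only [ha, indicator_of_mem hx]
          · simp only [ha, indicator_of_notMem hx, zero_mul]
        rw [this]
        refine IntegrableOn.integrable_indicator ?_ measurableSet_ball
        refine Integrable.bdd_mul (c := V⁻¹) hψi haon.aestronglyMeasurable ?_
        filter_upwards [ae_restrict_mem measurableSet_ball] with x hx
        have := hab x
        rwa [ha, indicator_of_mem hx] at this
      have : (fun x => a x * ψ x) = fun x => a x * (ψ x - k) + a x * k := by ext x; ring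
      rw [this, integral_add hb2 (hai.mul_const k), integral_mul_const, ha0, zero_mul, add_zero]
    have e2 : (fun x => a x * (ψ x - k)) = (ball c r).indicator
        fun x => ((2 * V : ℝ) : ℂ)⁻¹ * ((‖ψ x - k‖ : ℂ) - σ * (ψ x - k)) := by
      ext x
      by_cases hx : x ∈ ball c r
      · simp only [ha, indicator_of_mem hx]
        rw [← hsψ x]; ring
      · simp only [ha, indicator_of_notMem hx, zero_mul]
    have e3 : ∫ x in ball c r, (ψ x - k) = 0 := by
      rw [integral_sub (integrableOn_ball_of_loc hψ.locallyIntegrable c r)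
        (integrableOn_const hvt), setIntegral_const, hk, setAverage_eq, smul_inv_smul₀, sub_self]
      exact hVpos.ne'
    have hni : IntegrableOn (fun x => ((‖ψ x - k‖ : ℝ) : ℂ)) (ball c r) := hψi.norm.ofReal
    rw [e1, e2, integral_indicator measurableSet_ball, integral_const_mul,
      integral_sub hni (hψi.const_mul σ), integral_const_mul, e3, mul_zero, sub_zero]
    have e4 : ∫ x in ball c r, ((‖ψ x - k‖ : ℝ) : ℂ) = ((∫ x in ball c r, ‖ψ x - k‖ : ℝ) : ℂ) :=
      integral_complex_ofReal
    push_cast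
    rw [← e4]
  have hD := h a c r hr hai (fun x hx => by rw [ha, indicator_of_notMem hx]) hab ha0
  have hI0 : 0 ≤ ∫ x in ball c r, ‖ψ x - k‖ := integral_nonneg fun _ => norm_nonneg _
  rw [hpair, Complex.norm_real, Real.norm_eq_abs, abs_of_nonneg (by positivity),
    inv_mul_le_iff₀ (by positivity)] at hD
  rw [meanOsc, mul_comm, ← div_eq_mul_inv]
  refine ENNReal.div_le_of_le_mul ?_
  have hD0 : 0 ≤ 2 * D := by
    have : 0 ≤ 2 * V * D := hI0.trans hD
    by_contra! hneg
    nlinarith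
  rw [← ofReal_measureReal hvt, ← ENNReal.ofReal_mul hD0]
  simp only [← ofReal_norm]
  rw [← ofReal_integral_eq_lintegral_ofReal hψi.norm (ae_of_all _ fun _ => norm_nonneg _)]
  refine ENNReal.ofReal_le_ofReal (hD.trans (le_of_eq ?_))
  ring

lemma norm_cc_le_of_atoms (g : ccSubmodule n) {D : ℝ} (hD : 0 ≤ D)
    (h : ∀ (a : Eucl n → ℂ) (c : Eucl n) (r : ℝ), 0 < r → Integrable a →
      (∀ x, x ∉ ball c r → a x = 0) → (∀ x, ‖a x‖ ≤ (volume.real (ball c r))⁻¹) →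
      ∫ x, a x = 0 → ‖∫ x, a x * (g : BMOFun n).toFun x‖ ≤ D) : ‖ccToVMO n g‖ ≤ 2 * D := by
  rw [norm_ccToVMO, BMOFun.norm_def]
  exact ENNReal.toReal_le_of_le_ofReal (by positivity) (bmoENorm_le_of_atoms g.2.1 h)

lemma norm_cc_le_sup (g : ccSubmodule n) {D : ℝ} (hD : 0 ≤ D)
    (h : ∀ x, ‖(g : BMOFun n).toFun x‖ ≤ D) : ‖ccToVMO n g‖ ≤ 2 * D := by
  refine norm_cc_le_of_atoms g hD fun a c r hr ha hz hb _ => ?_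
  have hv0 := (measure_ball_pos volume c hr).ne'
  have hVpos : 0 < volume.real (ball c r) := ENNReal.toReal_pos hv0 measure_ball_lt_top.ne
  rw [← setIntegral_eq_integral_of_forall_compl_eq_zero (s := ball c r)
    fun x hx => by rw [hz x hx, zero_mul]]
  refine (norm_setIntegral_le_of_norm_le_const (C := (volume.real (ball c r))⁻¹ * D)
    measure_ball_lt_top fun x _ => ?_).trans (le_of_eq ?_)
  · rw [norm_mul]
    exact mul_le_mul (hb x) (h x) (norm_nonneg _) (by positivity)
  · field_simp

end Cc

/-! ### From values on dilates to an integrable density. -/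

section Reproducing

variable {n : ℕ} {K : ℝ} {φ : Eucl n → ℂ}

lemma exists_isTestFun_integral_pos (n : ℕ) (hK : 0 < K) :
    ∃ φ : Eucl n → ℂ, IsTestFun n K φ ∧ ∃ θ : ℝ, 0 < θ ∧ ∫ x, φ x = θ := by
  let f : ContDiffBump (0 : Eucl n) := ⟨1 / 4, 1 / 2, by norm_num, by norm_num⟩
  let g : Eucl n → ℂ := fun x => ((f x : ℝ) : ℂ)
  have hg : ContDiff ℝ ∞ g := Complex.ofRealCLM.contDiff.comp f.contDiff
  have hgs : HasCompactSupport g := f.hasCompactSupport.comp_left (g := Complex.ofReal) rfl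
  obtain ⟨C, hC⟩ := (hg.continuous_fderiv (by simp)).bounded_above_of_compact_support
    (hgs.fderiv ℝ)
  have hC0 : 0 ≤ C := (norm_nonneg _).trans (hC 0)
  have hk : 0 < K / (C + 1) := by positivity
  refine ⟨(K / (C + 1)) • g, ⟨contDiff_const.smul hg, ?_, fun x => ?_⟩,
    K / (C + 1) * ∫ x, f x, mul_pos hk f.integral_pos, ?_⟩
  · refine (closure_mono (Function.support_const_smul_subset _ _)).trans ?_
    refine (tsupport_comp_subset (g := Complex.ofReal) rfl f).trans ?_
    rw [f.tsupport_eq]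
    exact closedBall_subset_ball (by norm_num [f])
  · rw [fderiv_const_smul (hg.differentiable (by simp) x), norm_smul, Real.norm_eq_abs,
      abs_of_pos hk, div_mul_eq_mul_div, div_le_iff₀ (by positivity)]
    exact mul_le_mul_of_nonneg_left ((hC x).trans (by linarith)) hK.le
  · simp only [Pi.smul_apply, g]
    rw [integral_smul, integral_complex_ofReal, Complex.real_smul, Complex.ofReal_mul]

lemma integral_dilate {t : ℝ} (ht : 0 < t) (φ : Eucl n → ℂ) (z : Eucl n) :
    ∫ y, dilate φ t (y - z) = ∫ x, φ x := by
  rw [integral_sub_right_eq_self (dilate φ t) z]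
  unfold dilate
  rw [integral_smul, Measure.integral_comp_smul, finrank_euclideanSpace_fin, smul_smul,
    abs_of_pos (by positivity), inv_pow, inv_inv, inv_mul_cancel₀ (by positivity), one_smul]

/-- The dilate centred at `y` as a continuous function with compact support. -/
noncomputable def dilateCc (hφ : IsTestFun n K φ) {t : ℝ} (ht : 0 < t) (y : Eucl n) :
    ccSubmodule n :=
  ofCc (fun z => dilate φ t (y - z)) (continuous_dilate hφ t y) (hasCompactSupport_dilate hφ ht y)

/-- A continuous function with compact support as a bounded continuous function. -/
noncomputable def ccToBCF (n : ℕ) : ccSubmodule n →ₗ[ℂ] (Eucl n →ᵇ ℂ) where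
  toFun g := BoundedContinuousFunction.ofNormedAddCommGroup (g : BMOFun n).toFun g.2.1
    (g.2.1.bounded_above_of_compact_support g.2.2).choose
    (g.2.1.bounded_above_of_compact_support g.2.2).choose_spec
  map_add' _ _ := rfl
  map_smul' _ _ := rfl

/-- A functional on continuous functions with compact support is controlled by its values on the
dilates of a single test function. -/
lemma enorm_functional_le (hn : 1 ≤ n) (hK : 0 ≤ K) (hφ : IsTestFun n K φ)
    (ℓ : ccSubmodule n →ₗ[ℂ] ℂ) {C : ℝ} (hℓ : ∀ g, ‖ℓ g‖ ≤ C * ‖ccToBCF n g‖) {M : Eucl n → ℝ≥0∞}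
    (hM : ∀ (t : ℝ) (ht : 0 < t) (y : Eucl n), ‖ℓ (dilateCc hφ ht y)‖ₑ ≤ M y)
    (g : ccSubmodule n) :
    ‖(∫ x, φ x) * ℓ g‖ₑ ≤ ∫⁻ y, ‖(g : BMOFun n).toFun y‖ₑ * M y := by
  -- Bounded continuous functions form a Banach space, on which a bounded functional commutes with
  -- vector-valued integrals.
  obtain ⟨Λ, hΛ⟩ := exists_dual_factor (ccToBCF n) ℓ hℓ
  set ψ := (g : BMOFun n).toFun with hψ
  have hψc : Continuous ψ := g.2.1
  have hψs : HasCompactSupport ψ := g.2.2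
  refine ENNReal.le_of_forall_pos_le_add fun ε hε _ => ?_
  have hω := unitVol_pos (n := n)
  obtain ⟨δ, hδ, hδε⟩ : ∃ δ : ℝ, 0 < δ ∧ ‖Λ‖ * (δ * (2 * K * unitVol n)) ≤ ε := by
    refine ⟨ε / (‖Λ‖ * (2 * K * unitVol n) + 1), by positivity, ?_⟩
    rw [div_mul_eq_mul_div, mul_div_assoc', div_le_iff₀ (by positivity)]
    have : (0 : ℝ) ≤ ε := ε.2
    nlinarith
  obtain ⟨t, ht, hut⟩ := Metric.uniformContinuous_iff.1
    (hψs.uniformContinuous_of_continuous hψc) δ hδ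
  set Γ : Eucl n → (Eucl n →ᵇ ℂ) := fun y => ccToBCF n (dilateCc hφ ht y) with hΓ
  have hΓa : ∀ y z, Γ y z = dilate φ t (y - z) := fun y z => rfl
  have hΓc : Continuous Γ := by
    refine LipschitzWith.continuous (K := ((t ^ n)⁻¹ * (K * t⁻¹)).toNNReal) ?_
    refine LipschitzWith.of_dist_le_mul fun y y' => ?_
    rw [BoundedContinuousFunction.dist_le (by positivity)]
    intro z
    rw [hΓa, hΓa, dist_eq_norm]
    refine (dilate_lip hK hφ ht _ _).trans (le_of_eq ?_)
    rw [dist_sub_right, Real.coe_toNNReal _ (by positivity)]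
    ring
  have hi : Integrable fun y => ψ y • Γ y :=
    (hψc.smul hΓc).integrable_of_hasCompactSupport hψs.smul_right
  -- This superposition of dilates is a mollification of `ψ`, uniformly close to `(∫ φ) ψ` for small
  -- `t`, while `Λ I` involves only the values of `ℓ` on dilates.
  set I := ∫ y, ψ y • Γ y with hI
  have hIz : ∀ z, I z = ∫ y, ψ y * dilate φ t (y - z) := fun z => by
    have := (BoundedContinuousFunction.evalCLM ℂ z).integral_comp_comm hi
    exact this.symm
  have hΛI : Λ I = ∫ y, ψ y * ℓ (dilateCc hφ ht y) := by
    rw [hI, ← Λ.integral_comp_comm hi]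
    refine integral_congr_ae (ae_of_all _ fun y => ?_)
    simp only [map_smul, smul_eq_mul, hΓ, hΛ]
  have hclose : ‖(∫ x, φ x) • ccToBCF n g - I‖ ≤ δ * (2 * K * unitVol n) := by
    rw [BoundedContinuousFunction.norm_le (by positivity)]
    intro z
    have hdi : Integrable fun y => dilate φ t (y - z) := by
      refine Continuous.integrable_of_hasCompactSupport ?_ ?_
      · have := hφ.1.continuous
        unfold dilate
        fun_prop
      · refine HasCompactSupport.intro (isCompact_closedBall z t) fun y hy => ?_
        refine dilate_eq_zero hφ ht ?_
        rw [← dist_eq_norm]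
        exact le_of_lt (by simpa using hy)
    have hψi : Integrable fun y => ψ y * dilate φ t (y - z) := by
      obtain ⟨D, hD⟩ := hψc.bounded_above_of_compact_support hψs
      exact hdi.bdd_mul hψc.aestronglyMeasurable (ae_of_all _ hD)
    have e : ((∫ x, φ x) • ccToBCF n g - I) z
        = ∫ y, (ψ z - ψ y) * dilate φ t (y - z) := by
      have e1 : (fun y => (ψ z - ψ y) * dilate φ t (y - z)) =
          fun y => ψ z * dilate φ t (y - z) - ψ y * dilate φ t (y - z) := by
        ext y; ring
      rw [e1, integral_sub (hdi.const_mul _) hψi, integral_const_mul, integral_dilate ht, ← hIz,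
        mul_comm]
      rfl
    rw [e, ← setIntegral_eq_integral_of_forall_compl_eq_zero (s := ball z t) fun y hy => by
      rw [dilate_eq_zero hφ ht, mul_zero]
      rw [← dist_eq_norm]
      exact not_lt.1 hy]
    refine (norm_setIntegral_le_of_norm_le_const (C := δ * ((t ^ n)⁻¹ * (2 * K)))
      measure_ball_lt_top fun y hy => ?_).trans (le_of_eq ?_)
    · rw [norm_mul]
      refine mul_le_mul ?_ (norm_dilate_le hn hK hφ ht _) (norm_nonneg _) hδ.le
      rw [← dist_eq_norm, dist_comm]
      exact (hut hy).le
    · rw [volumeReal_ball z ht]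
      field_simp
  have hsplit : (∫ x, φ x) * ℓ g = Λ I + Λ ((∫ x, φ x) • ccToBCF n g - I) := by
    rw [map_sub, map_smul, hΛ, smul_eq_mul]; ring
  rw [hsplit]
  refine (enorm_add_le _ _).trans (add_le_add ?_ ?_)
  · rw [hΛI]
    refine (enorm_integral_le_lintegral_enorm _).trans (lintegral_mono fun y => ?_)
    rw [enorm_mul]
    gcongr
    exact hM t ht y
  · rw [← ofReal_norm, ← ENNReal.ofReal_coe_nnreal]
    refine ENNReal.ofReal_le_ofReal ((Λ.le_opNorm _).trans ?_)
    exact (mul_le_mul_of_nonneg_left hclose (norm_nonneg _)).trans hδε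

/-- A functional dominated by a weighted `L¹`-norm with integrable weight is given by an integrable
density. -/
lemma exists_density (ℓ : ccSubmodule n →ₗ[ℂ] ℂ) {M : Eucl n → ℝ≥0∞} (hMm : Measurable M)
    (hMi : ∫⁻ x, M x ≠ ⊤) {κ : ℝ} (hκ : 0 ≤ κ)
    (hℓ : ∀ g : ccSubmodule n, ‖ℓ g‖ₑ ≤ ENNReal.ofReal κ * ∫⁻ y, ‖(g : BMOFun n).toFun y‖ₑ * M y) :
    ∃ f : LOne n, ∀ g : ccSubmodule n, ℓ g = ∫ x, f x * (g : BMOFun n).toFun x := by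
  set N := volume.withDensity M with hN
  have : IsFiniteMeasure N := isFiniteMeasure_withDensity hMi
  have hfin : ∀ᵐ x, M x < ⊤ := ae_lt_top hMm hMi
  have hmem : ∀ g : ccSubmodule n, MemLp (g : BMOFun n).toFun 2 N := fun g =>
    Continuous.memLp_of_hasCompactSupport g.2.1 g.2.2
  let J : ccSubmodule n →ₗ[ℂ] Lp ℂ 2 N :=
    { toFun := fun g => (hmem g).toLp
      map_add' := fun g h => MemLp.toLp_add (hmem g) (hmem h)
      map_smul' := fun c g => MemLp.toLp_const_smul c (hmem g) }
  -- As `N` is finite, Cauchy–Schwarz turns the `L¹(N)` bound into an `L²(N)` bound, so the Hilbert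
  -- space representation theorem supplies the density. Its representing vector lies in `L¹(N)`,
  -- hence becomes integrable after multiplication by `M`.
  have hJ : ∀ g, ‖ℓ g‖ ≤ κ * (N univ ^ (1 / 2 : ℝ)).toReal * ‖J g‖ := by
    intro g
    have hNt : N univ ^ (1 / 2 : ℝ) ≠ ⊤ :=
      ENNReal.rpow_ne_top_of_nonneg (by norm_num) (measure_ne_top N univ)
    have h1 : ∫⁻ y, ‖(g : BMOFun n).toFun y‖ₑ * M y = eLpNorm (g : BMOFun n).toFun 1 N := by
      rw [eLpNorm_one_eq_lintegral_enorm, hN,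
        lintegral_withDensity_eq_lintegral_mul _ hMm g.2.1.measurable.enorm]
      simp only [Pi.mul_apply, mul_comm]
    have h2 : eLpNorm (g : BMOFun n).toFun 1 N ≤
        eLpNorm (g : BMOFun n).toFun 2 N * N univ ^ (1 / 2 : ℝ) := by
      refine (eLpNorm_le_eLpNorm_mul_rpow_measure_univ (q := 2) (by norm_num)
        (hmem g).1).trans (le_of_eq ?_)
      norm_num
    have h3 : ‖J g‖ = (eLpNorm (g : BMOFun n).toFun 2 N).toReal := Lp.norm_toLp _ (hmem g)
    have h4 : ‖ℓ g‖ₑ ≤ ENNReal.ofReal κ * (eLpNorm (g : BMOFun n).toFun 2 N *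
        N univ ^ (1 / 2 : ℝ)) := by
      refine (hℓ g).trans ?_
      rw [h1]
      gcongr
    have h5 := ENNReal.toReal_mono
      (ENNReal.mul_ne_top ENNReal.ofReal_ne_top (ENNReal.mul_ne_top (hmem g).2.ne hNt)) h4
    rw [toReal_enorm, ENNReal.toReal_mul, ENNReal.toReal_mul, ENNReal.toReal_ofReal hκ, ← h3] at h5
    linarith
  obtain ⟨Λ, hΛ⟩ := exists_dual_factor J ℓ hJ
  set h := (InnerProductSpace.toDual ℂ (Lp ℂ 2 N)).symm Λ with hh
  have hhi : Integrable (h : Eucl n → ℂ) N := (Lp.memLp h).integrable (by norm_num)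
  have hci : Integrable (fun x => (starRingEnd ℂ) (h x)) N :=
    Complex.conjCLE.toContinuousLinearMap.integrable_comp hhi
  have hfi : Integrable fun x => (M x).toReal • (starRingEnd ℂ) (h x) :=
    (integrable_withDensity_iff_integrable_smul' hMm hfin).1 hci
  refine ⟨hfi.toL1, fun g => ?_⟩
  rw [← hΛ, ← InnerProductSpace.toDual_symm_apply, L2.inner_def]
  have e1 : ∫ x, inner ℂ (h x) (J g x) ∂N =
      ∫ x, (starRingEnd ℂ) (h x) * (g : BMOFun n).toFun x ∂N := by
    refine integral_congr_ae ?_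
    filter_upwards [(hmem g).coeFn_toLp] with x hx
    have hx' : J g x = (g : BMOFun n).toFun x := hx
    rw [hx', RCLike.inner_apply, mul_comm]
  rw [← hh, e1]
  refine (integral_withDensity_eq_integral_toReal_smul hMm hfin _).trans ?_
  refine integral_congr_ae ?_
  filter_upwards [hfi.coeFn_toL1] with x hx
  rw [hx, smul_mul_assoc]

end Reproducing

/-! ### Representing functionals on `VMO` by Hardy space functions. -/

section Surjectivity

variable {n : ℕ} {b K : ℝ}

lemma le_grandMax {φ : Eucl n → ℂ} (hφ : IsTestFun n K φ) {t : ℝ} (ht : 0 < t) {x y : Eucl n}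
    (hxy : dist y x < b * t) (f : Eucl n → ℂ) : ‖convDilate f φ t y‖ₑ ≤ grandMax b K f x :=
  le_iSup₂_of_le φ hφ (le_iSup₂_of_le t ht (le_iSup₂_of_le y hxy le_rfl))

/-- A linear combination of dilates with coefficients bounded by the measures of disjoint sets on
which the dilates are admissible has controlled `BMO`-norm. -/
lemma norm_sum_dilateCc_le {A : ℝ} (hA : 0 ≤ A)
    (hmax : ∀ (a : Eucl n → ℂ) (c : Eucl n) (r B : ℝ), 0 < r → 0 ≤ B → Integrable a →
      (∀ x, x ∉ ball c r → a x = 0) → (∀ x, ‖a x‖ ≤ B) → ∫ x, a x = 0 →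
      ∫⁻ x, grandMax b K a x ≤ ENNReal.ofReal (A * (B * r ^ n)))
    {ι : Type*} (I : Finset ι) (φ : ι → Eucl n → ℂ) (hφ : ∀ j, IsTestFun n K (φ j)) (t : ι → ℝ)
    (ht : ∀ j, 0 < t j) (y : ι → Eucl n) (E : ι → Set (Eucl n)) (hE : ∀ j, MeasurableSet (E j))
    (hEb : ∀ j, E j ⊆ ball (y j) (b * t j)) (hd : (I : Set ι).PairwiseDisjoint E) (w : ι → ℂ)
    (hw : ∀ j, ‖w j‖ₑ ≤ volume (E j)) :
    ‖ccToVMO n (∑ j ∈ I, w j • dilateCc (hφ j) (ht j) (y j))‖ ≤ 2 * (A * (unitVol n)⁻¹) := by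
  have hω := unitVol_pos (n := n)
  refine norm_cc_le_of_atoms _ (by positivity) fun a c r hr ha hz hb h0 => ?_
  have hsum : ∫ x, a x * (((∑ j ∈ I, w j • dilateCc (hφ j) (ht j) (y j) : ccSubmodule n) :
      BMOFun n)).toFun x = ∑ j ∈ I, w j * convDilate a (φ j) (t j) (y j) := by
    have e : ∀ x, a x * (((∑ j ∈ I, w j • dilateCc (hφ j) (ht j) (y j) : ccSubmodule n) :
        BMOFun n)).toFun x = ∑ j ∈ I, w j * (a x * dilate (φ j) (t j) (y j - x)) := by
      intro x
      rw [Submodule.coe_sum, map_sum, Finset.sum_apply, Finset.mul_sum]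
      refine Finset.sum_congr rfl fun j _ => ?_
      rw [Submodule.coe_smul, map_smul, Pi.smul_apply, smul_eq_mul, mul_left_comm]
      rfl
    simp only [e]
    rw [integral_finsetSum _ fun j _ => (integrable_mul_dilate ha (hφ j) _ _).const_mul _]
    exact Finset.sum_congr rfl fun j _ => integral_const_mul _ _
  -- Every point of `E j` admits the `j`-th dilate, so the `j`-th term is at most the integral of
  -- the maximal function of `a` over `E j`; disjointness adds these up to one integral, bounded
  -- uniformly over atoms.
  have hle : ‖∑ j ∈ I, w j * convDilate a (φ j) (t j) (y j)‖ₑ ≤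
      ENNReal.ofReal (A * (unitVol n)⁻¹) := by
    calc ‖∑ j ∈ I, w j * convDilate a (φ j) (t j) (y j)‖ₑ
        ≤ ∑ j ∈ I, ‖w j * convDilate a (φ j) (t j) (y j)‖ₑ := enorm_sum_le _ _
      _ ≤ ∑ j ∈ I, ∫⁻ x in E j, grandMax b K a x := Finset.sum_le_sum fun j _ => by
          rw [enorm_mul]
          calc ‖w j‖ₑ * ‖convDilate a (φ j) (t j) (y j)‖ₑ
              ≤ ∫⁻ _ in E j, ‖convDilate a (φ j) (t j) (y j)‖ₑ := by
                rw [setLIntegral_const, mul_comm]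
                gcongr
                exact hw j
            _ ≤ ∫⁻ x in E j, grandMax b K a x := setLIntegral_mono' (hE j) fun x hx =>
                le_grandMax (hφ j) (ht j) (by rw [dist_comm]; exact hEb j hx) a
      _ = ∫⁻ x in ⋃ j ∈ I, E j, grandMax b K a x :=
          (lintegral_biUnion_finset hd (fun j _ => hE j) _).symm
      _ ≤ ∫⁻ x, grandMax b K a x := setLIntegral_le_lintegral _ _
      _ ≤ ENNReal.ofReal (A * ((volume.real (ball c r))⁻¹ * r ^ n)) :=
          hmax a c r _ hr (by positivity) ha hz hb h0
      _ = ENNReal.ofReal (A * (unitVol n)⁻¹) := by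
          rw [volumeReal_ball c hr]
          congr 2
          field_simp
  rw [hsum]
  rw [← ofReal_norm] at hle
  exact (ENNReal.ofReal_le_ofReal_iff (by positivity)).1 hle

/-- Every functional on `VMO` is the pairing with an integrable function whose grand maximal
function is controlled by the norm of the functional. -/
theorem exists_hardy_representative (hn : 1 ≤ n) (hb : 1 < b) (hK : 0 < K) :
    ∃ C : ℝ, 0 ≤ C ∧ ∀ Λ : StrongDual ℂ (VMO n), ∃ f : LOne n,
      hardyENorm b K f ≤ ENNReal.ofReal (C * ‖Λ‖) ∧
      ∀ g : ccSubmodule n, Λ (ccToVMO n g) = ∫ x, f x * (g : BMOFun n).toFun x := by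
  classical
  have hω := unitVol_pos (n := n)
  obtain ⟨A, hA, hmax⟩ := exists_lintegral_grandMax_le (n := n) hn hb hK
  refine ⟨2 * (A * (unitVol n)⁻¹), by positivity, fun Λ => ?_⟩
  let α : Type := {p : (Eucl n → ℂ) × ℝ × Eucl n // IsTestFun n K p.1 ∧ 0 < p.2.1}
  let Φ : α → ccSubmodule n := fun p => dilateCc p.2.1 p.2.2 p.1.2.2
  let c : α → ℝ≥0∞ := fun p => ‖Λ (ccToVMO n (Φ p))‖ₑ
  let U : α → Set (Eucl n) := fun p => ball p.1.2.2 (b * p.1.2.1)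
  have hU : ∀ p, IsOpen (U p) := fun p => isOpen_ball
  -- The grand maximal function of the functional itself, available before any density is known.
  set M : Eucl n → ℝ≥0∞ := fun x => ⨆ p, (U p).indicator (fun _ => c p) x with hM
  have hMm : Measurable M := LowerSemicontinuous.measurable <| lowerSemicontinuous_iSup fun p =>
    (hU p).lowerSemicontinuous_indicator zero_le
  have hMi : ∫⁻ x, M x ≤ ENNReal.ofReal (2 * (A * (unitVol n)⁻¹) * ‖Λ‖) := by
    refine lintegral_iSup_indicator_le c U hU fun I E hEm hEU hEd => ?_
    have hEt : ∀ j, volume (E j) ≠ ⊤ := fun j =>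
      ((measure_mono (hEU j)).trans_lt measure_ball_lt_top).ne
    set z : α → ℂ := fun j => Λ (ccToVMO n (Φ j)) with hz
    -- The phases make every term of `Λ (∑ w_j φ_j)` nonnegative, so no cancellation is lost.
    set w : α → ℂ := fun j => (volume.real (E j) : ℂ) * ((starRingEnd ℂ) (z j) / (‖z j‖ : ℂ))
      with hw
    have hwz : ∀ j, w j * z j = ((volume.real (E j) * ‖z j‖ : ℝ) : ℂ) := by
      intro j
      simp only [hw]
      rw [mul_assoc, div_mul_eq_mul_div, Complex.conj_mul', Complex.ofReal_mul]
      by_cases h : (‖z j‖ : ℂ) = 0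
      · simp [h]
      · rw [pow_two, mul_div_assoc, div_self h, mul_one]
    have hwn : ∀ j, ‖w j‖ₑ ≤ volume (E j) := by
      intro j
      rw [← ofReal_norm, ← ofReal_measureReal (hEt j)]
      refine ENNReal.ofReal_le_ofReal ?_
      simp only [hw, norm_mul, norm_div, RCLike.norm_conj, Complex.norm_real, norm_norm]
      rw [Real.norm_of_nonneg measureReal_nonneg]
      exact mul_le_of_le_one_right measureReal_nonneg (div_self_le_one _)
    have hv := norm_sum_dilateCc_le hA hmax I (fun j => j.1.1) (fun j => j.2.1) (fun j => j.1.2.1)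
      (fun j => j.2.2) (fun j => j.1.2.2) E hEm hEU hEd w hwn
    set v := ∑ j ∈ I, w j • dilateCc j.2.1 j.2.2 j.1.2.2 with hvdef
    have hΛv : Λ (ccToVMO n v) = ((∑ j ∈ I, volume.real (E j) * ‖z j‖ : ℝ) : ℂ) := by
      rw [hvdef, map_sum, map_sum, Complex.ofReal_sum]
      refine Finset.sum_congr rfl fun j _ => ?_
      rw [map_smul, map_smul, smul_eq_mul, ← hwz]
    have hsum0 : 0 ≤ ∑ j ∈ I, volume.real (E j) * ‖z j‖ :=
      Finset.sum_nonneg fun j _ => by positivity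
    have hbound : ∑ j ∈ I, volume.real (E j) * ‖z j‖ ≤ 2 * (A * (unitVol n)⁻¹) * ‖Λ‖ := by
      have h1 := Λ.le_opNorm (ccToVMO n v)
      rw [hΛv, Complex.norm_real, Real.norm_of_nonneg hsum0] at h1
      refine h1.trans ?_
      rw [mul_comm]
      exact mul_le_mul_of_nonneg_right hv (norm_nonneg _)
    refine le_trans (le_of_eq ?_) (ENNReal.ofReal_le_ofReal hbound)
    rw [ENNReal.ofReal_sum_of_nonneg fun j _ => by positivity]
    refine Finset.sum_congr rfl fun j _ => ?_
    rw [ENNReal.ofReal_mul measureReal_nonneg, ofReal_measureReal (hEt j), ofReal_norm, mul_comm]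
  have hcM : ∀ p x, x ∈ U p → c p ≤ M x := fun p x hx => by
    refine le_trans (le_of_eq ?_) (le_iSup (fun p => (U p).indicator (fun _ => c p) x) p)
    rw [indicator_of_mem hx]
  let ℓ : ccSubmodule n →ₗ[ℂ] ℂ := Λ.toLinearMap.comp (ccToVMO n)
  have hℓ : ∀ g, ‖ℓ g‖ ≤ 2 * ‖Λ‖ * ‖ccToBCF n g‖ := fun g => by
    have h1 := norm_cc_le_sup g (norm_nonneg (ccToBCF n g)) fun x =>
      (ccToBCF n g).norm_coe_le_norm x
    have h2 : ‖ℓ g‖ ≤ ‖Λ‖ * ‖ccToVMO n g‖ := Λ.le_opNorm _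
    nlinarith [norm_nonneg Λ]
  obtain ⟨φ, hφ, θ, hθ, hφθ⟩ := exists_isTestFun_integral_pos n hK
  have hdom : ∀ g : ccSubmodule n, ‖ℓ g‖ₑ ≤
      ENNReal.ofReal θ⁻¹ * ∫⁻ y, ‖(g : BMOFun n).toFun y‖ₑ * M y := by
    intro g
    have h := enorm_functional_le hn hK.le hφ ℓ hℓ (M := M) (fun t ht y =>
      hcM ⟨(φ, t, y), hφ, ht⟩ y (mem_ball_self (mul_pos (by linarith) ht))) g
    rw [hφθ, enorm_mul] at h
    have hθe : ‖(θ : ℂ)‖ₑ = ENNReal.ofReal θ := by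
      rw [← ofReal_norm, Complex.norm_real, Real.norm_of_nonneg hθ.le]
    calc ‖ℓ g‖ₑ = ENNReal.ofReal θ⁻¹ * (‖(θ : ℂ)‖ₑ * ‖ℓ g‖ₑ) := by
          rw [← mul_assoc, hθe, ← ENNReal.ofReal_mul (by positivity), inv_mul_cancel₀ hθ.ne',
            ENNReal.ofReal_one, one_mul]
      _ ≤ _ := by gcongr
  obtain ⟨f, hf⟩ := exists_density ℓ hMm (hMi.trans_lt ENNReal.ofReal_lt_top).ne
    (inv_nonneg.2 hθ.le) hdom
  -- Convolving `f` with a dilate evaluates `Λ` on that dilate, so the grand maximal function of `f`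
  -- is bounded by `M`.
  refine ⟨f, (lintegral_mono fun x => ?_).trans hMi, hf⟩
  refine iSup_le fun φ => iSup_le fun hφ => iSup_le fun t => iSup_le fun ht => iSup_le fun y =>
    iSup_le fun hy => ?_
  have h := hcM ⟨(φ, t, y), hφ, ht⟩ x (by rw [mem_ball, dist_comm]; exact hy)
  refine le_trans (le_of_eq ?_) h
  have := hf (dilateCc hφ ht y)
  exact congrArg enorm this.symm

end Surjectivity

/-! ### The isomorphism and the atomic pairing. -/

section Duality

variable {n : ℕ} {b K : ℝ}

lemma eq_zero_of_forall_cc {f : LOne n}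
    (h : ∀ g : ccSubmodule n, ∫ x, f x * (g : BMOFun n).toFun x = 0) : f = 0 := by
  refine (Lp.eq_zero_iff_ae_eq_zero).2 ?_
  refine ae_eq_zero_of_integral_contDiff_smul_eq_zero (L1.integrable_coeFn f).locallyIntegrable
    fun g hg hgs => ?_
  rw [← h (ofCc (fun x => (g x : ℂ)) (Complex.continuous_ofReal.comp hg.continuous)
    (hgs.comp_left (g := Complex.ofReal) rfl))]
  refine integral_congr_ae (ae_of_all _ fun x => ?_)
  simp only [toFun_ofCc, Complex.real_smul, mul_comm]

/-- The functionals on `VMO` and the functions in the Hardy space correspond to each other through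
the pairing with continuous functions of compact support. -/
theorem exists_duality (hn : 1 ≤ n) (hb : 1 < b) (hK : 0 < K) :
    ∃ T : Hardy n b K ≃L[ℂ] StrongDual ℂ (VMO n), ∀ (f : Hardy n b K) (g : ccSubmodule n),
      T f (ccToVMO n g) = ∫ x, f.toL1 x * (g : BMOFun n).toFun x := by
  obtain ⟨A, hA, hdec⟩ := exists_atomic_decomposition (n := n) hn hb hK
  obtain ⟨S, hS, hpair⟩ := exists_pairing_functional n (q := ⊤) ENNReal.one_lt_top
  obtain ⟨C, hC, hsurj⟩ := exists_hardy_representative (n := n) hn hb hK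
  have hex : ∀ f : Hardy n b K, ∃ Λ : StrongDual ℂ (VMO n), ‖Λ‖ ≤ S * A * ‖f‖ ∧
      ∀ g : ccSubmodule n, Λ (ccToVMO n g) = ∫ x, f.toL1 x * (g : BMOFun n).toFun x := by
    intro f
    obtain ⟨μ, a, hd, hle⟩ := hdec f.toL1 f.2
    obtain ⟨Λ, hΛ, hΛg⟩ := hpair μ a f.toL1 hd
    refine ⟨Λ.comp (VMO n).subtypeL, ?_, fun g => ?_⟩
    · refine (Λ.opNorm_comp_le _).trans ?_
      refine (mul_le_of_le_one_right (norm_nonneg _) (VMO n).norm_subtypeL_le).trans ?_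
      rw [mul_assoc]
      exact hΛ.trans (mul_le_mul_of_nonneg_left hle hS.le)
    · rw [← tsum_pairing_eq_integral hd g.2.1 g.2.2]
      exact (hΛg g).2.2
  choose Λ hΛn hΛg using hex
  have hfi : ∀ (f : LOne n) (g : ccSubmodule n),
      Integrable fun x => f x * (g : BMOFun n).toFun x := fun f g => by
    obtain ⟨D, hD⟩ := g.2.1.bounded_above_of_compact_support g.2.2
    exact (L1.integrable_coeFn f).mul_bdd g.2.1.aestronglyMeasurable (ae_of_all _ hD)
  -- The functionals come from arbitrarily chosen atomic decompositions; they depend linearly on `f`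
  -- because their values on compactly supported functions do.
  let T₀ : Hardy n b K →ₗ[ℂ] StrongDual ℂ (VMO n) :=
    { toFun := Λ
      map_add' := fun f₁ f₂ => ext_on_cc fun g => by
        rw [add_apply, hΛg, hΛg, hΛg, ← integral_add (hfi _ g) (hfi _ g),
          map_add]
        refine integral_congr_ae ?_
        filter_upwards [Lp.coeFn_add f₁.toL1 f₂.toL1] with x hx
        rw [hx, Pi.add_apply, add_mul]
      map_smul' := fun c f => ext_on_cc fun g => by
        rw [RingHom.id_apply, smul_apply, hΛg, hΛg, smul_eq_mul,
          ← integral_const_mul, map_smul]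
        refine integral_congr_ae ?_
        filter_upwards [Lp.coeFn_smul c f.toL1] with x hx
        rw [hx, Pi.smul_apply, smul_eq_mul, mul_assoc] }
  have hinj : Function.Injective T₀ := by
    refine (injective_iff_map_eq_zero T₀).2 fun f hf => ?_
    refine Subtype.ext (eq_zero_of_forall_cc fun g => ?_)
    have := hΛg f g
    rw [show Λ f = 0 from hf, zero_apply] at this
    exact this.symm
  -- The preimage comes with a norm bound, so continuity of the inverse requires neither the open
  -- mapping theorem nor completeness of the Hardy space.
  have hex' : ∀ L : StrongDual ℂ (VMO n), ∃ f : Hardy n b K, T₀ f = L ∧ ‖f‖ ≤ C * ‖L‖ := by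
    intro L
    obtain ⟨f, hf, hfg⟩ := hsurj L
    refine ⟨⟨f, hf.trans_lt ENNReal.ofReal_lt_top⟩, ext_on_cc fun g => ?_, ?_⟩
    · rw [hfg]
      exact hΛg _ g
    · exact ENNReal.toReal_le_of_le_ofReal (by positivity) hf
  let T₁ := LinearEquiv.ofBijective T₀ ⟨hinj, fun L => (hex' L).imp fun _ h => h.1⟩
  have hinv : ∀ L, ‖T₁.symm L‖ ≤ C * ‖L‖ := fun L => by
    obtain ⟨f, rfl, hf⟩ := hex' L
    have : T₁.symm (T₀ f) = f := T₁.symm_apply_apply f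
    rw [this]
    exact hf
  let T : Hardy n b K ≃L[ℂ] StrongDual ℂ (VMO n) :=
    LinearEquiv.toContinuousLinearEquivOfBounds (𝕜 := ℂ) (𝕜₂ := ℂ) (σ := RingHom.id ℂ)
      (σ₂₁ := RingHom.id ℂ) (E := Hardy n b K) (F := StrongDual ℂ (VMO n)) T₁ (S * A) C hΛn hinv
  have hT : ∀ f, T f = Λ f := fun f => rfl
  exact ⟨T, fun f g => by rw [hT, hΛg]⟩

end Duality

theorem proposition6p30 (n : ℕ) (hn : 1 ≤ n) (b K : ℝ) (hb : 1 < b) (hK : 0 < K) :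
    ∃ T : Hardy n b K ≃L[ℂ] StrongDual ℂ (VMO n),
      ∀ q : ℝ≥0∞, 1 < q → ∀ f : Hardy n b K,
        (∃ (μ : ℕ → ℂ) (a : ℕ → LOne n), IsAtomicDecomposition q μ a f.toL1) ∧
        ∀ (μ : ℕ → ℂ) (a : ℕ → LOne n), IsAtomicDecomposition q μ a f.toL1 →
          ∀ (v : VMO n) (g : BMOFun n), BMO.mk g = (v : BMO n) →
            (∀ j, Integrable (fun x => a j x * g.toFun x)) ∧
            Summable (fun j => ‖μ j * ∫ x, a j x * g.toFun x‖) ∧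
            T f v = ∑' j, μ j * ∫ x, a j x * g.toFun x := by
  obtain ⟨T, hT⟩ := exists_duality (n := n) hn hb hK
  obtain ⟨A, -, hdec⟩ := exists_atomic_decomposition (n := n) hn hb hK
  refine ⟨T, fun q hq f => ⟨?_, fun μ a hd v g hv => ?_⟩⟩
  · obtain ⟨μ, a, hd, -⟩ := hdec f.toL1 f.2
    exact ⟨μ, a, fun j => (hd.atom j).of_top, hd.summable, hd.hasSum⟩
  · obtain ⟨S, -, hpair⟩ := exists_pairing_functional n hq
    obtain ⟨Λ, -, hΛ⟩ := hpair μ a f.toL1 hd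
    obtain ⟨h1, h2, h3⟩ := hΛ g
    refine ⟨h1, h2, ?_⟩
    -- The functional of the given decomposition and `T f` are both integration against `f` on
    -- compactly supported functions, so they agree on `VMO n` by density.
    have he : T f = Λ.comp (VMO n).subtypeL := ext_on_cc fun g' => by
      rw [hT, ← tsum_pairing_eq_integral hd g'.2.1 g'.2.2]
      exact (hΛ g').2.2.symm
    rw [he, ← h3, hv]
    rfl
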